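/- **Definitions.** An *$m$-player one-round game* consists of a probability distribution $\pi$ with finite support on $m$-tuples of questions and a predicate $V(a_1,\dots,a_m\mid q_1,\dots,q_m)\in\{0,1\}$. The players win with probability $\sum_{q}\pi(q)\sum_a S(a\mid q)V(a\mid q)$ when their answers are distributed according to $S(\cdot\mid q)$. The *classical value* $w_{\mathrm c}(G)$, the *entangled value* $w_{\mathrm q}(G)$ and the *commuting-operator value* $w_{\mathrm{com}}(G)$ are the suprema of the winning probability over players who, respectively: share only a random source; share a quantum state on a tensor product $\mathbb C^{d_1}\otimes\dots\otimes\mathbb C^{d_m}$ and measure their own factors with POVMs; share a density operator $\rho$ on an arbitrary Hilbert space and measure it with POVMs $(M^{(i)}_{q,a})_a$ on the whole space such that $M^{(i)}_{q,a}$ and $M^{(i')}_{q',a'}$ commute for $i\neq i'$, so that $S(a\mid q)=\operatorname{tr}\rho M^{(1)}_{q_1,a_1}\cdots M^{(m)}_{q_m,a_m}$. An *$m$-prover one-round interactive proof system* is a pair $(M_\pi,M_V)$ of polynomial-time machines: $M_\pi$ is probabilistic and generates $m$ questions from the input $x$; $M_V$ is deterministic and accepts or rejects given $x$, the $m$ questions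 and the $m$ answers. On each input $x$ it defines a game $G_x$. $\mathrm{MIP}^*_{c(n),s(n)}(m,1)$ is the class of languages $L$ having such a system with $w_{\mathrm q}(G_x)\ge c(|x|)$ for all $x\in L$ and $w_{\mathrm q}(G_x)\le s(|x|)$ for all $x\notin L$. $\mathrm{naPCP}_{c(n),s(n)}(r(n),k)$ is the class of languages $L$ having a probabilistic polynomial-time verifier that, on inputs of length $n$, tosses at most $r(n)$ fair coins, determines from the input and the coins $k$ positions of a proof string, reads these $k$ bits non-adaptively, and then accepts or rejects depending on the input, its coins and the $k$ bits, such that for $x\in L$ some proof is accepted with probability at least $c(|x|)$, and for $x\notin L$ every proof is accepted with probability at most $s(|x|)$. **Theorem.** There is an absolute constant $C$ such that the following holds for all functions $s\colon\mathbb Z_{\ge0}\to[0,1]$ and $r\colon\mathbb Z_{\ge0}\to\mathbb Z_{\ge0}$. Let $$\varepsilon(n)=\tfrac{1}{384}\,(1-s(n))^2\cdot2^{-2r(n)}.$$ Then $$\mathrm{naPCP}_{1,s(n)}(r(n),3)\subseteq\mathrm{MIP}^*_{1,1-\varepsilon(n)}(3,1).$$ More precisely, every $L\in\mathrm{naPCP}_{1,s(n)}(r(n),3)$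 has a three-prover one-round interactive proof system in which the verifier tosses at most $r(n)+C$ fair coins on inputs of length $n$, each prover answers one bit, and * for every $x\in L$, $w_{\mathrm c}(G_x)\ge1$ and $w_{\mathrm q}(G_x)\ge 1$ (honest provers need no entanglement); * for every $x\notin L$, $w_{\mathrm q}(G_x)\le1-\varepsilon(|x|)$ and even $w_{\mathrm{com}}(G_x)\le1-\varepsilon(|x|)$ (soundness also holds against commuting-operator provers). -/

import Mathlib

namespace ProverGames

/-! ## Machines

A machine has a finite control and finitely many stacks of bits (a Turing tape is a pair of stacks,
and a larger tape alphabet is a tuple of parallel stacks), among them designated input and output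
stacks. One instruction is one step. The instruction `toss` draws a fresh fair coin. -/

inductive Instr (K Λ : Type) : Type
  | push (k : K) (b : Bool) (next : Λ)
  | pop (k : K) (next : Option Bool → Λ)
  | toss (next : Bool → Λ)
  | halt

/-- A machine with input stacks `ι`, output stacks `ο` and work stacks `W`. -/
structure Machine (ι ο : Type) where
  W : Type
  finiteW : Finite W
  Λ : Type
  finiteΛ : Finite Λ
  start : Λ
  program : Λ → Instr (ι ⊕ ο ⊕ W) Λ

/-- Current state, contents of the stacks (top first), and the number of coins tossed so far. -/
structure Cfg (K Λ : Type) where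
  label : Λ
  stk : K → List Bool
  tossed : ℕ

namespace Machine

variable {ι ο : Type}

/-- One step; the `i`-th coin toss of the computation has the result `ω i`. A machine that has
halted stays where it is. Popping the empty stack yields `none` and leaves it empty. -/
noncomputable def step (M : Machine ι ο) (ω : ℕ → Bool) (c : Cfg (ι ⊕ ο ⊕ M.W) M.Λ) :
    Cfg (ι ⊕ ο ⊕ M.W) M.Λ := by
  classical
  exact match M.program c.label with
    | .push k b l => ⟨l, Function.update c.stk k (b :: c.stk k), c.tossed⟩
    | .pop k l => ⟨l (c.stk k).head?, Function.update c.stk k (c.stk k).tail, c.tossed⟩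
    | .toss l => ⟨l (ω c.tossed), c.stk, c.tossed + 1⟩
    | .halt => c

/-- Initial configuration: the inputs are on the input stacks, all other stacks are empty. -/
def init (M : Machine ι ο) (inp : ι → List Bool) : Cfg (ι ⊕ ο ⊕ M.W) M.Λ where
  label := M.start
  stk := Sum.elim inp (fun _ => [])
  tossed := 0

/-- The configuration after `t` steps. -/
noncomputable def run (M : Machine ι ο) (inp : ι → List Bool) (ω : ℕ → Bool) (t : ℕ) :
    Cfg (ι ⊕ ο ⊕ M.W) M.Λ :=
  (M.step ω)^[t] (M.init inp)

/-- The machine halts after at most `t` steps. -/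
def HaltsBy (M : Machine ι ο) (inp : ι → List Bool) (ω : ℕ → Bool) (t : ℕ) : Prop :=
  M.program (M.run inp ω t).label = Instr.halt

/-- Contents of the output stacks after `t` steps. -/
noncomputable def output (M : Machine ι ο) (inp : ι → List Bool) (ω : ℕ → Bool) (t : ℕ) (o : ο) :
    List Bool :=
  (M.run inp ω t).stk (Sum.inr (Sum.inl o))

/-- The machine never tosses a coin. -/
def IsDeterministic (M : Machine ι ο) : Prop :=
  ∀ l next, M.program l ≠ Instr.toss next

end Machine

/-- The infinite coin sequence that starts with the `R` coins `ρ`; only those matter for a machine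
that tosses at most `R` coins. -/
def coinSeq {R : ℕ} (ρ : Fin R → Bool) : ℕ → Bool :=
  fun i => if h : i < R then ρ ⟨i, h⟩ else false

/-! ## Non-adaptive probabilistically checkable proofs -/

inductive QueryOutput (k : ℕ) : Type
  | address (i : Fin k)
  | memory

inductive DeciderInput (k : ℕ) : Type
  | input
  | memory
  | answer (i : Fin k)

/-- The inputs of the second phase of a PCP verifier. -/
def deciderInput {k : ℕ} (x mem : List Bool) (b : Fin k → Bool) : DeciderInput k → List Bool
  | .input => x
  | .memory => mem
  | .answer i => [b i]

/-- A polynomial-time verifier with `k` non-adaptive queries. In the first phase it tosses coins and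
writes down `k` addresses of proof bits, and a string that it keeps as private memory (for example
all its coins). In the second phase it decides deterministically from the input, its private memory
and the `k` proof bits. An address is a bit string `w`; it names the position with the binary
numeral `1w`, so that addresses and positive integers correspond one to one. -/
structure PCPVerifier (k : ℕ) where
  query : Machine Unit (QueryOutput k)
  decide : Machine (DeciderInput k) Unit
  queryTime : Polynomial ℕ
  decideTime : Polynomial ℕ
  /-- bound on the number of coins, as a function of the input length -/
  coins : ℕ → ℕ
  query_halts : ∀ (x : List Bool) (ω : ℕ → Bool),
    query.HaltsBy (fun _ => x) ω (queryTime.eval x.length)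
  query_coins : ∀ (x : List Bool) (ω : ℕ → Bool) (t : ℕ),
    (query.run (fun _ => x) ω t).tossed ≤ coins x.length
  decide_det : decide.IsDeterministic
  decide_halts : ∀ (x mem : List Bool) (b : Fin k → Bool),
    decide.HaltsBy (deciderInput x mem b) (fun _ => false)
      (decideTime.eval (x.length + mem.length + k))

namespace PCPVerifier

variable {k : ℕ}

noncomputable def queryOutput (V : PCPVerifier k) (x : List Bool)
    (ρ : Fin (V.coins x.length) → Bool) (o : QueryOutput k) : List Bool :=
  V.query.output (fun _ => x) (coinSeq ρ) (V.queryTime.eval x.length) o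

/-- The verifier accepts, with coins `ρ`, the string `proof`. -/
def Accepts (V : PCPVerifier k) (x : List Bool) (proof : List Bool → Bool)
    (ρ : Fin (V.coins x.length) → Bool) : Prop :=
  V.decide.output
      (deciderInput x (V.queryOutput x ρ .memory) (fun i => proof (V.queryOutput x ρ (.address i))))
      (fun _ => false)
      (V.decideTime.eval (x.length + (V.queryOutput x ρ .memory).length + k)) () = [true]

open Classical in
/-- The probability, over uniform coins, that the string `proof` is accepted. -/
noncomputable def acceptProb (V : PCPVerifier k) (x : List Bool) (proof : List Bool → Bool) : ℝ :=
  (∑ ρ : Fin (V.coins x.length) → Bool, if V.Accepts x proof ρ then (1 : ℝ) else 0)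
    / 2 ^ V.coins x.length

end PCPVerifier

/-- Languages with a non-adaptive PCP verifier that makes `k` queries, tosses at most `r n` coins
and has completeness `c n` and soundness `s n` on inputs of length `n`. -/
def naPCP (c s : ℕ → ℝ) (r : ℕ → ℕ) (k : ℕ) : Set (Language Bool) :=
  {L | ∃ V : PCPVerifier k, (∀ n, V.coins n ≤ r n) ∧
    (∀ x ∈ L, ∃ proof : List Bool → Bool, c x.length ≤ V.acceptProb x proof) ∧
    (∀ x, x ∉ L → ∀ proof : List Bool → Bool, V.acceptProb x proof ≤ s x.length)}

/-! ## Cooperative one-round games -/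

/-- An `m`-player game: a finitely supported probability distribution on question tuples and a
predicate on questions and answers. -/
structure Game (m : ℕ) (Q A : Type) where
  π : (Fin m → Q) →₀ ℝ
  nonneg : ∀ q, 0 ≤ π q
  total : (π.sum fun _ p => p) = 1
  wins : (Fin m → Q) → (Fin m → A) → Prop

/-- `S q a` is the probability of the answers `a` to the questions `q`. -/
abbrev Behavior (m : ℕ) (Q A : Type) : Type := (Fin m → Q) → (Fin m → A) → ℝ

section

variable {m : ℕ} {Q A : Type} [Fintype A]

open Classical in
noncomputable def Game.winProb (G : Game m Q A) (S : Behavior m Q A) : ℝ :=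
  G.π.sum fun q p => p * ∑ a : Fin m → A, S q a * (if G.wins q a then 1 else 0)

open Classical in
/-- Behaviors of players who share a random source only. -/
def IsClassical (S : Behavior m Q A) : Prop :=
  ∃ (N : ℕ) (p : Fin N → ℝ) (f : Fin N → Fin m → Q → A),
    (∀ j, 0 ≤ p j) ∧ ∑ j, p j = 1 ∧
    ∀ q a, S q a = ∑ j, p j * (if ∀ i, f j i (q i) = a i then 1 else 0)

/-- The tensor product of the square matrices `M i`. -/
def tensorMatrix {d : Fin m → ℕ} (M : (i : Fin m) → Matrix (Fin (d i)) (Fin (d i)) ℂ) :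
    Matrix ((i : Fin m) → Fin (d i)) ((i : Fin m) → Fin (d i)) ℂ :=
  Matrix.of fun j k => ∏ i, M i (j i) (k i)

open scoped ComplexOrder in
/-- Behaviors of isolated players who share a state `ρ` of `ℂ^(d 0) ⊗ ⋯ ⊗ ℂ^(d (m-1))` and measure
their own tensor factors with POVMs. -/
def IsEntangled (S : Behavior m Q A) : Prop :=
  ∃ (d : Fin m → ℕ) (ρ : Matrix ((i : Fin m) → Fin (d i)) ((i : Fin m) → Fin (d i)) ℂ)
    (M : (i : Fin m) → Q → A → Matrix (Fin (d i)) (Fin (d i)) ℂ),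
    ρ.PosSemidef ∧ ρ.trace = 1 ∧
    (∀ i q a, (M i q a).PosSemidef) ∧ (∀ i q, ∑ a, M i q a = 1) ∧
    ∀ q a, S q a = (ρ * tensorMatrix fun i => M i (q i) (a i)).trace.re

/-- Behaviors of commuting-operator players: a Hilbert space `H`, a state `∑ k, |ψ k⟩⟨ψ k|` of trace
one (every density operator on `H` is of this form), and POVMs on all of `H`, such that the
operators of different players commute. -/
def IsCommutingOperator (S : Behavior m Q A) : Prop :=
  ∃ (H : Type) (_ : NormedAddCommGroup H) (_ : InnerProductSpace ℂ H) (_ : CompleteSpace H)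
    (ψ : ℕ → H) (M : Fin m → Q → A → (H →L[ℂ] H)),
    HasSum (fun k => ‖ψ k‖ ^ 2) 1 ∧
    (∀ i q a, (M i q a).IsPositive) ∧ (∀ i q, ∑ a, M i q a = 1) ∧
    (∀ i i', i ≠ i' → ∀ q a q' a', Commute (M i q a) (M i' q' a')) ∧
    ∀ q a, S q a = ∑' k, (inner ℂ (ψ k) ((List.ofFn fun i => M i (q i) (a i)).prod (ψ k))).re

/-- The supremum of the winning probabilities over all classical behaviors. -/
noncomputable def Game.classicalValue (G : Game m Q A) : ℝ :=
  sSup {w | ∃ S : Behavior m Q A, IsClassical S ∧ w = G.winProb S}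

/-- The supremum of the winning probabilities over all entangled behaviors. -/
noncomputable def Game.entangledValue (G : Game m Q A) : ℝ :=
  sSup {w | ∃ S : Behavior m Q A, IsEntangled S ∧ w = G.winProb S}

/-- The supremum of the winning probabilities over all commuting-operator behaviors. -/
noncomputable def Game.commutingValue (G : Game m Q A) : ℝ :=
  sSup {w | ∃ S : Behavior m Q A, IsCommutingOperator S ∧ w = G.winProb S}

end

/-! ## One-round multi-prover interactive proof systems -/

inductive RefereeInput (m : ℕ) : Type
  | input
  | question (i : Fin m)
  | answer (i : Fin m)

/-- The inputs of the machine that judges the answers: the input, the questions, the answers. -/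
def refereeInput {m : ℕ} (x : List Bool) (q a : Fin m → List Bool) : RefereeInput m → List Bool
  | .input => x
  | .question i => q i
  | .answer i => a i

/-- A classical polynomial-time verifier of an `m`-prover one-round interactive proof system: a
probabilistic machine that generates the `m` questions from the input, and a deterministic machine
that accepts or rejects on the input, the questions and the answers alone. Each prover answers with
`answerLength.eval n` bits on inputs of length `n`. -/
structure MIPVerifier (m : ℕ) where
  ask : Machine Unit (Fin m)
  judge : Machine (RefereeInput m) Unit
  askTime : Polynomial ℕ
  judgeTime : Polynomial ℕ
  answerLength : Polynomial ℕ
  /-- bound on the number of coins, as a function of the input length -/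
  coins : ℕ → ℕ
  ask_halts : ∀ (x : List Bool) (ω : ℕ → Bool),
    ask.HaltsBy (fun _ => x) ω (askTime.eval x.length)
  ask_coins : ∀ (x : List Bool) (ω : ℕ → Bool) (t : ℕ),
    (ask.run (fun _ => x) ω t).tossed ≤ coins x.length
  judge_det : judge.IsDeterministic
  judge_halts : ∀ (x : List Bool) (q a : Fin m → List Bool),
    judge.HaltsBy (refereeInput x q a) (fun _ => false)
      (judgeTime.eval (x.length + ∑ i, (q i).length + ∑ i, (a i).length))

namespace MIPVerifier

variable {m : ℕ}

/-- The questions sent on input `x` with coins `ρ`. -/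
noncomputable def questions (V : MIPVerifier m) (x : List Bool)
    (ρ : Fin (V.coins x.length) → Bool) : Fin m → List Bool :=
  V.ask.output (fun _ => x) (coinSeq ρ) (V.askTime.eval x.length)

/-- The judging machine outputs `1`. -/
def Accepts (V : MIPVerifier m) (x : List Bool) (q a : Fin m → List Bool) : Prop :=
  V.judge.output (refereeInput x q a) (fun _ => false)
    (V.judgeTime.eval (x.length + ∑ i, (q i).length + ∑ i, (a i).length)) () = [true]

/-- The game played by the provers on input `x`. -/
noncomputable def game (V : MIPVerifier m) (x : List Bool) :
    Game m (List Bool) (Fin (V.answerLength.eval x.length) → Bool) where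
  π := ∑ ρ : Fin (V.coins x.length) → Bool,
    Finsupp.single (V.questions x ρ) ((2 ^ V.coins x.length : ℝ)⁻¹)
  nonneg q := by
    classical
    rw [Finsupp.finsetSum_apply]
    refine Finset.sum_nonneg fun ρ _ => ?_
    rw [Finsupp.single_apply]
    split_ifs <;> positivity
  total := by
    classical
    rw [← Finsupp.sum_finsetSum_index (fun _ => rfl) (fun _ _ _ => rfl)]
    simp
  wins q a := V.Accepts x q (fun i => List.ofFn (a i))

end MIPVerifier

/-- Languages with an `m`-prover one-round interactive proof system that has completeness `c n` and
soundness `s n` for entangled provers on inputs of length `n`. -/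
def MIPStar (c s : ℕ → ℝ) (m : ℕ) : Set (Language Bool) :=
  {L | ∃ V : MIPVerifier m,
    (∀ x ∈ L, c x.length ≤ (V.game x).entangledValue) ∧
    (∀ x, x ∉ L → (V.game x).entangledValue ≤ s x.length)}

end ProverGames

open ProverGames

open ProverGames
set_option linter.unusedSectionVars false

namespace ProverGames

/-! ### Runs of machines: single steps, halting, time and length bounds -/

namespace Machine

variable {ι ο : Type} {M : Machine ι ο} {ω : ℕ → Bool}

/-! The new verifier tosses coins `ρ` for the PCP verifier and four more coins that choose a test.
In a simulation test each prover receives one of the three query addresses, and the PCP decision is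
applied to the three bits. In a consistency test all provers receive the same address and must
answer equally. The judge sees only the input, the questions and the answers; therefore the first
question also carries the private memory, and tags on the first two questions reveal the test to the
judge (equal tags: consistency). Each prover's question in a simulation test also occurs in some
consistency test. For the middle prover, whose tag is then `true`, this takes the extra consistency
test at the middle address. Provers who share an accepted proof always win.

For soundness, consider commuting-operator players who rarely lose. With square roots of POVM
elements, probabilities become squared norms. If two provers almost always agree at an address,
their measurements act on the state almost equally (`IsStrategy.sum_sq_sub_le`). The consistency
question of the middle prover depends on the address alone, so this prover can measure all addresses
one after another, which produces a random proof. To see that it is accepted for fixed `ρ`, note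
that a measurement made first can be handed over to another prover at a small cost, commuted to the
end, and dropped there if nobody looks at its outcome. Hence the order of the measurements hardly
matters: the random proof agrees with the answers of the simulation test at the three queried
places, and these answers are mostly accepted (`wnorm_measured_le`). Distances are computed with
`wnorm`, the square root of a probability; it is a Euclidean norm, so the costs of successive
changes add by the triangle inequality. Averaging over `ρ` and over the random proof gives one good
proof (`exists_assignment`), which contradicts the soundness of the PCP.

If there are `N` coin strings, at most `3N` handovers occur, each costing the square root of twice a
disagreement probability `δ`. By Cauchy–Schwarz the squared total is at most `6N ∑ δ`, and `∑ δ` is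
at most `4N` times the losing probability. This is the origin of the factor `2 ^ (-2r)`.
Tensor-product players are commuting-operator players (`IsEntangled.isCommutingOperator`), so one
bound serves both values. The rest is the construction of two explicit machines (`Ask.run_machine`,
`Judge.run_machine`). -/

theorem step_push [DecidableEq (ι ⊕ ο ⊕ M.W)] {c : Cfg (ι ⊕ ο ⊕ M.W) M.Λ} {k b l}
    (h : M.program c.label = .push k b l) :
    M.step ω c = ⟨l, Function.update c.stk k (b :: c.stk k), c.tossed⟩ := by
  unfold step
  rw [h]
  simp only
  congr!

theorem step_pop [DecidableEq (ι ⊕ ο ⊕ M.W)] {c : Cfg (ι ⊕ ο ⊕ M.W) M.Λ} {k l}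
    (h : M.program c.label = .pop k l) :
    M.step ω c = ⟨l (c.stk k).head?, Function.update c.stk k (c.stk k).tail, c.tossed⟩ := by
  unfold step
  rw [h]
  simp only
  congr!

theorem step_toss {c : Cfg (ι ⊕ ο ⊕ M.W) M.Λ} {l} (h : M.program c.label = .toss l) :
    M.step ω c = ⟨l (ω c.tossed), c.stk, c.tossed + 1⟩ := by
  unfold step
  rw [h]

theorem step_halt {c : Cfg (ι ⊕ ο ⊕ M.W) M.Λ} (h : M.program c.label = .halt) :
    M.step ω c = c := by
  unfold step
  rw [h]

theorem iterate_halt {c : Cfg (ι ⊕ ο ⊕ M.W) M.Λ} (h : M.program c.label = .halt) (n : ℕ) :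
    (M.step ω)^[n] c = c :=
  Function.iterate_fixed (step_halt h) n

/-- The successor is specified stack by stack rather than by `Function.update`, so that stack
contents can be given by explicit functions such as `Ask.contents`. -/
theorem step_eq_of_push {c c' : Cfg (ι ⊕ ο ⊕ M.W) M.Λ} {k b l}
    (h : M.program c.label = .push k b l) (hl : c'.label = l) (ht : c'.tossed = c.tossed)
    (hk : c'.stk k = b :: c.stk k) (hne : ∀ j, j ≠ k → c'.stk j = c.stk j) : M.step ω c = c' := by
  classical
  obtain ⟨l', s', t'⟩ := c'
  rw [step_push h]
  subst hl ht
  congr 1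
  exact Function.update_eq_iff.2 ⟨hk.symm, fun j hj => (hne j hj).symm⟩

theorem step_eq_of_pop {c c' : Cfg (ι ⊕ ο ⊕ M.W) M.Λ} {k l}
    (h : M.program c.label = .pop k l) (hl : c'.label = l (c.stk k).head?)
    (ht : c'.tossed = c.tossed) (hk : c'.stk k = (c.stk k).tail)
    (hne : ∀ j, j ≠ k → c'.stk j = c.stk j) : M.step ω c = c' := by
  classical
  obtain ⟨l', s', t'⟩ := c'
  rw [step_pop h]
  subst hl ht
  congr 1
  exact Function.update_eq_iff.2 ⟨hk.symm, fun j hj => (hne j hj).symm⟩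

/-- The machine passes from `c` to `c'` in `n` steps. -/
def Reaches (M : Machine ι ο) (ω : ℕ → Bool) (n : ℕ) (c c' : Cfg (ι ⊕ ο ⊕ M.W) M.Λ) : Prop :=
  (M.step ω)^[n] c = c'

theorem Reaches.trans {n n' : ℕ} {c c' c'' : Cfg (ι ⊕ ο ⊕ M.W) M.Λ} (h : M.Reaches ω n c c')
    (h' : M.Reaches ω n' c' c'') : M.Reaches ω (n + n') c c'' := by
  unfold Reaches at *
  rw [add_comm, Function.iterate_add_apply, h, h']

theorem Reaches.step {c c' : Cfg (ι ⊕ ο ⊕ M.W) M.Λ} (h : M.step ω c = c') :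
    M.Reaches ω 1 c c' := h

theorem Reaches.run_eq {inp : ι → List Bool} {n t : ℕ} {c : Cfg (ι ⊕ ο ⊕ M.W) M.Λ}
    (h : M.Reaches ω n (M.init inp) c) (hc : M.program c.label = .halt) (hn : n ≤ t) :
    M.run inp ω t = c := by
  unfold Reaches at h
  unfold run
  obtain ⟨s, rfl⟩ := Nat.exists_eq_add_of_le hn
  rw [add_comm, Function.iterate_add_apply, h, iterate_halt hc]

theorem tossed_le_step (c : Cfg (ι ⊕ ο ⊕ M.W) M.Λ) : c.tossed ≤ (M.step ω c).tossed := by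
  unfold step
  split <;> simp

theorem tossed_run_mono (inp : ι → List Bool) : Monotone fun t => (M.run inp ω t).tossed := by
  refine monotone_nat_of_le_succ fun t => ?_
  unfold run
  rw [Function.iterate_succ_apply']
  exact tossed_le_step _

theorem length_stk_step_le (c : Cfg (ι ⊕ ο ⊕ M.W) M.Λ) (k : ι ⊕ ο ⊕ M.W) :
    ((M.step ω c).stk k).length ≤ (c.stk k).length + 1 := by
  classical
  unfold step
  split
  · rename_i k' b l _
    by_cases h : k = k'
    · subst h; simp
    · simp [Function.update_of_ne h]
  · rename_i k' l _
    by_cases h : k = k'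
    · subst h; simp; omega
    · simp [Function.update_of_ne h]
  · simp
  · simp

theorem length_stk_run_le (inp : ι → List Bool) (t : ℕ) (k : ι ⊕ ο ⊕ M.W) :
    ((M.run inp ω t).stk k).length ≤ ((M.init inp).stk k).length + t := by
  induction t with
  | zero => simp [run]
  | succ t ih =>
    unfold run at *
    rw [Function.iterate_succ_apply']
    exact (length_stk_step_le _ _).trans (by omega)

theorem length_output_le (inp : ι → List Bool) (t : ℕ) (o : ο) :
    (M.output inp ω t o).length ≤ t :=
  (length_stk_run_le inp t _).trans (by simp [init])

/-- A simulation can be followed only until the simulated machine halts, because the host may act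
differently from then on; hence the first halting time is needed. -/
theorem HaltsBy.exists_first {inp : ι → List Bool} {T : ℕ} (h : M.HaltsBy inp ω T) :
    ∃ n ≤ T, (∀ i < n, M.program ((M.step ω)^[i] (M.init inp)).label ≠ .halt) ∧
      (M.step ω)^[n] (M.init inp) = M.run inp ω T ∧
      M.program (M.run inp ω T).label = .halt := by
  classical
  have hex : ∃ n, M.program (M.run inp ω n).label = .halt := ⟨T, h⟩
  have hle : Nat.find hex ≤ T := Nat.find_min' hex h
  refine ⟨Nat.find hex, hle, fun i hi => Nat.find_min hex hi, ?_, h⟩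
  exact (Reaches.run_eq (M := M) (n := Nat.find hex) rfl (Nat.find_spec hex) hle).symm

end Machine

/-! ### Simulation of a machine inside a larger one -/

/-- The same instruction for a machine with more stacks and states. -/
def Instr.map {K K' Λ Λ' : Type} (e : K → K') (g : Λ → Λ') : Instr K Λ → Instr K' Λ'
  | .push k b l => .push (e k) b (g l)
  | .pop k l => .pop (e k) fun o => g (l o)
  | .toss l => .toss fun b => g (l b)
  | .halt => .halt

/-- A configuration as part of a configuration of a machine with more stacks and states. -/
noncomputable def Cfg.lift {K K' Λ Λ' : Type} (e : K → K') (g : Λ → Λ') (fr : K' → List Bool)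
    (off : ℕ) (c : Cfg K Λ) : Cfg K' Λ' :=
  ⟨g c.label, Function.extend e c.stk fr, c.tossed + off⟩

namespace Machine

variable {ι ο ι' ο' : Type} {M : Machine ι ο} {N : Machine ι' ο'} {ω ω' : ℕ → Bool}
  {e : ι ⊕ ο ⊕ M.W → ι' ⊕ ο' ⊕ N.W} {g : M.Λ → N.Λ} {fr : ι' ⊕ ο' ⊕ N.W → List Bool} {off : ℕ}

theorem extend_update {K K' : Type} [DecidableEq K] [DecidableEq K'] {e : K → K'}
    (he : Function.Injective e) (s : K → List Bool) (fr : K' → List Bool) (k : K)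
    (v : List Bool) :
    Function.extend e (Function.update s k v) fr
      = Function.update (Function.extend e s fr) (e k) v := by
  funext j
  by_cases hj : ∃ i, e i = j
  · obtain ⟨i, rfl⟩ := hj
    rw [he.extend_apply]
    by_cases hi : i = k
    · subst hi; simp
    · rw [Function.update_of_ne hi, Function.update_of_ne (he.ne hi), he.extend_apply]
  · rw [Function.extend_apply' _ _ _ hj, Function.update_of_ne (fun h => hj ⟨k, h.symm⟩),
      Function.extend_apply' _ _ _ hj]

theorem step_lift (he : Function.Injective e) (hω : ∀ i, ω' (i + off) = ω i)
    {c : Cfg (ι ⊕ ο ⊕ M.W) M.Λ}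
    (hp : N.program (g c.label) = (M.program c.label).map e g) :
    N.step ω' (c.lift e g fr off) = (M.step ω c).lift e g fr off := by
  classical
  rcases hI : M.program c.label with ⟨k, b, l⟩ | ⟨k, l⟩ | ⟨l⟩ | _
  · rw [hI] at hp
    rw [step_push hI, step_push (M := N) (c := c.lift e g fr off) hp]
    simp only [Cfg.lift, extend_update he, he.extend_apply]
  · rw [hI] at hp
    rw [step_pop hI, step_pop (M := N) (c := c.lift e g fr off) hp]
    simp only [Cfg.lift, extend_update he, he.extend_apply]
  · rw [hI] at hp
    rw [step_toss hI, step_toss (M := N) (c := c.lift e g fr off) hp]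
    simp only [Cfg.lift, hω, add_right_comm]
  · rw [hI] at hp
    rw [step_halt hI, step_halt (M := N) (c := c.lift e g fr off) hp]

/-- Nothing is assumed about the host at images of halting states, so it is free to continue there.
The offset `off` accounts for coins that the host tossed before the simulation. -/
theorem iterate_lift (he : Function.Injective e) (hω : ∀ i, ω' (i + off) = ω i)
    (hp : ∀ l, M.program l ≠ .halt → N.program (g l) = (M.program l).map e g)
    (c : Cfg (ι ⊕ ο ⊕ M.W) M.Λ) (n : ℕ)
    (hn : ∀ i < n, M.program ((M.step ω)^[i] c).label ≠ .halt) :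
    (N.step ω')^[n] (c.lift e g fr off) = ((M.step ω)^[n] c).lift e g fr off := by
  induction n with
  | zero => rfl
  | succ n ih =>
    rw [Function.iterate_succ_apply', Function.iterate_succ_apply',
      ih fun i hi => hn i (by omega)]
    exact step_lift he hω (hp _ (hn n (by omega)))

end Machine

/-! ### The tests and the machine that asks the questions -/

/-- A test: prover `p` is asked for the bit at the address number `τ.1 p` of the simulated verifier;
`τ.2` are the tags that the first two provers receive. -/
abbrev Test : Type := (Fin 3 → Fin 3) × Bool × Bool

/-- The tests, according to four coins: consistency at the three addresses with tags `00` (four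
times out of sixteen each), consistency at the middle address with tags `11` (three times), and
simulation of the verifier with tags `01` (once). -/
def testOf : Bool → Bool → Bool → Bool → Test
  | true, true, _, _ => (fun _ => 0, false, false)
  | true, false, _, _ => (fun _ => 1, false, false)
  | false, true, _, _ => (fun _ => 2, false, false)
  | false, false, false, false => (id, false, true)
  | false, false, _, _ => (fun _ => 1, true, true)

inductive AskLabel (Λ : Type) : Type
  | coin0
  | coin1 (b : Bool)
  | coin2 (b b' : Bool)
  | coin3 (b b' b'' : Bool)
  | query (τ : Test) (l : Λ)
  | popAddress (τ : Test) (k : Fin 3)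
  | pushAddress (τ : Test) (k : Fin 3) (b : Bool) (p : Fin 3)
  | separate (τ : Test)
  | popMemory (τ : Test)
  | pushBit (τ : Test) (b : Bool)
  | pushMark (τ : Test)
  | tagFirst (τ : Test)
  | tagSecond (τ : Test)
  | done

theorem AskLabel.finite (Λ : Type) [Finite Λ] : Finite (AskLabel Λ) := by
  let f : AskLabel Λ → Fin 14 × (Bool × Bool × Bool) × Option Λ × Option Test × Fin 3 × Fin 3
    | .coin0 => (0, (false, false, false), none, none, 0, 0)
    | .coin1 b => (1, (b, false, false), none, none, 0, 0)
    | .coin2 b b' => (2, (b, b', false), none, none, 0, 0)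
    | .coin3 b b' b'' => (3, (b, b', b''), none, none, 0, 0)
    | .query τ l => (4, (false, false, false), some l, some τ, 0, 0)
    | .popAddress τ k => (5, (false, false, false), none, some τ, k, 0)
    | .pushAddress τ k b p => (6, (b, false, false), none, some τ, k, p)
    | .separate τ => (7, (false, false, false), none, some τ, 0, 0)
    | .popMemory τ => (8, (false, false, false), none, some τ, 0, 0)
    | .pushBit τ b => (9, (b, false, false), none, some τ, 0, 0)
    | .pushMark τ => (10, (false, false, false), none, some τ, 0, 0)
    | .tagFirst τ => (11, (false, false, false), none, some τ, 0, 0)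
    | .tagSecond τ => (12, (false, false, false), none, some τ, 0, 0)
    | .done => (13, (false, false, false), none, none, 0, 0)
  refine Finite.of_injective f fun l l' h => ?_
  cases l <;> cases l' <;> simp_all [f]

namespace Ask

variable (M : Machine Unit (QueryOutput 3))

/-- The stacks of the simulated machine among the stacks of the asking machine; the asking machine
has one more work stack, which is always empty. -/
def stack : Unit ⊕ QueryOutput 3 ⊕ M.W → Unit ⊕ Fin 3 ⊕ (QueryOutput 3 ⊕ M.W ⊕ Unit)
  | .inl u => .inl u
  | .inr (.inl o) => .inr (.inr (.inl o))
  | .inr (.inr w) => .inr (.inr (.inr (.inl w)))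

theorem stack_injective : Function.Injective (stack M) := by
  rintro (_ | _ | _) (_ | _ | _) h <;> simp_all [stack]

/-- Popping this always empty stack changes nothing but the label; it serves as an unconditional
jump. -/
def nop {W : Type} : Unit ⊕ Fin 3 ⊕ (QueryOutput 3 ⊕ W ⊕ Unit) := .inr (.inr (.inr (.inr ())))

def out {W : Type} (p : Fin 3) : Unit ⊕ Fin 3 ⊕ (QueryOutput 3 ⊕ W ⊕ Unit) := .inr (.inl p)

def mem {W : Type} : Unit ⊕ Fin 3 ⊕ (QueryOutput 3 ⊕ W ⊕ Unit) := .inr (.inr (.inl .memory))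

def addr {W : Type} (k : Fin 3) : Unit ⊕ Fin 3 ⊕ (QueryOutput 3 ⊕ W ⊕ Unit) :=
  .inr (.inr (.inl (.address k)))

/-- The label after the copying of the address number `k`. -/
def nextAddress {Λ : Type} (τ : Test) (k : Fin 3) : AskLabel Λ :=
  if k = 2 then .separate τ else .popAddress τ (k + 1)

/-- The label after the copying of a bit to the prover `p`. -/
def nextProver {Λ : Type} (τ : Test) (k : Fin 3) (b : Bool) (p : Fin 3) : AskLabel Λ :=
  if p = 2 then .popAddress τ k else .pushAddress τ k b (p + 1)

def program : AskLabel M.Λ → Instr (Unit ⊕ Fin 3 ⊕ (QueryOutput 3 ⊕ M.W ⊕ Unit)) (AskLabel M.Λ)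
  | .coin0 => .toss .coin1
  | .coin1 b => .toss (.coin2 b)
  | .coin2 b b' => .toss (.coin3 b b')
  | .coin3 b b' b'' => .toss fun b''' => .query (testOf b b' b'' b''') M.start
  | .query τ l => match M.program l with
    -- Where the simulated machine halts, the host starts to write the questions.
    | .halt => .pop nop fun _ => .popAddress τ 0
    | i => i.map (stack M) (.query τ)
  | .popAddress τ k => .pop (addr k) fun o => match o with
    | some b => .pushAddress τ k b 0
    | none => nextAddress τ k
  | .pushAddress τ k b p =>
    if τ.1 p = k then .push (out p) b (nextProver τ k b p)
    else .pop nop fun _ => nextProver τ k b p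
  | .separate τ => .push (out 0) false (.popMemory τ)
  | .popMemory τ => .pop mem fun o => match o with
    | some b => .pushBit τ b
    | none => .tagFirst τ
  | .pushBit τ b => .push (out 0) b (.pushMark τ)
  | .pushMark τ => .push (out 0) true (.popMemory τ)
  | .tagFirst τ => .push (out 0) τ.2.1 (.tagSecond τ)
  | .tagSecond τ => .push (out 1) τ.2.2 .done
  | .done => .halt

/-- The machine that generates the questions from a machine that generates PCP queries. -/
def machine : Machine Unit (Fin 3) where
  W := QueryOutput 3 ⊕ M.W ⊕ Unit
  finiteW := by
    have := M.finiteW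
    have : Finite (QueryOutput 3) := by
      let f : QueryOutput 3 → Option (Fin 3)
        | .address k => some k
        | .memory => none
      refine Finite.of_injective f fun o o' h => ?_
      cases o <;> cases o' <;> simp_all [f]
    infer_instance
  Λ := AskLabel M.Λ
  finiteΛ := by
    have := M.finiteΛ
    exact AskLabel.finite M.Λ
  start := .coin0
  program := program M

/-- The contents of the stacks. -/
def contents {W : Type} (x : List Bool) (o a : Fin 3 → List Bool) (m : List Bool)
    (w : W → List Bool) : Unit ⊕ Fin 3 ⊕ (QueryOutput 3 ⊕ W ⊕ Unit) → List Bool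
  | .inl _ => x
  | .inr (.inl p) => o p
  | .inr (.inr (.inl (.address k))) => a k
  | .inr (.inr (.inl .memory)) => m
  | .inr (.inr (.inr (.inl v))) => w v
  | .inr (.inr (.inr (.inr _))) => []

section Stacks

variable {W : Type} (x : List Bool) (o a : Fin 3 → List Bool) (m : List Bool) (w : W → List Bool)
  (v : List Bool)

theorem contents_out_ne (p : Fin 3) (k) (hk : k ≠ out p) :
    contents x (Function.update o p v) a m w k = contents x o a m w k := by
  rcases k with _ | p' | (_ | _) | _ | _ <;> simp only [contents]
  rw [Function.update_of_ne]
  rintro rfl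
  exact hk rfl

theorem contents_addr_ne (j : Fin 3) (k) (hk : k ≠ addr j) :
    contents x o (Function.update a j v) m w k = contents x o a m w k := by
  rcases k with _ | p' | (_ | _) | _ | _ <;> simp only [contents]
  rw [Function.update_of_ne]
  rintro rfl
  exact hk rfl

theorem contents_mem_ne (k) (hk : k ≠ mem) : contents x o a v w k = contents x o a m w k := by
  rcases k with _ | p' | (_ | _) | _ | _ <;> simp only [contents]
  exact absurd rfl hk

end Stacks

variable {M} {ω : ℕ → Bool} (x : List Bool) (o a : Fin 3 → List Bool) (m : List Bool)
  (w : M.W → List Bool) (t : ℕ) (τ : Test)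

theorem step_pushAddress (k : Fin 3) (b : Bool) (p : Fin 3) :
    (machine M).step ω ⟨.pushAddress τ k b p, contents x o a m w, t⟩
      = ⟨nextProver τ k b p, contents x
        (Function.update o p (if τ.1 p = k then b :: o p else o p)) a m w, t⟩ := by
  by_cases h : τ.1 p = k
  · exact Machine.step_eq_of_push (k := out p) (b := b) (l := nextProver τ k b p)
      (by simp [machine, program, h]) rfl rfl (by simp [contents, out, h])
      (contents_out_ne x o a m w _ p)
  · exact Machine.step_eq_of_pop (k := nop) (l := fun _ => nextProver τ k b p)
      (by simp [machine, program, h]) rfl rfl (by simp [contents, nop])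
      (fun j _ => by simp [h])

/-- One pop, then one step for each prover: a push if this prover is due to receive the address, a
jump otherwise. -/
theorem copy_bit (k : Fin 3) (b : Bool) (l : List Bool) (h : a k = b :: l) :
    (machine M).Reaches ω 4 ⟨.popAddress τ k, contents x o a m w, t⟩
      ⟨.popAddress τ k, contents x (fun p => if τ.1 p = k then b :: o p else o p)
        (Function.update a k l) m w, t⟩ := by
  have s1 : (machine M).step ω ⟨.popAddress τ k, contents x o a m w, t⟩
      = ⟨.pushAddress τ k b 0, contents x o (Function.update a k l) m w, t⟩ :=
    Machine.step_eq_of_pop (k := addr k) rfl (by simp [contents, addr, h]; rfl) rfl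
      (by simp [contents, addr, h]) (contents_addr_ne x o a m w _ k)
  have h2 := (Machine.Reaches.step s1).trans
    ((Machine.Reaches.step (step_pushAddress (ω := ω) x o (Function.update a k l) m w t τ k b 0)).trans
    ((Machine.Reaches.step (step_pushAddress (ω := ω) x _ (Function.update a k l) m w t τ k b 1)).trans
    (Machine.Reaches.step (step_pushAddress (ω := ω) x _ (Function.update a k l) m w t τ k b 2))))
  have e : (fun p => if τ.1 p = k then b :: o p else o p) = Function.update
      (Function.update (Function.update o 0 (if τ.1 0 = k then b :: o 0 else o 0)) 1
        (if τ.1 1 = k then b :: o 1 else o 1)) 2 (if τ.1 2 = k then b :: o 2 else o 2) := by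
    funext p
    fin_cases p <;> simp
  rw [e]
  exact h2

/-- Moving a string from stack to stack reverses it. This is harmless: reversal is injective and all
provers receive the same reversed string. -/
theorem copy_address (k : Fin 3) :
    (machine M).Reaches ω (4 * (a k).length + 1) ⟨.popAddress τ k, contents x o a m w, t⟩
      ⟨nextAddress τ k, contents x (fun p => if τ.1 p = k then (a k).reverse ++ o p else o p)
        (Function.update a k []) m w, t⟩ := by
  induction hl : a k generalizing o a with
  | nil =>
    have e : Function.update a k [] = a := by rw [← hl, Function.update_eq_self]
    rw [e]
    exact Machine.Reaches.step (Machine.step_eq_of_pop (k := addr k) rfl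
      (by simp [contents, addr, hl]; rfl) rfl (by simp [contents, addr, hl]) (fun j _ => by simp))
  | cons b l ih =>
    have h1 := copy_bit (ω := ω) x o a m w t τ k b l hl
    have h2 := ih (fun p => if τ.1 p = k then b :: o p else o p) (Function.update a k l) (by simp)
    have h3 := h1.trans h2
    have e : (fun p => if τ.1 p = k then (b :: l).reverse ++ o p else o p) = fun p =>
        if τ.1 p = k then l.reverse ++ (if τ.1 p = k then b :: o p else o p) else
        (if τ.1 p = k then b :: o p else o p) := by
      funext p
      by_cases hp : τ.1 p = k <;> simp [hp]
    have e' : 4 * (b :: l).length + 1 = 4 + (4 * l.length + 1) := by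
      simp only [List.length_cons]; ring
    rw [Function.update_idem] at h3
    rw [e, e']
    exact h3

/-- The self-delimiting encoding of the string `m` on top of the stack `s`. -/
def pushString (m s : List Bool) : List Bool :=
  m.foldl (fun s b => true :: b :: s) s

theorem copy_memory (o : Fin 3 → List Bool) :
    (machine M).Reaches ω (3 * m.length + 1) ⟨.popMemory τ, contents x o a m w, t⟩
      ⟨.tagFirst τ, contents x (Function.update o 0 (pushString m (o 0))) a [] w, t⟩ := by
  induction m generalizing o with
  | nil =>
    have e : Function.update o 0 (pushString [] (o 0)) = o := Function.update_eq_self _ _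
    rw [e]
    exact Machine.Reaches.step (Machine.step_eq_of_pop (k := mem) rfl
      rfl rfl (by simp [contents, mem]) (fun j _ => rfl))
  | cons b l ih =>
    have s1 : (machine M).step ω ⟨.popMemory τ, contents x o a (b :: l) w, t⟩
        = ⟨.pushBit τ b, contents x o a l w, t⟩ :=
      Machine.step_eq_of_pop (k := mem) rfl rfl rfl rfl (contents_mem_ne x o a _ w l)
    have s2 : (machine M).step ω ⟨.pushBit τ b, contents x o a l w, t⟩
        = ⟨.pushMark τ, contents x (Function.update o 0 (b :: o 0)) a l w, t⟩ :=
      Machine.step_eq_of_push (k := out 0) rfl rfl rfl (by simp [contents, out])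
        (contents_out_ne x o a l w _ 0)
    have s3 : (machine M).step ω ⟨.pushMark τ, contents x (Function.update o 0 (b :: o 0)) a l w, t⟩
        = ⟨.popMemory τ, contents x (Function.update o 0 (true :: b :: o 0)) a l w, t⟩ := by
      have := contents_out_ne x (Function.update o 0 (b :: o 0)) a l w (true :: b :: o 0) 0
      rw [Function.update_idem] at this
      exact Machine.step_eq_of_push (k := out 0) rfl rfl rfl (by simp [contents, out]) this
    have h := (Machine.Reaches.step s1).trans ((Machine.Reaches.step s2).trans
      ((Machine.Reaches.step s3).trans (ih (Function.update o 0 (true :: b :: o 0)))))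
    rw [Function.update_idem, Function.update_self] at h
    have e' : 3 * (b :: l).length + 1 = 1 + (1 + (1 + (3 * l.length + 1))) := by
      simp only [List.length_cons]; ring
    rw [e']
    exact h

/-- The questions of the test `τ`, for the addresses `a` and the private memory `m`. -/
def question (τ : Test) (a : Fin 3 → List Bool) (m : List Bool) : Fin 3 → List Bool :=
  ![τ.2.1 :: pushString m (false :: (a (τ.1 0)).reverse), τ.2.2 :: (a (τ.1 1)).reverse,
    (a (τ.1 2)).reverse]

/-- The constant 7 counts the three ends of addresses, the end of the memory, the separator and the
two tags. -/
theorem write_questions :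
    ∃ n ≤ 4 * ∑ k, (a k).length + 3 * m.length + 7, ∃ s,
      (machine M).Reaches ω n ⟨.popAddress τ 0, contents x (fun _ => []) a m w, t⟩ ⟨.done, s, t⟩ ∧
      ∀ p, s (.inr (.inl p)) = question τ a m p := by
  classical
  have h0 := copy_address (ω := ω) x (fun _ => []) a m w t τ 0
  have h1 := copy_address (ω := ω) x (fun p => if τ.1 p = 0 then (a 0).reverse ++ [] else [])
    (Function.update a 0 []) m w t τ 1
  have h2 := copy_address (ω := ω) x (fun p => if τ.1 p = 1 then (a 1).reverse ++
    (if τ.1 p = 0 then (a 0).reverse ++ [] else []) else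
    (if τ.1 p = 0 then (a 0).reverse ++ [] else []))
    (Function.update (Function.update a 0 []) 1 []) m w t τ 2
  simp only [Function.update_of_ne (show (1 : Fin 3) ≠ 0 by decide),
    Function.update_of_ne (show (2 : Fin 3) ≠ 0 by decide),
    Function.update_of_ne (show (2 : Fin 3) ≠ 1 by decide)] at h1 h2
  have h012 := h0.trans (h1.trans h2)
  set a' := Function.update (Function.update (Function.update a 0 []) 1 []) 2 [] with ha'
  have e : (fun p => if τ.1 p = 2 then (a 2).reverse ++ (if τ.1 p = 1 then (a 1).reverse ++
      (if τ.1 p = 0 then (a 0).reverse ++ [] else []) else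
      (if τ.1 p = 0 then (a 0).reverse ++ [] else [])) else (if τ.1 p = 1 then (a 1).reverse ++
      (if τ.1 p = 0 then (a 0).reverse ++ [] else []) else
      (if τ.1 p = 0 then (a 0).reverse ++ [] else []))) = fun p => (a (τ.1 p)).reverse := by
    funext p
    generalize τ.1 p = j
    fin_cases j <;> simp
  rw [e] at h012
  set o : Fin 3 → List Bool := fun p => (a (τ.1 p)).reverse with ho
  have s3 : (machine M).step ω ⟨.separate τ, contents x o a' m w, t⟩
      = ⟨.popMemory τ, contents x (Function.update o 0 (false :: o 0)) a' m w, t⟩ :=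
    Machine.step_eq_of_push (k := out 0) rfl rfl rfl (by simp [contents, out])
      (contents_out_ne x o a' m w _ 0)
  have h4 := copy_memory (ω := ω) x a' m w t τ (Function.update o 0 (false :: o 0))
  simp only [Function.update_self, Function.update_idem] at h4
  have s5 : (machine M).step ω ⟨.tagFirst τ, contents x
      (Function.update o 0 (pushString m (false :: o 0))) a' [] w, t⟩ = ⟨.tagSecond τ, contents x
      (Function.update o 0 (τ.2.1 :: pushString m (false :: o 0))) a' [] w, t⟩ := by
    have := contents_out_ne x (Function.update o 0 (pushString m (false :: o 0))) a' [] w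
      (τ.2.1 :: pushString m (false :: o 0)) 0
    rw [Function.update_idem] at this
    exact Machine.step_eq_of_push (k := out 0) rfl rfl rfl (by simp [contents, out]) this
  have s6 : (machine M).step ω ⟨.tagSecond τ, contents x
      (Function.update o 0 (τ.2.1 :: pushString m (false :: o 0))) a' [] w, t⟩
      = ⟨.done, contents x (Function.update (Function.update o 0
        (τ.2.1 :: pushString m (false :: o 0))) 1 (τ.2.2 :: o 1)) a' [] w, t⟩ :=
    Machine.step_eq_of_push (k := out 1) rfl rfl rfl (by simp [contents, out])
      (contents_out_ne x _ a' [] w _ 1)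
  have h := h012.trans ((Machine.Reaches.step s3).trans (h4.trans
    ((Machine.Reaches.step s5).trans (Machine.Reaches.step s6))))
  refine ⟨_, ?_, _, h, fun p => ?_⟩
  · rw [Fin.sum_univ_three]; omega
  · fin_cases p <;> simp [contents, question, ho]

theorem extend_stack (s : Unit ⊕ QueryOutput 3 ⊕ M.W → List Bool) :
    Function.extend (stack M) s (fun _ => [])
      = contents (s (.inl ())) (fun _ => []) (fun k => s (.inr (.inl (.address k))))
        (s (.inr (.inl .memory))) (fun v => s (.inr (.inr v))) := by
  have hin (k) : Function.extend (stack M) s (fun _ => []) (stack M k) = s k :=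
    (stack_injective M).extend_apply _ _ _
  funext k
  rcases k with _ | p | (k | _) | v | _
  · exact hin (.inl ())
  · rw [Function.extend_apply']
    · rfl
    · rintro ⟨_ | _ | _, h⟩ <;> simp [stack] at h
  · exact hin (.inr (.inl (.address k)))
  · exact hin (.inr (.inl .memory))
  · exact hin (.inr (.inr v))
  · rw [Function.extend_apply']
    · rfl
    · rintro ⟨_ | _ | _, h⟩ <;> simp [stack] at h

theorem program_query (τ : Test) (l : M.Λ) (hl : M.program l ≠ .halt) :
    program M (.query τ l) = (M.program l).map (stack M) (.query τ) := by
  unfold program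
  cases h : M.program l <;> simp_all

/-- The run of the asking machine. -/
theorem run_machine (ω ω' : ℕ → Bool) (hω : ∀ i, ω (i + 4) = ω' i) {T : ℕ}
    (hT : M.HaltsBy (fun _ => x) ω' T) :
    ∃ n ≤ 16 * T + 12, ∃ s, (machine M).Reaches ω n ((machine M).init fun _ => x)
        ⟨.done, s, (M.run (fun _ => x) ω' T).tossed + 4⟩ ∧
      ∀ p, s (.inr (.inl p)) = question (testOf (ω 0) (ω 1) (ω 2) (ω 3))
        (fun k => M.output (fun _ => x) ω' T (.address k))
        (M.output (fun _ => x) ω' T .memory) p := by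
  classical
  set τ := testOf (ω 0) (ω 1) (ω 2) (ω 3) with hτ
  have h1 : (machine M).Reaches ω 4 ((machine M).init fun _ => x)
      (Cfg.lift (stack M) (AskLabel.query τ) (fun _ => []) 4 (M.init fun _ => x)) := by
    have e : ((machine M).init fun _ => x).stk
        = Function.extend (stack M) (M.init fun _ => x).stk (fun _ => []) := by
      rw [extend_stack]
      funext k
      rcases k with _ | p | (k | _) | v | _ <;> rfl
    set s0 := ((machine M).init fun _ => x).stk
    have c0 : (machine M).step ω ⟨.coin0, s0, 0⟩ = ⟨.coin1 (ω 0), s0, 1⟩ := Machine.step_toss rfl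
    have c1 : (machine M).step ω ⟨.coin1 (ω 0), s0, 1⟩ = ⟨.coin2 (ω 0) (ω 1), s0, 2⟩ :=
      Machine.step_toss rfl
    have c2 : (machine M).step ω ⟨.coin2 (ω 0) (ω 1), s0, 2⟩
        = ⟨.coin3 (ω 0) (ω 1) (ω 2), s0, 3⟩ := Machine.step_toss rfl
    have c3 : (machine M).step ω ⟨.coin3 (ω 0) (ω 1) (ω 2), s0, 3⟩ = ⟨.query τ M.start, s0, 4⟩ :=
      Machine.step_toss (M := machine M)
        (l := fun b => AskLabel.query (testOf (ω 0) (ω 1) (ω 2) b) M.start) rfl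
    have h := (Machine.Reaches.step c0).trans ((Machine.Reaches.step c1).trans
      ((Machine.Reaches.step c2).trans (Machine.Reaches.step c3)))
    rw [e] at h
    have e0 : (machine M).init (fun _ => x) = ⟨.coin0, s0, 0⟩ := rfl
    rw [e0, e]
    exact h
  obtain ⟨n, hn, hlt, hrun, hhalt⟩ := hT.exists_first
  have h2 : (machine M).Reaches ω n
      (Cfg.lift (stack M) (AskLabel.query τ) (fun _ => []) 4 (M.init fun _ => x))
      (Cfg.lift (stack M) (AskLabel.query τ) (fun _ => []) 4 (M.run (fun _ => x) ω' T)) := by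
    unfold Machine.Reaches
    have := Machine.iterate_lift (N := machine M) (ω := ω') (ω' := ω) (stack_injective M)
      (g := AskLabel.query τ) (fr := fun _ => []) (off := 4) hω
      (fun l hl => program_query τ l hl) (M.init fun _ => x) n hlt
    rw [hrun] at this
    exact this
  set cf := M.run (fun _ => x) ω' T with hcf
  have s3 : (machine M).step ω (Cfg.lift (stack M) (AskLabel.query τ) (fun _ => []) 4 cf)
      = ⟨.popAddress τ 0, contents (cf.stk (.inl ())) (fun _ => [])
        (fun k => cf.stk (.inr (.inl (.address k)))) (cf.stk (.inr (.inl .memory)))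
        (fun v => cf.stk (.inr (.inr v))), cf.tossed + 4⟩ := by
    have e := extend_stack cf.stk
    exact Machine.step_eq_of_pop (k := nop) (l := fun _ => .popAddress τ 0)
      (by simp [machine, program, Cfg.lift, hhalt]) rfl rfl
      (congrArg List.tail (congrFun e nop)).symm (fun j _ => (congrFun e j).symm)
  obtain ⟨n', hn', s, h4, hs⟩ := write_questions (M := M) (ω := ω) (cf.stk (.inl ()))
    (fun k => cf.stk (.inr (.inl (.address k)))) (cf.stk (.inr (.inl .memory)))
    (fun v => cf.stk (.inr (.inr v))) (cf.tossed + 4) τ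
  refine ⟨_, ?_, s, h1.trans (h2.trans ((Machine.Reaches.step s3).trans h4)), hs⟩
  -- A string written in `T` steps has length at most `T`. The total is 4 coin tosses, at most `T`
  -- simulated steps, one jump, and at most `12 T + 3 T + 7` steps of writing.
  have ha (k : Fin 3) : (cf.stk (.inr (.inl (.address k)))).length ≤ T :=
    Machine.length_output_le (M := M) (fun _ => x) T (.address k)
  have hm : (cf.stk (.inr (.inl .memory))).length ≤ T :=
    Machine.length_output_le (M := M) (fun _ => x) T .memory
  have := ha 0
  have := ha 1
  have := ha 2
  rw [Fin.sum_univ_three] at hn'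
  omega

end Ask

/-! ### The machine that judges the answers -/

inductive JudgeLabel (Λ : Type) : Type
  | answer0
  | answer1 (b : Bool)
  | answer2 (b b' : Bool)
  | tagFirst (β : Fin 3 → Bool)
  | tagSecond (β : Fin 3 → Bool) (o : Option Bool)
  | accept
  | finish
  | parse (β : Fin 3 → Bool)
  | parseBit (β : Fin 3 → Bool)
  | store (β : Fin 3 → Bool) (b : Bool)
  | put (β : Fin 3 → Bool) (i : Fin 3)
  | decide (l : Λ)

theorem JudgeLabel.finite (Λ : Type) [Finite Λ] : Finite (JudgeLabel Λ) := by
  let f : JudgeLabel Λ → Fin 12 × (Fin 3 → Bool) × Option Bool × Bool × Fin 3 × Option Λ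
    | .answer0 => (0, fun _ => false, none, false, 0, none)
    | .answer1 b => (1, fun _ => false, none, b, 0, none)
    | .answer2 b b' => (2, fun _ => false, some b', b, 0, none)
    | .tagFirst β => (3, β, none, false, 0, none)
    | .tagSecond β o => (4, β, o, false, 0, none)
    | .accept => (5, fun _ => false, none, false, 0, none)
    | .finish => (6, fun _ => false, none, false, 0, none)
    | .parse β => (7, β, none, false, 0, none)
    | .parseBit β => (8, β, none, false, 0, none)
    | .store β b => (9, β, none, b, 0, none)
    | .put β i => (10, β, none, false, i, none)
    | .decide l => (11, fun _ => false, none, false, 0, some l)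
  refine Finite.of_injective f fun l l' h => ?_
  cases l <;> cases l' <;> simp_all [f]

namespace Judge

variable (M : Machine (DeciderInput 3) Unit)

/-- The stacks of the simulated decision machine among the stacks of the judging machine. -/
def stack : DeciderInput 3 ⊕ Unit ⊕ M.W → RefereeInput 3 ⊕ Unit ⊕ (Option (Fin 3) ⊕ M.W)
  | .inl .input => .inl .input
  | .inl .memory => .inr (.inr (.inl none))
  | .inl (.answer i) => .inr (.inr (.inl (some i)))
  | .inr (.inl u) => .inr (.inl u)
  | .inr (.inr w) => .inr (.inr (.inr w))

theorem stack_injective : Function.Injective (stack M) := by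
  rintro ((_ | _ | _) | _ | _) ((_ | _ | _) | _ | _) h <;> simp_all [stack]

def quest {W : Type} (i : Fin 3) : RefereeInput 3 ⊕ Unit ⊕ (Option (Fin 3) ⊕ W) :=
  .inl (.question i)

def answ {W : Type} (i : Fin 3) : RefereeInput 3 ⊕ Unit ⊕ (Option (Fin 3) ⊕ W) :=
  .inl (.answer i)

def verdict {W : Type} : RefereeInput 3 ⊕ Unit ⊕ (Option (Fin 3) ⊕ W) := .inr (.inl ())

def work {W : Type} (i : Option (Fin 3)) : RefereeInput 3 ⊕ Unit ⊕ (Option (Fin 3) ⊕ W) :=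
  .inr (.inr (.inl i))

def program :
    JudgeLabel M.Λ → Instr (RefereeInput 3 ⊕ Unit ⊕ (Option (Fin 3) ⊕ M.W)) (JudgeLabel M.Λ)
  | .answer0 => .pop (answ 0) fun o => .answer1 (o.getD false)
  | .answer1 b => .pop (answ 1) fun o => .answer2 b (o.getD false)
  | .answer2 b b' => .pop (answ 2) fun o => .tagFirst ![b, b', o.getD false]
  | .tagFirst β => .pop (quest 0) fun o => .tagSecond β o
  | .tagSecond β o => .pop (quest 1) fun o' =>
    if o = o' then if β 0 = β 1 ∧ β 1 = β 2 then .accept else .finish else .parse β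
  | .accept => .push verdict true .finish
  | .finish => .halt
  | .parse β => .pop (quest 0) fun o => if o = some true then .parseBit β else .put β 0
  | .parseBit β => .pop (quest 0) fun o => .store β (o.getD false)
  | .store β b => .push (work none) b (.parse β)
  | .put β i =>
    .push (work (some i)) (β i) (if i = 2 then .decide M.start else .put β (i + 1))
  | .decide l => (M.program l).map (stack M) .decide

/-- The judging machine: it compares the answers if the tags are equal, and simulates the decision
machine of the PCP verifier otherwise. -/
def machine : Machine (RefereeInput 3) Unit where
  W := Option (Fin 3) ⊕ M.W
  finiteW := by
    have := M.finiteW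
    infer_instance
  Λ := JudgeLabel M.Λ
  finiteΛ := by
    have := M.finiteΛ
    exact JudgeLabel.finite M.Λ
  start := .answer0
  program := program M

theorem machine_isDeterministic (h : M.IsDeterministic) : (machine M).IsDeterministic := by
  intro (l : JudgeLabel M.Λ) (next : Bool → JudgeLabel M.Λ)
  change program M l ≠ .toss next
  cases l with
  | decide l =>
    cases hl : M.program l with
    | toss next' => exact absurd hl (h l _)
    | _ => simp [program, hl, Instr.map]
  | _ => simp [program]

/-- The contents of the stacks. -/
def contents {W : Type} (x : List Bool) (q a : Fin 3 → List Bool) (v : List Bool)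
    (s : Option (Fin 3) → List Bool) : RefereeInput 3 ⊕ Unit ⊕ (Option (Fin 3) ⊕ W) → List Bool
  | .inl .input => x
  | .inl (.question i) => q i
  | .inl (.answer i) => a i
  | .inr (.inl _) => v
  | .inr (.inr (.inl i)) => s i
  | .inr (.inr (.inr _)) => []

section Contents

variable {W : Type} (x : List Bool) (q a : Fin 3 → List Bool) (v : List Bool)
  (s : Option (Fin 3) → List Bool) (l : List Bool)

theorem contents_quest_ne (i : Fin 3) (k) (hk : k ≠ quest i) :
    contents (W := W) x (Function.update q i l) a v s k = contents x q a v s k := by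
  rcases k with (_ | _ | _) | _ | _ | _ <;> simp only [contents]
  rw [Function.update_of_ne]
  rintro rfl
  exact hk rfl

theorem contents_answ_ne (i : Fin 3) (k) (hk : k ≠ answ i) :
    contents (W := W) x q (Function.update a i l) v s k = contents x q a v s k := by
  rcases k with (_ | _ | _) | _ | _ | _ <;> simp only [contents]
  rw [Function.update_of_ne]
  rintro rfl
  exact hk rfl

theorem contents_verdict_ne (k) (hk : k ≠ verdict) :
    contents (W := W) x q a l s k = contents x q a v s k := by
  rcases k with (_ | _ | _) | _ | _ | _ <;> simp only [contents]
  exact absurd rfl hk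

theorem contents_work_ne (i : Option (Fin 3)) (k) (hk : k ≠ work i) :
    contents (W := W) x q a v (Function.update s i l) k = contents x q a v s k := by
  rcases k with (_ | _ | _) | _ | _ | _ <;> simp only [contents]
  rw [Function.update_of_ne]
  rintro rfl
  exact hk rfl

end Contents

variable {M} {ω : ℕ → Bool} (x : List Bool) (q a : Fin 3 → List Bool) (v : List Bool)
  (s : Option (Fin 3) → List Bool) (t : ℕ)

/-- The answer bits that the judging machine reads. -/
def bits (a : Fin 3 → List Bool) : Fin 3 → Bool := fun i => (a i).head?.getD false

theorem read_answers :
    (machine M).Reaches ω 3 ⟨.answer0, contents x q a v s, t⟩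
      ⟨.tagFirst (bits a), contents x q (fun i => (a i).tail) v s, t⟩ := by
  have s0 : (machine M).step ω ⟨.answer0, contents x q a v s, t⟩
      = ⟨.answer1 (bits a 0), contents x q (Function.update a 0 (a 0).tail) v s, t⟩ :=
    Machine.step_eq_of_pop (k := answ 0) rfl rfl rfl (by simp [contents, answ])
      (contents_answ_ne x q a v s _ 0)
  have s1 : (machine M).step ω
        ⟨.answer1 (bits a 0), contents x q (Function.update a 0 (a 0).tail) v s, t⟩
      = ⟨.answer2 (bits a 0) (bits a 1), contents x q
        (Function.update (Function.update a 0 (a 0).tail) 1 (a 1).tail) v s, t⟩ :=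
    Machine.step_eq_of_pop (k := answ 1) rfl rfl rfl (by simp [contents, answ])
      (contents_answ_ne x q _ v s _ 1)
  have s2 : (machine M).step ω ⟨.answer2 (bits a 0) (bits a 1), contents x q
        (Function.update (Function.update a 0 (a 0).tail) 1 (a 1).tail) v s, t⟩
      = ⟨.tagFirst ![bits a 0, bits a 1, bits a 2], contents x q (Function.update
        (Function.update (Function.update a 0 (a 0).tail) 1 (a 1).tail) 2 (a 2).tail) v s, t⟩ :=
    Machine.step_eq_of_pop (k := answ 2) rfl rfl rfl (by simp [contents, answ])
      (contents_answ_ne x q _ v s _ 2)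
  have e1 : ![bits a 0, bits a 1, bits a 2] = bits a := by funext i; fin_cases i <;> rfl
  have e2 : (Function.update (Function.update (Function.update a 0 (a 0).tail) 1 (a 1).tail) 2
      (a 2).tail) = fun i => (a i).tail := by funext i; fin_cases i <;> simp
  rw [e1, e2] at s2
  exact (Machine.Reaches.step s0).trans ((Machine.Reaches.step s1).trans (Machine.Reaches.step s2))

theorem read_tags (β : Fin 3 → Bool) (l : JudgeLabel M.Λ)
    (hl : l = if (q 0).head? = (q 1).head? then
      if β 0 = β 1 ∧ β 1 = β 2 then .accept else .finish else .parse β) :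
    ∃ q', q' 0 = (q 0).tail ∧
      (machine M).Reaches ω 2 ⟨.tagFirst β, contents x q a v s, t⟩ ⟨l, contents x q' a v s, t⟩ := by
  have s0 : (machine M).step ω ⟨.tagFirst β, contents x q a v s, t⟩
      = ⟨.tagSecond β (q 0).head?, contents x (Function.update q 0 (q 0).tail) a v s, t⟩ :=
    Machine.step_eq_of_pop (k := quest 0) rfl rfl rfl (by simp [contents, quest])
      (contents_quest_ne x q a v s _ 0)
  refine ⟨Function.update (Function.update q 0 (q 0).tail) 1 (q 1).tail, by simp, ?_⟩
  refine (Machine.Reaches.step s0).trans (Machine.Reaches.step ?_)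
  exact Machine.step_eq_of_pop (k := quest 1) rfl hl rfl (by simp [contents, quest])
    (contents_quest_ne x _ a v s _ 1)

/-- The string that the judging machine extracts from a question to the first prover, on top of the
string `s`. -/
def parseString : List Bool → List Bool → List Bool
  | true :: b :: l, s => parseString l (b :: s)
  | [true], s => false :: s
  | _, s => s

/-- The judge must run in polynomial time on all questions, including malformed ones, so the
extracted memory has to be bounded for every string. -/
theorem length_parseString_le (l s : List Bool) :
    (parseString l s).length ≤ l.length + s.length := by
  induction l, s using parseString.induct with
  | case1 b l s ih => simp only [parseString, List.length_cons] at *; omega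
  | case2 s => simp [parseString]
  | case3 l s h1 h2 => simp [parseString]

theorem read_memory (β : Fin 3 → Bool) (q : Fin 3 → List Bool) :
    ∃ n ≤ 3 * (q 0).length + 4, ∃ q',
      (machine M).Reaches ω n ⟨.parse β, contents x q a v s, t⟩
        ⟨.put β 0, contents x q' a v
          (Function.update s none (parseString (q 0) (s none))), t⟩ := by
  have pop_parse (q : Fin 3 → List Bool) (s : Option (Fin 3) → List Bool) (l : JudgeLabel M.Λ)
      (hl : l = if (q 0).head? = some true then .parseBit β else .put β 0) :
      (machine M).step ω ⟨.parse β, contents x q a v s, t⟩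
      = ⟨l, contents x (Function.update q 0 (q 0).tail) a v s, t⟩ :=
    Machine.step_eq_of_pop (k := quest 0) rfl hl rfl (by simp [contents, quest])
      (contents_quest_ne x q a v s _ 0)
  have pop_bit (q : Fin 3 → List Bool) (s : Option (Fin 3) → List Bool) :
      (machine M).step ω ⟨.parseBit β, contents x q a v s, t⟩
      = ⟨.store β ((q 0).head?.getD false),
        contents x (Function.update q 0 (q 0).tail) a v s, t⟩ :=
    Machine.step_eq_of_pop (k := quest 0) rfl rfl rfl (by simp [contents, quest])
      (contents_quest_ne x q a v s _ 0)
  have store (q : Fin 3 → List Bool) (s : Option (Fin 3) → List Bool) (b : Bool) :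
      (machine M).step ω ⟨.store β b, contents x q a v s, t⟩
      = ⟨.parse β, contents x q a v (Function.update s none (b :: s none)), t⟩ :=
    Machine.step_eq_of_push (k := work none) rfl rfl rfl (by simp [contents, work])
      (contents_work_ne x q a v s _ none)
  generalize hl : q 0 = l
  generalize hr : s none = r
  induction l, r using parseString.induct generalizing q s with
  | case1 b l r ih =>
    obtain ⟨n, hn, q', h⟩ := ih (Function.update s none (b :: s none)) (Function.update q 0 l)
      (by simp) (by simp [hr])
    have s0 := pop_parse q s (.parseBit β) (by simp [hl])
    rw [hl, List.tail_cons] at s0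
    have s1 := pop_bit (Function.update q 0 (b :: l)) s
    simp only [Function.update_self, List.head?_cons, Option.getD_some, List.tail_cons,
      Function.update_idem] at s1
    have h' := (Machine.Reaches.step s0).trans ((Machine.Reaches.step s1).trans
      ((Machine.Reaches.step (store _ s b)).trans h))
    refine ⟨1 + (1 + (1 + n)), ?_, q', ?_⟩
    · simp only [List.length_cons]; omega
    · simpa [parseString] using h'
  | case2 r =>
    have s0 := pop_parse q s (.parseBit β) (by simp [hl])
    rw [hl, List.tail_cons] at s0
    have s1 := pop_bit (Function.update q 0 []) s
    simp only [Function.update_self, List.head?_nil, Option.getD_none, List.tail_nil,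
      Function.update_idem] at s1
    have s3 := pop_parse (Function.update q 0 []) (Function.update s none (false :: s none))
      (.put β 0) (by simp)
    simp only [Function.update_self, List.tail_nil, Function.update_idem] at s3
    have h' := (Machine.Reaches.step s0).trans ((Machine.Reaches.step s1).trans
      ((Machine.Reaches.step (store _ s false)).trans (Machine.Reaches.step s3)))
    refine ⟨1 + (1 + (1 + 1)), by simp, Function.update q 0 [], ?_⟩
    · simpa [parseString, hr] using h'
  | case3 l r h1 h2 =>
    have hh : (q 0).head? ≠ some true := by
      rw [hl]
      rcases l with _ | ⟨_ | _, _ | ⟨b, l⟩⟩ <;> simp_all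
    have s0 := pop_parse q s (.put β 0) (if_neg hh).symm
    have e : parseString l r = r := by
      rcases l with _ | ⟨_ | _, _ | ⟨b, l⟩⟩ <;> simp_all [parseString]
    refine ⟨1, by omega, Function.update q 0 (q 0).tail, ?_⟩
    rw [e, ← hr, Function.update_eq_self]
    exact Machine.Reaches.step s0

theorem put_answers (β : Fin 3 → Bool) (m : List Bool) :
    (machine M).Reaches ω 3
      ⟨.put β 0, contents x q a v (Function.update (fun _ => []) none m), t⟩
      ⟨.decide M.start, contents x q a v (fun o => o.elim m fun i => [β i]), t⟩ := by
  have st (s : Option (Fin 3) → List Bool) (i : Fin 3) (l : JudgeLabel M.Λ)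
      (hl : l = if i = 2 then .decide M.start else .put β (i + 1)) :
      (machine M).step ω ⟨.put β i, contents x q a v s, t⟩
      = ⟨l, contents x q a v (Function.update s (some i) (β i :: s (some i))), t⟩ :=
    Machine.step_eq_of_push (k := work (some i)) rfl hl rfl (by simp [contents, work])
      (contents_work_ne x q a v s _ (some i))
  have h := (Machine.Reaches.step (st (Function.update (fun _ => []) none m) 0
    (.put β 1) rfl)).trans ((Machine.Reaches.step (st _ 1 (.put β 2) rfl)).trans
    (Machine.Reaches.step (st _ 2 (.decide M.start) rfl)))
  have e : Function.update (Function.update (Function.update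
      (Function.update (fun _ : Option (Fin 3) => []) none m)
      (some 0) [β 0]) (some 1) [β 1]) (some 2) [β 2] = fun o => o.elim m fun i => [β i] := by
    funext o
    rcases o with _ | i
    · simp
    · fin_cases i <;> simp
  rw [← e]
  simpa using h

theorem extend_stack_init (m : List Bool) (β : Fin 3 → Bool) :
    Function.extend (stack M) (M.init (deciderInput x m β)).stk (contents x q a [] fun _ => [])
      = contents x q a [] (fun o => o.elim m fun i => [β i]) := by
  have hin (k) : Function.extend (stack M) (M.init (deciderInput x m β)).stk
      (contents x q a [] fun _ => []) (stack M k) = (M.init (deciderInput x m β)).stk k :=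
    (stack_injective M).extend_apply _ _ _
  funext k
  rcases k with (_ | _ | _) | _ | (_ | i) | w
  · exact hin (.inl .input)
  · rw [Function.extend_apply']
    · rfl
    · rintro ⟨(_ | _ | _) | _ | _, h⟩ <;> simp [stack] at h
  · rw [Function.extend_apply']
    · rfl
    · rintro ⟨(_ | _ | _) | _ | _, h⟩ <;> simp [stack] at h
  · exact hin (.inr (.inl ()))
  · exact hin (.inl .memory)
  · exact hin (.inl (.answer i))
  · exact hin (.inr (.inr w))

theorem init_machine :
    (machine M).init (refereeInput x q a) = ⟨.answer0, contents x q a [] (fun _ => []), 0⟩ := by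
  unfold Machine.init
  congr 1
  funext k
  rcases k with (_ | _ | _) | _ | (_ | i) | w <;> rfl

/-- The run of the judging machine. -/
theorem run_machine {T : ℕ}
    (hT : (q 0).head? ≠ (q 1).head? →
      M.HaltsBy (deciderInput x (parseString (q 0).tail []) (bits a)) (fun _ => false) T) :
    ∃ n ≤ T + 3 * (q 0).length + 12, ∃ c,
      (machine M).Reaches (fun _ => false) n ((machine M).init (refereeInput x q a)) c ∧
      (machine M).program c.label = .halt ∧
      (c.stk (.inr (.inl ())) = [true] ↔
        if (q 0).head? = (q 1).head? then bits a 0 = bits a 1 ∧ bits a 1 = bits a 2 else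
          M.output (deciderInput x (parseString (q 0).tail []) (bits a)) (fun _ => false) T ()
            = [true]) := by
  have h0 := read_answers (M := M) (ω := fun _ => false) x q a [] (fun _ => []) 0
  have h1 (l) (hl) := read_tags (M := M) (ω := fun _ => false) x q (fun i => (a i).tail) []
    (fun _ => []) 0 (bits a) l hl
  rw [init_machine]
  by_cases hq : (q 0).head? = (q 1).head?
  · rw [if_pos hq]
    by_cases hβ : bits a 0 = bits a 1 ∧ bits a 1 = bits a 2
    · obtain ⟨q', hq', h1⟩ := h1 .accept (by rw [if_pos hq, if_pos hβ])
      have s2 : (machine M).step (fun _ => false)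
          ⟨.accept, contents x q' (fun i => (a i).tail) [] (fun _ => []), 0⟩
          = ⟨.finish, contents x q' (fun i => (a i).tail) [true] (fun _ => []), 0⟩ :=
        Machine.step_eq_of_push (k := verdict) rfl rfl rfl rfl
          (contents_verdict_ne x q' _ [] _ [true])
      exact ⟨_, by omega, _, h0.trans (h1.trans (Machine.Reaches.step s2)), rfl,
        by simp [contents, hβ]⟩
    · obtain ⟨q', hq', h1⟩ := h1 .finish (by rw [if_pos hq, if_neg hβ])
      exact ⟨_, by omega, _, h0.trans h1, rfl, by simp [contents, hβ]⟩
  · obtain ⟨q', hq', h1⟩ := h1 (.parse (bits a)) (by rw [if_neg hq])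
    rw [if_neg hq]
    obtain ⟨n, hn, q'', h2⟩ := read_memory (M := M) (ω := fun _ => false) x
      (fun i => (a i).tail) [] (fun _ => []) 0 (bits a) q'
    rw [hq'] at h2 hn
    have h3 := put_answers (M := M) (ω := fun _ => false) x q'' (fun i => (a i).tail) [] 0 (bits a)
      (parseString (q 0).tail [])
    obtain ⟨n', hn', hlt, hrun, hhalt⟩ := (hT hq).exists_first
    set m := parseString (q 0).tail [] with hm
    have h4 := Machine.iterate_lift (N := machine M) (ω := fun _ => false) (ω' := fun _ => false)
      (stack_injective M) (g := JudgeLabel.decide) (off := 0)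
      (fr := contents x q'' (fun i => (a i).tail) [] fun _ => []) (fun _ => rfl)
      (fun l hl => rfl) (M.init (deciderInput x m (bits a))) n' hlt
    rw [hrun] at h4
    set cf := M.run (deciderInput x m (bits a)) (fun _ => false) T with hcf
    have e : (M.init (deciderInput x m (bits a))).lift (stack M) JudgeLabel.decide
        (contents x q'' (fun i => (a i).tail) [] fun _ => []) 0
        = ⟨.decide M.start, contents x q'' (fun i => (a i).tail) []
          (fun o => o.elim m fun i => [bits a i]), 0⟩ := by
      unfold Cfg.lift
      rw [extend_stack_init]
      rfl
    have h5 := (congrArg ((machine M).step fun _ => false)^[n'] e.symm).trans h4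
    refine ⟨_, ?_, _, h0.trans (h1.trans (h2.trans (h3.trans h5))), ?_, ?_⟩
    · rw [List.length_tail] at hn
      omega
    -- A halting instruction is mapped to a halting instruction, so the judge stops exactly where
    -- the decision machine does, with its verdict on the shared output stack.
    · change (M.program cf.label).map (stack M) JudgeLabel.decide = _
      rw [hhalt]
      rfl
    · have : Function.extend (stack M) cf.stk (contents x q'' (fun i => (a i).tail) [] fun _ => [])
          (stack M (.inr (.inl ()))) = cf.stk (.inr (.inl ())) :=
        (stack_injective M).extend_apply _ _ _
      change Function.extend (stack M) cf.stk (contents x q'' (fun i => (a i).tail) [] fun _ => [])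
        (stack M (.inr (.inl ()))) = [true] ↔ _
      rw [this]
      rfl

end Judge

/-! ### Sequential measurements and their statistics -/

section Words

variable {J P 𝒜 : Type*} [Fintype J] [DecidableEq J] [Ring 𝒜]

theorem sum_eq_half_sum_update (r : J) (f : (J → Bool) → ℝ) :
    ∑ b, f b = 1 / 2 * ∑ b, ∑ β, f (Function.update b r β) := by
  have flip_inv : Function.Involutive fun b : J → Bool => Function.update b r (!b r) := by
    intro b
    simp
  have h1 : ∑ b : J → Bool, f (Function.update b r (!b r)) = ∑ b, f b :=
    Equiv.sum_comp flip_inv.toPerm f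
  have h2 : ∀ b : J → Bool, ∑ β, f (Function.update b r β)
      = f b + f (Function.update b r (!b r)) := by
    intro b
    have : f b = f (Function.update b r (b r)) := by rw [Function.update_eq_self]
    rw [this, Fintype.sum_bool]
    cases b r <;> simp [add_comm]
  simp only [h2, Finset.sum_add_distrib, h1]
  ring

/-- The product of the operators of a word, evaluated at the outcomes `b`. The rightmost letter acts
first. -/
def wordOp (K : P → J → Bool → 𝒜) (w : List (P × J)) (b : J → Bool) : 𝒜 :=
  (w.map fun x => K x.1 x.2 (b x.2)).prod

theorem wordOp_append (K : P → J → Bool → 𝒜) (w w' : List (P × J)) (b : J → Bool) :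
    wordOp K (w ++ w') b = wordOp K w b * wordOp K w' b := by
  simp [wordOp]

theorem wordOp_cons (K : P → J → Bool → 𝒜) (x : P × J) (w : List (P × J)) (b : J → Bool) :
    wordOp K (x :: w) b = K x.1 x.2 (b x.2) * wordOp K w b := by
  simp [wordOp]

theorem wordOp_update (K : P → J → Bool → 𝒜) {w : List (P × J)} {r : J}
    (hr : r ∉ w.map Prod.snd) (b : J → Bool) (β : Bool) :
    wordOp K w (Function.update b r β) = wordOp K w b := by
  unfold wordOp
  congr 1
  refine List.map_congr_left fun x hx => ?_
  have : x.2 ≠ r := fun h => hr (h ▸ List.mem_map_of_mem hx)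
  rw [Function.update_of_ne this]

/-- Commuting operators: a letter can be moved past the letters of the other players. -/
theorem wordOp_move {K : P → J → Bool → 𝒜}
    (hcomm : ∀ p p', p ≠ p' → ∀ r β r' β', Commute (K p r β) (K p' r' β'))
    (l₁ l l₂ : List (P × J)) (x : P × J) (hx : ∀ y ∈ l, y.1 ≠ x.1) :
    wordOp K (l₁ ++ l ++ x :: l₂) = wordOp K (l₁ ++ x :: l ++ l₂) := by
  funext b
  have hc : Commute (K x.1 x.2 (b x.2)) (wordOp K l b) := by
    refine Commute.list_prod_right _ _ fun z hz => ?_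
    obtain ⟨y, hy, rfl⟩ := List.mem_map.1 hz
    exact hcomm _ _ (hx y hy).symm _ _ _ _
  simp only [wordOp_append, wordOp_cons, List.append_assoc, List.cons_append]
  rw [← mul_assoc (wordOp K l b), ← hc.eq, mul_assoc]

open Classical in
/-- The square root of the probability of the event `F` when the measurements of the word are made
one after the other, from right to left, and registers that are not measured are filled with
uniform bits. The operators are scaled by `√2`. -/
noncomputable def wnorm (nrm : AddGroupSeminorm 𝒜) (K : P → J → Bool → 𝒜) (F : (J → Bool) → Prop)
    (w : List (P × J)) : ℝ :=
  ‖(WithLp.toLp 2 fun b => if F b then nrm (wordOp K w b) else 0 : EuclideanSpace ℝ (J → Bool))‖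
    / √(2 ^ Fintype.card J)

variable {nrm : AddGroupSeminorm 𝒜} {K : P → J → Bool → 𝒜}

theorem wnorm_nonneg (F : (J → Bool) → Prop) (w : List (P × J)) : 0 ≤ wnorm nrm K F w := by
  unfold wnorm; positivity

open Classical in
theorem wnorm_sq (F : (J → Bool) → Prop) (w : List (P × J)) :
    wnorm nrm K F w ^ 2
      = (∑ b, if F b then nrm (wordOp K w b) ^ 2 else 0) / 2 ^ Fintype.card J := by
  unfold wnorm
  rw [div_pow, EuclideanSpace.norm_sq_eq, Real.sq_sqrt (by positivity)]
  congr 1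
  refine Finset.sum_congr rfl fun b _ => ?_
  by_cases h : F b <;> simp [h]

theorem wnorm_congr {F : (J → Bool) → Prop} {w w' : List (P × J)}
    (h : wordOp K w = wordOp K w') : wnorm nrm K F w = wnorm nrm K F w' := by
  unfold wnorm; rw [h]

theorem wnorm_mono_event {F F' : (J → Bool) → Prop} (w : List (P × J))
    (h : ∀ b, F b → F' b) : wnorm nrm K F w ^ 2 ≤ wnorm nrm K F' w ^ 2 := by
  classical
  rw [wnorm_sq, wnorm_sq]
  gcongr with b
  by_cases h1 : F b
  · simp [h1, h b h1]
  · simp only [h1, if_false]; split_ifs <;> positivity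

theorem wnorm_union (F F' : (J → Bool) → Prop) (w : List (P × J)) :
    wnorm nrm K (fun b => F b ∨ F' b) w ^ 2 ≤ wnorm nrm K F w ^ 2 + wnorm nrm K F' w ^ 2 := by
  classical
  rw [wnorm_sq, wnorm_sq, wnorm_sq, ← add_div, ← Finset.sum_add_distrib]
  gcongr with b
  by_cases h1 : F b <;> by_cases h2 : F' b <;> simp [h1, h2]

/-- The event `F` does not depend on the register `r`. -/
def Ignores (F : (J → Bool) → Prop) (r : J) : Prop :=
  ∀ b β, F (Function.update b r β) ↔ F b

open Classical in
-- Measurements made last, with outcomes that nobody looks at, preserve the total weight: averaging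
-- over the register of the leftmost letter removes this letter by `hK`. Each register must occur
-- only once in the word.
theorem sum_wordOp_mul (hK : ∀ p r X, ∑ β, nrm (K p r β * X) ^ 2 = 2 * nrm X ^ 2)
    {F : (J → Bool) → Prop} {w : List (P × J)} (hw : (w.map Prod.snd).Nodup)
    (X : (J → Bool) → 𝒜) (hX : ∀ r ∈ w.map Prod.snd, ∀ b β, X (Function.update b r β) = X b)
    (hF : ∀ r ∈ w.map Prod.snd, Ignores F r) :
    (∑ b, if F b then nrm (wordOp K w b * X b) ^ 2 else 0)
      = ∑ b, if F b then nrm (X b) ^ 2 else 0 := by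
  induction w with
  | nil => simp [wordOp]
  | cons x w ih =>
    simp only [List.map_cons, List.nodup_cons] at hw
    rw [← ih hw.2 (fun r hr => hX r (by simp at hr ⊢; tauto))
      (fun r hr => hF r (by simp at hr ⊢; tauto)), sum_eq_half_sum_update x.2]
    rw [Finset.mul_sum]
    refine Finset.sum_congr rfl fun b _ => ?_
    simp only [wordOp_cons, wordOp_update K hw.1, hX x.2 (by simp), Function.update_self,
      hF x.2 (by simp) b _, mul_assoc]
    by_cases h : F b
    · simp only [h, if_true]
      rw [hK]; ring
    · simp [h]

/-- Later measurements do not influence the statistics of earlier ones. -/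
theorem wnorm_append_of_ignores
    (hK : ∀ p r X, ∑ β, nrm (K p r β * X) ^ 2 = 2 * nrm X ^ 2)
    {F : (J → Bool) → Prop} {w w' : List (P × J)} (hw : ((w ++ w').map Prod.snd).Nodup)
    (hF : ∀ r ∈ w.map Prod.snd, Ignores F r) :
    wnorm nrm K F (w ++ w') = wnorm nrm K F w' := by
  classical
  rw [List.map_append, List.nodup_append] at hw
  rw [← sq_eq_sq₀ (wnorm_nonneg _ _) (wnorm_nonneg _ _), wnorm_sq, wnorm_sq]
  congr 1
  simp only [wordOp_append]
  refine sum_wordOp_mul hK hw.1 _ (fun r hr b β => wordOp_update K ?_ b β) hF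
  exact fun h => hw.2.2 r hr r h rfl

theorem wnorm_true_nil : wnorm nrm K (fun _ => True) [] ^ 2 = nrm 1 ^ 2 := by
  rw [wnorm_sq]
  simp [wordOp]

/-- Changing the player who measures first. -/
theorem abs_wnorm_sub_wnorm_le
    (hK : ∀ p r X, ∑ β, nrm (K p r β * X) ^ 2 = 2 * nrm X ^ 2)
    (F : (J → Bool) → Prop) {w : List (P × J)} {p p' : P} {r : J} {d : ℝ} (hd : 0 ≤ d)
    (hw : ((w ++ [(p, r)]).map Prod.snd).Nodup)
    (hdist : ∑ β, nrm (K p r β - K p' r β) ^ 2 ≤ 2 * d ^ 2) :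
    |wnorm nrm K F (w ++ [(p, r)]) - wnorm nrm K F (w ++ [(p', r)])| ≤ d := by
  classical
  have hs : (0 : ℝ) < √(2 ^ Fintype.card J) := by positivity
  unfold wnorm
  rw [← sub_div, abs_div, abs_of_pos hs, div_le_iff₀ hs]
  -- The reverse triangle inequality in the Euclidean space indexed by outcomes. Restricting to `F`
  -- only shrinks the difference vector, so the bound does not depend on the event.
  refine (abs_norm_sub_norm_le _ _).trans ?_
  refine abs_le_of_sq_le_sq' ?_ (by positivity) |>.2
  rw [EuclideanSpace.norm_sq_eq, mul_pow, Real.sq_sqrt (by positivity)]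
  rw [List.map_append, List.nodup_append] at hw
  have hr : r ∉ w.map Prod.snd := fun h => hw.2.2 r h r (by simp) rfl
  calc _ ≤ ∑ b : J → Bool, nrm (wordOp K w b * (K p r (b r) - K p' r (b r))) ^ 2 := by
        refine Finset.sum_le_sum fun b _ => ?_
        by_cases h : F b
        · simp only [PiLp.sub_apply, h, if_true, Real.norm_eq_abs]
          rw [sq_le_sq, abs_abs, abs_of_nonneg (apply_nonneg nrm _)]
          refine (abs_sub_map_le_sub nrm _ _).trans (le_of_eq ?_)
          simp [mul_sub, wordOp]
        · simp [h]
    -- The common factor `w` is measured later and drops out.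
    _ = ∑ b : J → Bool, nrm (K p r (b r) - K p' r (b r)) ^ 2 := by
        have := sum_wordOp_mul (F := fun _ => True) hK hw.1
          (fun b => K p r (b r) - K p' r (b r))
          (fun s hs b β => by
            have : r ≠ s := fun h => hr (h ▸ hs)
            simp [Function.update_of_ne this]) (fun _ _ _ _ => Iff.rfl)
        simpa using this
    _ ≤ _ := by
        rw [sum_eq_half_sum_update r]
        simp only [Function.update_self, Finset.sum_const, Finset.card_univ, nsmul_eq_mul,
          Fintype.card_fun, Fintype.card_bool, Nat.cast_pow, Nat.cast_ofNat]
        have : (0 : ℝ) < 2 ^ Fintype.card J := by positivity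
        nlinarith

/-- Dropping the letter measured first, if some player has not measured yet. -/
theorem abs_wnorm_sub_wnorm_le_of_ignores
    (hcomm : ∀ p p', p ≠ p' → ∀ r β r' β', Commute (K p r β) (K p' r' β'))
    (hK : ∀ p r X, ∑ β, nrm (K p r β * X) ^ 2 = 2 * nrm X ^ 2)
    {F : (J → Bool) → Prop} {w : List (P × J)} {p p' : P} {r : J} {d : ℝ} (hd : 0 ≤ d)
    (hw : ((w ++ [(p, r)]).map Prod.snd).Nodup)
    (hdist : ∑ β, nrm (K p r β - K p' r β) ^ 2 ≤ 2 * d ^ 2)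
    (hp' : ∀ x ∈ w, x.1 ≠ p') (hF : Ignores F r) :
    |wnorm nrm K F (w ++ [(p, r)]) - wnorm nrm K F w| ≤ d := by
  have h1 := abs_wnorm_sub_wnorm_le hK F hd hw hdist
  -- After the handover to `p'`, the letter commutes to the left end, where it is measured last and
  -- its register is ignored.
  have h2 : wnorm nrm K F (w ++ [(p', r)]) = wnorm nrm K F ([(p', r)] ++ w) := by
    have := wordOp_move hcomm [] w [] (p', r) hp'
    simp only [List.nil_append, List.append_nil] at this
    exact wnorm_congr this
  have h3 : wnorm nrm K F ([(p', r)] ++ w) = wnorm nrm K F w := by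
    refine wnorm_append_of_ignores hK ?_ ?_
    · simp only [List.map_append, List.map_cons, List.map_nil] at hw ⊢
      exact List.nodup_append_comm.1 hw
    · simpa using hF
  rwa [h2, h3] at h1

end Words

/-! ### Comparison of the random proof with the answers in a simulation test -/

section Rounding

variable {I 𝒜 : Type*} [Fintype I] [DecidableEq I] [Ring 𝒜] {nrm : AddGroupSeminorm 𝒜}
  {K : Fin 3 → I ⊕ Fin 3 → Bool → 𝒜}

/-- The letters of a list, measured by the middle player. -/
def measured (l : List I) : List (Fin 3 × (I ⊕ Fin 3)) := l.map fun y => (1, Sum.inl y)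

theorem measured_append (l l' : List I) : measured (l ++ l') = measured l ++ measured l' := by
  simp [measured]

theorem measured_map_snd (l : List I) : (measured l).map Prod.snd = l.map Sum.inl := by
  simp [measured]

theorem fst_of_mem_measured {l : List I} {x : Fin 3 × (I ⊕ Fin 3)} (hx : x ∈ measured l) :
    x.1 = 1 := by
  simp only [measured, List.mem_map] at hx
  obtain ⟨y, _, rfl⟩ := hx
  rfl

/-- The letters are removed from the right, earliest measurement first. The player `p'` occurs
nowhere in the word, so each letter can be handed over to `p'` and dropped at the cost `D y`. -/
theorem abs_wnorm_append_measured_sub_le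
    (hcomm : ∀ p p', p ≠ p' → ∀ r β r' β', Commute (K p r β) (K p' r' β'))
    (hK : ∀ p r X, ∑ β, nrm (K p r β * X) ^ 2 = 2 * nrm X ^ 2)
    {D : I → ℝ} (hD : ∀ y, 0 ≤ D y)
    (hdist : ∀ p', p' ≠ 1 → ∀ y,
      ∑ β, nrm (K 1 (Sum.inl y) β - K p' (Sum.inl y) β) ^ 2 ≤ 2 * D y ^ 2)
    {F : (I ⊕ Fin 3 → Bool) → Prop} {w : List (Fin 3 × (I ⊕ Fin 3))} {p' : Fin 3} (hp1 : p' ≠ 1)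
    (hp' : ∀ x ∈ w, x.1 ≠ p') (l : List I)
    (hw : ((w ++ measured l).map Prod.snd).Nodup) (hF : ∀ y ∈ l, Ignores F (Sum.inl y)) :
    |wnorm nrm K F (w ++ measured l) - wnorm nrm K F w| ≤ (l.map D).sum := by
  induction l using List.reverseRecOn with
  | nil => simp [measured]
  | append_singleton l y ih =>
    rw [measured_append, ← List.append_assoc] at hw ⊢
    have hs : measured [y] = [((1 : Fin 3), (Sum.inl y : I ⊕ Fin 3))] := rfl
    rw [hs] at hw ⊢
    have h1 := abs_wnorm_sub_wnorm_le_of_ignores hcomm hK (F := F) (p' := p') (hD y) hw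
      (hdist p' hp1 y) (fun x hx => by
        rcases List.mem_append.1 hx with hx | hx
        · exact hp' x hx
        · rw [fst_of_mem_measured hx]; exact hp1.symm) (hF y (by simp))
    have h2 := ih (by
      rw [List.map_append] at hw
      exact (List.nodup_append.1 hw).1) (fun y hy => hF y (by simp [hy]))
    simp only [List.map_append, List.sum_append, List.map_cons, List.map_nil, List.sum_cons,
      List.sum_nil, add_zero]
    calc _ ≤ _ := abs_sub_le _ _ _
      _ ≤ _ := add_le_add h1 h2
      _ = _ := add_comm _ _

/-- Measuring all the letters before `i` hardly affects the joint distribution of the register `i`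
and of a register that another player measures. -/
theorem wnorm_cons_measured_le
    (hcomm : ∀ p p', p ≠ p' → ∀ r β r' β', Commute (K p r β) (K p' r' β'))
    (hK : ∀ p r X, ∑ β, nrm (K p r β * X) ^ 2 = 2 * nrm X ^ 2)
    {D : I → ℝ} (hD : ∀ y, 0 ≤ D y)
    (hdist : ∀ p', p' ≠ 1 → ∀ y,
      ∑ β, nrm (K 1 (Sum.inl y) β - K p' (Sum.inl y) β) ^ 2 ≤ 2 * D y ^ 2)
    {L : List I} (hL : L.Nodup) {i : I} (hi : i ∈ L) {p p' : Fin 3} (hp : p ≠ 1) (hp1 : p' ≠ 1)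
    (hpp : p ≠ p') (t : Fin 3) {F : (I ⊕ Fin 3 → Bool) → Prop}
    (hF : ∀ y, y ≠ i → Ignores F (Sum.inl y)) :
    wnorm nrm K F ((p, Sum.inr t) :: measured L)
      ≤ ∑ y ∈ L.toFinset.erase i, D y
        + wnorm nrm K F [(p, Sum.inr t), (1, Sum.inl i)] := by
  -- Words act from right to left: `l₁` is measured before `i`, and its letters must be paid for;
  -- `l₂` is measured after `i` and drops out for free, once the letter of `p` has been commuted
  -- past it.
  obtain ⟨l₂, l₁, rfl⟩ := List.append_of_mem hi
  have hnot : i ∉ l₁ ∧ i ∉ l₂ := by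
    have := hL
    rw [List.nodup_append, List.nodup_cons] at this
    exact ⟨this.2.1.1, fun h => this.2.2 i h i (by simp) rfl⟩
  have hnd : (((p, (Sum.inr t : I ⊕ Fin 3)) :: measured (l₂ ++ i :: l₁)).map Prod.snd).Nodup := by
    rw [List.map_cons, measured_map_snd, List.nodup_cons]
    exact ⟨by simp, hL.map Sum.inl_injective⟩
  have e1 : (p, (Sum.inr t : I ⊕ Fin 3)) :: measured (l₂ ++ i :: l₁)
      = ((p, Sum.inr t) :: measured (l₂ ++ [i])) ++ measured l₁ := by
    simp [measured]
  rw [e1] at hnd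
  have h1 := abs_wnorm_append_measured_sub_le hcomm hK hD hdist (F := F)
    (w := (p, Sum.inr t) :: measured (l₂ ++ [i])) hp1 (fun x hx => by
      rcases List.mem_cons.1 hx with rfl | hx
      · exact hpp
      · rw [fst_of_mem_measured hx]; exact hp1.symm) l₁ hnd
      (fun y hy => hF y (fun h => hnot.1 (h ▸ hy)))
  have h2 : wnorm nrm K F ((p, Sum.inr t) :: measured (l₂ ++ [i]))
      = wnorm nrm K F (measured l₂ ++ [(p, Sum.inr t), (1, Sum.inl i)]) := by
    have := wordOp_move hcomm [] (measured l₂) [((1 : Fin 3), (Sum.inl i : I ⊕ Fin 3))]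
      (p, Sum.inr t) (fun y hy => by rw [fst_of_mem_measured hy]; exact hp.symm)
    refine wnorm_congr ?_
    rw [measured_append]
    simpa [measured] using this.symm
  have h3 : wnorm nrm K F (measured l₂ ++ [(p, Sum.inr t), (1, Sum.inl i)])
      = wnorm nrm K F [(p, Sum.inr t), (1, Sum.inl i)] := by
    refine wnorm_append_of_ignores hK ?_ ?_
    · rw [List.map_append, measured_map_snd]
      have h4 := hL
      rw [List.nodup_append] at h4
      rw [List.nodup_append]
      refine ⟨h4.1.map Sum.inl_injective, by simp, ?_⟩
      intro a ha b hb
      obtain ⟨y, hy, rfl⟩ := List.mem_map.1 ha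
      simp only [List.map_cons, List.map_nil, List.mem_cons, List.not_mem_nil, or_false] at hb
      rcases hb with rfl | rfl
      · simp
      · intro h; exact hnot.2 (Sum.inl_injective h ▸ hy)
    · intro r hr
      rw [measured_map_snd] at hr
      obtain ⟨y, hy, rfl⟩ := List.mem_map.1 hr
      exact hF y (fun h => hnot.2 (h ▸ hy))
  have h4 : (l₁.map D).sum ≤ ∑ y ∈ (l₂ ++ i :: l₁).toFinset.erase i, D y := by
    have hl₁ : l₁.Nodup := by
      rw [List.nodup_append, List.nodup_cons] at hL
      exact hL.2.1.2
    rw [← List.sum_toFinset D hl₁]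
    refine Finset.sum_le_sum_of_subset_of_nonneg (fun y hy => ?_) (fun y _ _ => hD y)
    rw [List.mem_toFinset] at hy
    simp only [Finset.mem_erase, List.mem_toFinset]
    exact ⟨fun h => hnot.1 (h ▸ hy), by simp [hy]⟩
  rw [e1]
  rw [h2, h3] at h1
  linarith [(abs_le.1 h1).2]

/-- The measurement of the whole list by one player reproduces the statistics of three isolated
players: `F` is the bad event for the outcomes at the places `i`, and the registers `Sum.inr` hold
the answers of the three players. -/
theorem wnorm_measured_le
    (hcomm : ∀ p p', p ≠ p' → ∀ r β r' β', Commute (K p r β) (K p' r' β'))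
    (hK : ∀ p r X, ∑ β, nrm (K p r β * X) ^ 2 = 2 * nrm X ^ 2)
    {D : I → ℝ} (hD : ∀ y, 0 ≤ D y)
    (hdist : ∀ p', p' ≠ 1 → ∀ y,
      ∑ β, nrm (K 1 (Sum.inl y) β - K p' (Sum.inl y) β) ^ 2 ≤ 2 * D y ^ 2)
    {d : ℝ} (hd : 0 ≤ d)
    (hdist' : ∀ p', p' ≠ 1 →
      ∑ β, nrm (K 1 (Sum.inr 1) β - K p' (Sum.inr 1) β) ^ 2 ≤ 2 * d ^ 2)
    {L : List I} (hL : L.Nodup) {i : Fin 3 → I} (hi : ∀ t, i t ∈ L)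
    (R : (Fin 3 → Bool) → Prop) {σ : ℝ} {a : Fin 3 → ℝ}
    (hσ : wnorm nrm K (fun b => R fun t => b (Sum.inr t))
      [(0, Sum.inr 0), (2, Sum.inr 2), (1, Sum.inr 1)] ^ 2 ≤ σ)
    (ha0 : wnorm nrm K (fun b => b (Sum.inr 0) ≠ b (Sum.inl (i 0)))
      [(0, Sum.inr 0), (1, Sum.inl (i 0))] ≤ a 0)
    (ha1 : wnorm nrm K (fun b => b (Sum.inr 1) ≠ b (Sum.inl (i 1)))
      [(2, Sum.inr 1), (1, Sum.inl (i 1))] ≤ a 1)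
    (ha2 : wnorm nrm K (fun b => b (Sum.inr 2) ≠ b (Sum.inl (i 2)))
      [(2, Sum.inr 2), (1, Sum.inl (i 2))] ≤ a 2) :
    wnorm nrm K (fun b => R fun t => b (Sum.inl (i t))) (measured L)
      ≤ √(σ + ∑ t, (d + ∑ y ∈ L.toFinset.erase (i t), D y + a t) ^ 2) + d := by
  have ign (t t' : Fin 3) (h : t' ≠ t) (j : I) :
      Ignores (fun b : I ⊕ Fin 3 → Bool => b (Sum.inr t) ≠ b (Sum.inl j)) (Sum.inr t') := by
    intro b β
    simp [h.symm]
  have ign' (t : Fin 3) (j y : I) (h : y ≠ j) :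
      Ignores (fun b : I ⊕ Fin 3 → Bool => b (Sum.inr t) ≠ b (Sum.inl j)) (Sum.inl y) := by
    intro b β
    simp [h.symm]
  have ignR (t : Fin 3) :
      Ignores (fun b : I ⊕ Fin 3 → Bool => R fun t => b (Sum.inl (i t))) (Sum.inr t) := by
    intro b β
    simp
  have ignR' (y : I) :
      Ignores (fun b : I ⊕ Fin 3 → Bool => R fun t => b (Sum.inr t)) (Sum.inl y) := by
    intro b β
    simp
  have hML : ((measured L).map Prod.snd).Nodup := by
    rw [measured_map_snd]; exact hL.map Sum.inl_injective
  have nd1 (p q : Fin 3) (t t' : Fin 3) (h : t ≠ t') :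
      (((p, (Sum.inr t : I ⊕ Fin 3)) :: measured L ++ [(q, Sum.inr t')]).map Prod.snd).Nodup := by
    rw [List.map_append, List.map_cons, measured_map_snd] at *
    simp only [List.map_cons, List.map_nil, List.cons_append, List.nodup_cons, List.mem_append,
      List.nodup_append]
    refine ⟨by simp [h], hML, by simp, ?_⟩
    simp
  have ndL (q : Fin 3) (t' : Fin 3) :
      ((measured L ++ [(q, (Sum.inr t' : I ⊕ Fin 3))]).map Prod.snd).Nodup := by
    have := nd1 q q (t' + 1) t' (by fin_cases t' <;> decide)
    simp only [List.cons_append, List.map_cons, List.nodup_cons] at this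
    exact this.2
  have ndU : (((0, (Sum.inr 0 : I ⊕ Fin 3)) :: (2, Sum.inr 2) :: measured L
      ++ [((1 : Fin 3), Sum.inr 1)]).map Prod.snd).Nodup := by
    have := nd1 2 1 2 1 (by decide)
    simp only [List.cons_append, List.map_cons] at this ⊢
    rw [List.nodup_cons]
    refine ⟨?_, this⟩
    simp [measured]
  -- The auxiliary experiment in which all registers are filled: the middle player first answers the
  -- simulation question and then measures the whole list; the other two answer as well. The answers
  -- and the random proof can be compared inside it.
  set U : List (Fin 3 × (I ⊕ Fin 3)) :=
    (0, Sum.inr 0) :: (2, Sum.inr 2) :: measured L ++ [(1, Sum.inr 1)] with hU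
  have ne1 : ∀ x ∈ measured L, x.1 ≠ (0 : Fin 3) ∧ x.1 ≠ (2 : Fin 3) := fun x hx => by
    rw [fst_of_mem_measured hx]; decide
  -- the three events
  have E0 : wnorm nrm K (fun b => b (Sum.inr 0) ≠ b (Sum.inl (i 0))) U
      ≤ d + ∑ y ∈ L.toFinset.erase (i 0), D y + a 0 := by
    -- The answer of player 2 does not enter this event. Dropping it leaves player 2 free to take
    -- over, and so remove, the first measurement of the middle player at the cost `d`.
    have s1 : wordOp K U = wordOp K ([(2, Sum.inr 2)] ++ ((0, Sum.inr 0) :: measured L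
        ++ [(1, Sum.inr 1)])) := by
      have := wordOp_move hcomm [] [((0 : Fin 3), (Sum.inr 0 : I ⊕ Fin 3))]
        (measured L ++ [(1, Sum.inr 1)]) (2, Sum.inr 2) (by simp)
      simpa [hU] using this
    rw [wnorm_congr s1, wnorm_append_of_ignores hK (by
        rw [hU] at ndU
        exact ((List.Perm.swap _ _ _).map Prod.snd).nodup_iff.1 ndU)
      (by simpa using ign 0 2 (by decide) _)]
    have s2 := abs_wnorm_sub_wnorm_le_of_ignores hcomm hK (p' := 2) hd (nd1 0 1 0 1 (by decide))
      (hdist' 2 (by decide)) (fun x hx => by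
        rcases List.mem_cons.1 hx with rfl | hx
        · simp
        · exact (ne1 x hx).2) (ign 0 1 (by decide) (i 0))
    have s3 := wnorm_cons_measured_le hcomm hK hD hdist hL (hi 0) (p := 0) (p' := 2) (by decide)
      (by decide) (by decide) 0 (ign' 0 (i 0))
    linarith [(abs_le.1 s2).2]
  have E1 : wnorm nrm K (fun b => b (Sum.inr 1) ≠ b (Sum.inl (i 1))) U
      ≤ d + ∑ y ∈ L.toFinset.erase (i 1), D y + a 1 := by
    have e : U = [(0, Sum.inr 0), (2, Sum.inr 2)] ++ (measured L ++ [(1, Sum.inr 1)]) := rfl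
    rw [e, wnorm_append_of_ignores (w := [(0, Sum.inr 0), (2, Sum.inr 2)])
      (w' := measured L ++ [(1, Sum.inr 1)]) hK ndU
      (by simpa using ⟨ign 1 0 (by decide) _, ign 1 2 (by decide) _⟩)]
    -- The event involves this register, so it cannot be dropped. It is handed over to player 2,
    -- whose measurement commutes past the list, and the comparison becomes one between players 2
    -- and 1.
    have s2 := abs_wnorm_sub_wnorm_le hK
      (fun b : I ⊕ Fin 3 → Bool => b (Sum.inr 1) ≠ b (Sum.inl (i 1))) hd (ndL 1 1)
      (hdist' 2 (by decide))
    have s1 : wordOp K (measured L ++ [(2, Sum.inr 1)]) = wordOp K ((2, Sum.inr 1) :: measured L) := by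
      have := wordOp_move hcomm [] (measured L) [] (2, Sum.inr 1) (fun x hx => (ne1 x hx).2)
      simpa using this
    rw [wnorm_congr s1] at s2
    have s3 := wnorm_cons_measured_le hcomm hK hD hdist hL (hi 1) (p := 2) (p' := 0) (by decide)
      (by decide) (by decide) 1 (ign' 1 (i 1))
    linarith [(abs_le.1 s2).2]
  have E2 : wnorm nrm K (fun b => b (Sum.inr 2) ≠ b (Sum.inl (i 2))) U
      ≤ d + ∑ y ∈ L.toFinset.erase (i 2), D y + a 2 := by
    have e : U = [(0, Sum.inr 0)] ++ ((2, Sum.inr 2) :: measured L ++ [(1, Sum.inr 1)]) := rfl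
    rw [e, wnorm_append_of_ignores (w := [(0, Sum.inr 0)])
      (w' := (2, Sum.inr 2) :: measured L ++ [(1, Sum.inr 1)]) hK ndU
      (by simpa using ign 2 0 (by decide) _)]
    have s2 := abs_wnorm_sub_wnorm_le_of_ignores hcomm hK (p' := 0) hd (nd1 2 1 2 1 (by decide))
      (hdist' 0 (by decide)) (fun x hx => by
        rcases List.mem_cons.1 hx with rfl | hx
        · simp
        · exact (ne1 x hx).1) (ign 2 1 (by decide) (i 2))
    have s3 := wnorm_cons_measured_le hcomm hK hD hdist hL (hi 2) (p := 2) (p' := 0) (by decide)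
      (by decide) (by decide) 2 (ign' 2 (i 2))
    linarith [(abs_le.1 s2).2]
  -- the answers of the three players
  have ES : wnorm nrm K (fun b => R fun t => b (Sum.inr t)) U ^ 2 ≤ σ := by
    -- Players 0 and 2 can be moved before the list, so the list comes after all three answers and
    -- does not affect them.
    have s1 : wordOp K U = wordOp K (measured L ++
        [(0, Sum.inr 0), (2, Sum.inr 2), (1, Sum.inr 1)]) := by
      have h1 := wordOp_move hcomm [(0, Sum.inr 0)] (measured L) [(1, Sum.inr 1)] (2, Sum.inr 2)
        (fun x hx => (ne1 x hx).2)
      have h2 := wordOp_move hcomm [] (measured L) [(2, Sum.inr 2), (1, Sum.inr 1)] (0, Sum.inr 0)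
        (fun x hx => (ne1 x hx).1)
      simp only [List.nil_append, List.cons_append] at h1 h2
      rw [h2, h1]
      simp [hU]
    rw [wnorm_congr s1, wnorm_append_of_ignores hK]
    · exact hσ
    · have : (U.map Prod.snd).Perm ((measured L ++
          [(0, Sum.inr 0), (2, Sum.inr 2), (1, Sum.inr 1)]).map Prod.snd) := by
        refine List.Perm.map _ ?_
        rw [hU]
        have := (List.perm_append_comm (l₁ := [((0 : Fin 3), (Sum.inr 0 : I ⊕ Fin 3)),
          (2, Sum.inr 2)]) (l₂ := measured L)).append_right [((1 : Fin 3), (Sum.inr 1 : I ⊕ Fin 3))]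
        simpa using this
      exact this.nodup_iff.1 ndU
    · intro r hr
      rw [measured_map_snd] at hr
      obtain ⟨y, _, rfl⟩ := List.mem_map.1 hr
      exact ignR' y
  have EU : wnorm nrm K (fun b => R fun t => b (Sum.inl (i t))) U ^ 2
      ≤ σ + ∑ t, (d + ∑ y ∈ L.toFinset.erase (i t), D y + a t) ^ 2 := by
    -- If the bits of the random proof are rejected, then either the answers are rejected or one of
    -- them differs from the proof.
    have m := wnorm_mono_event (nrm := nrm) (K := K)
      (F := fun b => R fun t => b (Sum.inl (i t)))
      (F' := fun b => (((R fun t => b (Sum.inr t)) ∨ b (Sum.inr 0) ≠ b (Sum.inl (i 0))) ∨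
        b (Sum.inr 1) ≠ b (Sum.inl (i 1))) ∨ b (Sum.inr 2) ≠ b (Sum.inl (i 2))) U (by
        intro b hb
        by_contra! hc
        obtain ⟨⟨⟨h0, h1⟩, h2⟩, h3⟩ := hc
        refine h0 ?_
        have : (fun t => b (Sum.inr t)) = fun t => b (Sum.inl (i t)) := by
          funext t; fin_cases t <;> assumption
        rwa [this])
    refine m.trans ?_
    refine (wnorm_union _ _ _).trans ?_
    rw [Fin.sum_univ_three, ← add_assoc, ← add_assoc]
    refine add_le_add ?_ (pow_le_pow_left₀ (wnorm_nonneg _ _) E2 2)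
    refine (wnorm_union _ _ _).trans (add_le_add ?_ (pow_le_pow_left₀ (wnorm_nonneg _ _) E1 2))
    exact (wnorm_union _ _ _).trans (add_le_add ES (pow_le_pow_left₀ (wnorm_nonneg _ _) E0 2))
  -- dropping the registers of the answers
  have EF : |wnorm nrm K (fun b => R fun t => b (Sum.inl (i t))) U
      - wnorm nrm K (fun b => R fun t => b (Sum.inl (i t))) (measured L)| ≤ d := by
    have e : U = [(0, Sum.inr 0), (2, Sum.inr 2)] ++ (measured L ++ [(1, Sum.inr 1)]) := rfl
    rw [e, wnorm_append_of_ignores (w := [(0, Sum.inr 0), (2, Sum.inr 2)])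
      (w' := measured L ++ [(1, Sum.inr 1)]) hK ndU (by simpa using ⟨ignR 0, ignR 2⟩)]
    exact abs_wnorm_sub_wnorm_le_of_ignores hcomm hK (p' := 0) hd (ndL 1 1)
      (hdist' 0 (by decide)) (fun x hx => (ne1 x hx).1) (ignR 1)
  have := Real.le_sqrt_of_sq_le EU
  linarith [(abs_le.1 EF).1]

end Rounding
-- Norm inequalities for measurement operators
section Operators

variable {H : Type*} [NormedAddCommGroup H] [InnerProductSpace ℂ H] [CompleteSpace H]

theorem sum_norm_sq_apply {A : Bool → H →L[ℂ] H} (hA : ∀ β, IsSelfAdjoint (A β))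
    (h1 : ∑ β, A β * A β = 1) (v : H) : ∑ β, ‖A β v‖ ^ 2 = ‖v‖ ^ 2 := by
  have h : ∀ β, ‖A β v‖ ^ 2 = (inner ℂ v ((A β * A β) v)).re := by
    intro β
    have := (ContinuousLinearMap.isSelfAdjoint_iff_isSymmetric.1 (hA β)) v (A β v)
    rw [mul_apply_eq_comp]
    change inner ℂ (A β v) (A β v) = inner ℂ v (A β (A β v)) at this
    rw [← this, inner_self_eq_norm_sq_to_K]
    norm_cast
  simp only [h]
  rw [← Complex.re_sum, ← inner_sum, ← sum_apply, h1,
    one_apply_eq_self, inner_self_eq_norm_sq_to_K]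
  norm_cast

theorem norm_sqrt_apply_le {A : H →L[ℂ] H} (hA : 0 ≤ A) (h1 : ∀ v, ‖A v‖ ≤ ‖v‖) (v : H) :
    ‖CFC.sqrt A v‖ ≤ ‖v‖ := by
  have hs := (CFC.sqrt_nonneg A).isSelfAdjoint
  have h := (ContinuousLinearMap.isSelfAdjoint_iff_isSymmetric.1 hs) v (CFC.sqrt A v)
  change inner ℂ (CFC.sqrt A v) (CFC.sqrt A v) = inner ℂ v (CFC.sqrt A (CFC.sqrt A v)) at h
  rw [← mul_apply_eq_comp, CFC.sqrt_mul_sqrt_self A hA] at h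
  have h2 : ‖CFC.sqrt A v‖ ^ 2 ≤ ‖v‖ ^ 2 := by
    have h3 : ‖CFC.sqrt A v‖ ^ 2 = ‖inner ℂ v (A v)‖ := by
      rw [← h, inner_self_eq_norm_sq_to_K]
      simp
    rw [h3, sq]
    exact (norm_inner_le_norm _ _).trans (by gcongr; exact h1 v)
  exact abs_le_of_sq_le_sq' h2 (norm_nonneg _) |>.2

theorem commute_sqrt {A B : H →L[ℂ] H} (h : Commute A B) : Commute (CFC.sqrt A) B := by
  unfold CFC.sqrt
  exact Commute.cfcₙ_nnreal h _

/-- For commuting positive contractions, `⟨A v, B v⟩` is at least `‖A B v‖²`. -/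
theorem norm_sq_mul_apply_le {A B : H →L[ℂ] H} (hA : 0 ≤ A) (hB : 0 ≤ B) (hAB : Commute A B)
    (hA1 : ∀ v, ‖A v‖ ≤ ‖v‖) (hB1 : ∀ v, ‖B v‖ ≤ ‖v‖) (v : H) :
    ‖A (B v)‖ ^ 2 ≤ (inner ℂ (A v) (B v)).re := by
  -- With the commuting square roots `a` and `b`, the inner product is the squared norm of `a b v`,
  -- while `A B v = a b (a b v)`, and `a b` is a contraction.
  set a := CFC.sqrt A with ha
  set b := CFC.sqrt B with hb
  have haA : a * a = A := CFC.sqrt_mul_sqrt_self A hA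
  have hbB : b * b = B := CFC.sqrt_mul_sqrt_self B hB
  have hab : Commute a b := (commute_sqrt (commute_sqrt hAB).symm).symm
  have hsa := ContinuousLinearMap.isSelfAdjoint_iff_isSymmetric.1 (CFC.sqrt_nonneg A).isSelfAdjoint
  have hsb := ContinuousLinearMap.isSelfAdjoint_iff_isSymmetric.1 (CFC.sqrt_nonneg B).isSelfAdjoint
  have hsA := ContinuousLinearMap.isSelfAdjoint_iff_isSymmetric.1 hA.isSelfAdjoint
  have comm : ∀ w, a (b w) = b (a w) := fun w => by
    simpa using congrArg (fun T : H →L[ℂ] H => T w) hab.eq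
  have e : inner ℂ (A v) (B v) = inner ℂ (a (b v)) (a (b v)) := by
    calc inner ℂ (A v) (B v) = inner ℂ (a (a v)) (b (b v)) := by rw [← haA, ← hbB]; rfl
      _ = inner ℂ (a v) (a (b (b v))) := hsa _ _
      _ = inner ℂ (a v) (b (a (b v))) := by rw [comm (b v)]
      _ = inner ℂ (b (a v)) (a (b v)) := (hsb _ _).symm
      _ = _ := by rw [comm v]
  have e2 : A (B v) = a (b (a (b v))) := by
    calc A (B v) = a (a (b (b v))) := by rw [← haA, ← hbB]; rfl
      _ = _ := by rw [comm (b v)]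
  rw [e, e2, inner_self_eq_norm_sq_to_K]
  have h1 : ‖a (b (a (b v)))‖ ≤ ‖a (b v)‖ :=
    (norm_sqrt_apply_le hA hA1 _).trans (norm_sqrt_apply_le hB hB1 _)
  have : ((‖a (b v)‖ : ℂ) ^ 2).re = ‖a (b v)‖ ^ 2 := by norm_cast
  simp only [Complex.coe_algebraMap, this]
  gcongr

/-- Expanding the squares gives `2 ‖v‖²` minus twice the sum of the real parts of `⟨A β v, B β v⟩`,
each of which is at least `‖A β B β v‖²`. The squared norms for all pairs of outcomes add up to
`‖v‖²`, so twice the weight of the unequal pairs remains. -/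
theorem sum_norm_sq_sub_apply_le {A B : Bool → H →L[ℂ] H} (hA : ∀ β, 0 ≤ A β) (hB : ∀ β, 0 ≤ B β)
    (hAB : ∀ β β', Commute (A β) (B β'))
    (hA1 : ∑ β, A β * A β = 1) (hB1 : ∑ β, B β * B β = 1) (v : H) :
    ∑ β, ‖(A β - B β) v‖ ^ 2 ≤ 2 * ∑ β, ‖(A β * B (!β)) v‖ ^ 2 := by
  have sA := sum_norm_sq_apply (fun β => (hA β).isSelfAdjoint) hA1
  have sB := sum_norm_sq_apply (fun β => (hB β).isSelfAdjoint) hB1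
  have contr {A : Bool → H →L[ℂ] H} (s : ∀ v, ∑ β, ‖A β v‖ ^ 2 = ‖v‖ ^ 2) (β : Bool) (v : H) :
      ‖A β v‖ ≤ ‖v‖ := by
    refine (abs_le_of_sq_le_sq' ?_ (norm_nonneg _)).2
    rw [← s v]
    exact Finset.single_le_sum (f := fun β => ‖A β v‖ ^ 2) (fun _ _ => by positivity)
      (Finset.mem_univ β)
  have key : ∀ β, ‖(A β - B β) v‖ ^ 2
      ≤ ‖A β v‖ ^ 2 + ‖B β v‖ ^ 2 - 2 * ‖A β (B β v)‖ ^ 2 := by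
    intro β
    have h1 := norm_sq_mul_apply_le (hA β) (hB β) (hAB β β) (contr sA β) (contr sB β) v
    rw [sub_apply, @norm_sub_sq ℂ]
    change ‖A β v‖ ^ 2 - 2 * (inner ℂ (A β v) (B β v)).re + _ ≤ _
    linarith
  have h1 := sA v
  have h2 := sB v
  have h3 := sA (B true v)
  have h4 := sA (B false v)
  have k1 := key true
  have k2 := key false
  simp only [Fintype.sum_bool, mul_apply_eq_comp, Bool.not_true, Bool.not_false] at *
  linarith

theorem memℓp_apply {ψ : ℕ → H} (hψ : Summable fun k => ‖ψ k‖ ^ 2) (X : H →L[ℂ] H) :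
    Memℓp (fun k => X (ψ k)) 2 := by
  refine memℓp_gen ?_
  simp only [ENNReal.toReal_ofNat, Real.rpow_ofNat]
  refine Summable.of_nonneg_of_le (fun k => by positivity) (fun k => ?_)
    (hψ.mul_left (‖X‖ ^ 2))
  rw [← mul_pow]
  gcongr
  exact X.le_opNorm _

/-- The family of the vectors `X (ψ k)`. -/
def stateVec (ψ : ℕ → H) (hψ : Summable fun k => ‖ψ k‖ ^ 2) (X : H →L[ℂ] H) :
    lp (fun _ : ℕ => H) 2 :=
  ⟨fun k => X (ψ k), memℓp_apply hψ X⟩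

/-- The seminorm `X ↦ (tr X ρ X*)^(1/2)` for `ρ = ∑ k, |ψ k⟩⟨ψ k|`. -/
noncomputable def stateSeminorm (ψ : ℕ → H) (hψ : Summable fun k => ‖ψ k‖ ^ 2) :
    AddGroupSeminorm (H →L[ℂ] H) where
  toFun X := ‖stateVec ψ hψ X‖
  map_zero' := by
    rw [norm_eq_zero]
    ext k
    simp [stateVec]
  add_le' X Y := norm_add_le (stateVec ψ hψ X) (stateVec ψ hψ Y)
  neg' X := norm_neg (stateVec ψ hψ X)

variable {ψ : ℕ → H} {hψ : Summable fun k => ‖ψ k‖ ^ 2}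

theorem hasSum_stateSeminorm_sq (X : H →L[ℂ] H) :
    HasSum (fun k => ‖X (ψ k)‖ ^ 2) (stateSeminorm ψ hψ X ^ 2) := by
  have := lp.hasSum_norm (p := 2) (by simp) (stateVec ψ hψ X)
  simp only [ENNReal.toReal_ofNat, Real.rpow_ofNat] at this
  exact this

theorem stateSeminorm_smul (c : ℝ) (X : H →L[ℂ] H) :
    stateSeminorm ψ hψ (c • X) ^ 2 = c ^ 2 * stateSeminorm ψ hψ X ^ 2 := by
  refine (hasSum_stateSeminorm_sq (c • X)).unique ?_
  have e : (fun k => ‖(c • X) (ψ k)‖ ^ 2) = fun k => c ^ 2 * ‖X (ψ k)‖ ^ 2 := by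
    funext k
    rw [smul_apply, norm_smul, mul_pow]
    simp
  rw [e]
  exact (hasSum_stateSeminorm_sq (hψ := hψ) X).mul_left (c ^ 2)

theorem sum_stateSeminorm_sq_mul {A : Bool → H →L[ℂ] H} (hA : ∀ β, IsSelfAdjoint (A β))
    (h1 : ∑ β, A β * A β = 1) (X : H →L[ℂ] H) :
    ∑ β, stateSeminorm ψ hψ (A β * X) ^ 2 = stateSeminorm ψ hψ X ^ 2 := by
  have h := hasSum_sum (s := Finset.univ) fun β (_ : β ∈ Finset.univ) =>
    hasSum_stateSeminorm_sq (ψ := ψ) (hψ := hψ) (A β * X)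
  refine h.unique ?_
  convert hasSum_stateSeminorm_sq (hψ := hψ) X using 2 with k
  exact sum_norm_sq_apply hA h1 _

theorem sum_stateSeminorm_sq_sub_le {A B : Bool → H →L[ℂ] H} (hA : ∀ β, 0 ≤ A β)
    (hB : ∀ β, 0 ≤ B β) (hAB : ∀ β β', Commute (A β) (B β'))
    (hA1 : ∑ β, A β * A β = 1) (hB1 : ∑ β, B β * B β = 1) :
    ∑ β, stateSeminorm ψ hψ (A β - B β) ^ 2
      ≤ 2 * ∑ β, stateSeminorm ψ hψ (A β * B (!β)) ^ 2 := by
  have h := hasSum_sum (s := Finset.univ) fun β (_ : β ∈ Finset.univ) =>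
    hasSum_stateSeminorm_sq (ψ := ψ) (hψ := hψ) (A β - B β)
  have h' := (hasSum_sum (s := Finset.univ) fun β (_ : β ∈ Finset.univ) =>
    hasSum_stateSeminorm_sq (ψ := ψ) (hψ := hψ) (A β * B (!β))).mul_left 2
  exact hasSum_le (fun k => sum_norm_sq_sub_apply_le hA hB hAB hA1 hB1 (ψ k)) h h'

end Operators
-- Averages over uniform registers
section Averages

variable {J : Type*} [Fintype J] [DecidableEq J]

theorem sum_apply_eq_half (r : J) (G : Bool → (J → Bool) → ℝ)
    (hG : ∀ β b β', G β (Function.update b r β') = G β b) :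
    ∑ b : J → Bool, G (b r) b = 1 / 2 * ∑ β, ∑ b, G β b := by
  rw [sum_eq_half_sum_update r, Finset.sum_comm]
  simp [hG]

/-- The factor `1 / 4` cancels the scaling by `√2` of the two operators in a word of two letters. -/
theorem average_apply_two {r r' : J} (h : r ≠ r') (g : Bool → Bool → ℝ) :
    (∑ b : J → Bool, g (b r) (b r')) / 2 ^ Fintype.card J = 1 / 4 * ∑ β, ∑ β', g β β' := by
  rw [sum_apply_eq_half r (fun β b => g β (b r')) (by simp [Function.update_of_ne h.symm])]
  have (β : Bool) : ∑ b : J → Bool, g β (b r') = 1 / 2 * ∑ β', ∑ _b : J → Bool, g β β' :=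
    sum_apply_eq_half r' (fun β' _ => g β β') (by simp)
  simp only [this, Finset.sum_const, Finset.card_univ, nsmul_eq_mul, Fintype.card_fun,
    Fintype.card_bool, Nat.cast_pow, Nat.cast_ofNat, ← Finset.mul_sum]
  field_simp
  ring

theorem average_apply_three {r r' r'' : J} (h : r ≠ r') (h' : r ≠ r'') (h'' : r' ≠ r'')
    (g : Bool → Bool → Bool → ℝ) :
    (∑ b : J → Bool, g (b r) (b r') (b r'')) / 2 ^ Fintype.card J
      = 1 / 8 * ∑ β, ∑ β', ∑ β'', g β β' β'' := by
  rw [sum_apply_eq_half r (fun β b => g β (b r') (b r''))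
    (by simp [Function.update_of_ne h.symm, Function.update_of_ne h'.symm]), mul_div_assoc,
    Finset.sum_div]
  simp only [average_apply_two h'', ← Finset.mul_sum]
  ring

end Averages

theorem sum_fin_three_arrow {A M : Type*} [Fintype A] [AddCommMonoid M] (f : (Fin 3 → A) → M) :
    ∑ a, f a = ∑ x, ∑ y, ∑ z, f ![x, y, z] := by
  let e : (Fin 3 → A) ≃ A × A × A :=
    { toFun a := (a 0, a 1, a 2)
      invFun x := ![x.1, x.2.1, x.2.2]
      left_inv a := by funext i; fin_cases i <;> rfl
      right_inv x := rfl }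
  rw [← e.symm.sum_comp, Fintype.sum_prod_type]
  refine Finset.sum_congr rfl fun x _ => ?_
  rw [Fintype.sum_prod_type]
  rfl

/-! ### Strategies of three commuting players and the rounding to a proof -/

section Strategy

variable {H Q : Type*} [NormedAddCommGroup H] [InnerProductSpace ℂ H] [CompleteSpace H]

/-- Three commuting players, whose measurements are given by the square roots `R p q β` of the
POVM elements. -/
structure IsStrategy (R : Fin 3 → Q → Bool → H →L[ℂ] H) : Prop where
  nonneg : ∀ p q β, 0 ≤ R p q β
  sum_mul_self : ∀ p q, ∑ β, R p q β * R p q β = 1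
  comm : ∀ p p', p ≠ p' → ∀ q β q' β', Commute (R p q β) (R p' q' β')

variable {ψ : ℕ → H} {hψ : Summable fun k => ‖ψ k‖ ^ 2}

/-- The probability of the answers `a`. -/
noncomputable def answerProb (ψ : ℕ → H) (hψ : Summable fun k => ‖ψ k‖ ^ 2)
    (R : Fin 3 → Q → Bool → H →L[ℂ] H) (q : Fin 3 → Q) (a : Fin 3 → Bool) : ℝ :=
  stateSeminorm ψ hψ (R 0 (q 0) (a 0) * R 1 (q 1) (a 1) * R 2 (q 2) (a 2)) ^ 2

/-- The probability that the answers are not all equal. -/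
noncomputable def disagreeProb (ψ : ℕ → H) (hψ : Summable fun k => ‖ψ k‖ ^ 2)
    (R : Fin 3 → Q → Bool → H →L[ℂ] H) (q : Fin 3 → Q) : ℝ :=
  ∑ a : Fin 3 → Bool, if a 0 = a 1 ∧ a 1 = a 2 then 0 else answerProb ψ hψ R q a

variable {R : Fin 3 → Q → Bool → H →L[ℂ] H}

theorem answerProb_nonneg (q : Fin 3 → Q) (a : Fin 3 → Bool) : 0 ≤ answerProb ψ hψ R q a := by
  unfold answerProb; positivity

theorem disagreeProb_nonneg (q : Fin 3 → Q) : 0 ≤ disagreeProb ψ hψ R q := by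
  refine Finset.sum_nonneg fun a _ => ?_
  split_ifs
  · rfl
  · exact answerProb_nonneg q a

namespace IsStrategy

variable (hR : IsStrategy R)
include hR

theorem isSelfAdjoint (p : Fin 3) (q : Q) (β : Bool) : IsSelfAdjoint (R p q β) :=
  (hR.nonneg p q β).isSelfAdjoint

theorem sum_sq_mul (p : Fin 3) (q : Q) (X : H →L[ℂ] H) :
    ∑ β, stateSeminorm ψ hψ (R p q β * X) ^ 2 = stateSeminorm ψ hψ X ^ 2 :=
  sum_stateSeminorm_sq_mul (hR.isSelfAdjoint p q) (hR.sum_mul_self p q) X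

/-- Summing over the outcome of the third player turns the left side into the probability that two
given players disagree, and then the three answers are not all equal. -/
theorem sum_sq_pair_le {p p' : Fin 3} (hp : p ≠ p') (q : Fin 3 → Q) :
    ∑ β, stateSeminorm ψ hψ (R p (q p) β * R p' (q p') (!β)) ^ 2 ≤ disagreeProb ψ hψ R q := by
  have m01 (a b) : stateSeminorm ψ hψ (R 0 (q 0) a * R 1 (q 1) b) ^ 2
      = ∑ c, answerProb ψ hψ R q ![a, b, c] := by
    rw [← hR.sum_sq_mul 2 (q 2)]
    refine Finset.sum_congr rfl fun c _ => ?_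
    unfold answerProb
    congr 2
    exact (((hR.comm 2 0 (by decide) _ _ _ _).mul_right (hR.comm 2 1 (by decide) _ _ _ _)).eq)
  have m02 (a c) : stateSeminorm ψ hψ (R 0 (q 0) a * R 2 (q 2) c) ^ 2
      = ∑ b, answerProb ψ hψ R q ![a, b, c] := by
    rw [← hR.sum_sq_mul 1 (q 1)]
    refine Finset.sum_congr rfl fun b _ => ?_
    unfold answerProb
    congr 2
    rw [← mul_assoc, (hR.comm 1 0 (by decide) _ _ _ _).eq]
    rfl
  have m12 (b c) : stateSeminorm ψ hψ (R 1 (q 1) b * R 2 (q 2) c) ^ 2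
      = ∑ a, answerProb ψ hψ R q ![a, b, c] := by
    rw [← hR.sum_sq_mul 0 (q 0)]
    refine Finset.sum_congr rfl fun a _ => ?_
    unfold answerProb
    congr 2
  have nn := fun a b c => answerProb_nonneg (ψ := ψ) (hψ := hψ) (R := R) q ![a, b, c]
  have h01 : ∑ β, stateSeminorm ψ hψ (R 0 (q 0) β * R 1 (q 1) (!β)) ^ 2
      ≤ disagreeProb ψ hψ R q := by
    unfold disagreeProb
    simp only [m01, sum_fin_three_arrow, Fintype.sum_bool]
    simp
    linarith [nn true true false, nn false false true]
  have h02 : ∑ β, stateSeminorm ψ hψ (R 0 (q 0) β * R 2 (q 2) (!β)) ^ 2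
      ≤ disagreeProb ψ hψ R q := by
    unfold disagreeProb
    simp only [m02, sum_fin_three_arrow, Fintype.sum_bool]
    simp
    linarith [nn true false true, nn false true false]
  have h12 : ∑ β, stateSeminorm ψ hψ (R 1 (q 1) β * R 2 (q 2) (!β)) ^ 2
      ≤ disagreeProb ψ hψ R q := by
    unfold disagreeProb
    simp only [m12, sum_fin_three_arrow, Fintype.sum_bool]
    simp
    linarith [nn false true true, nn true false false]
  have symm {p p' : Fin 3} (hp : p ≠ p') :
      ∑ β, stateSeminorm ψ hψ (R p (q p) β * R p' (q p') (!β)) ^ 2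
        = ∑ β, stateSeminorm ψ hψ (R p' (q p') β * R p (q p) (!β)) ^ 2 := by
    simp only [Fintype.sum_bool, Bool.not_true, Bool.not_false]
    rw [(hR.comm p p' hp _ _ _ _).eq, (hR.comm p p' hp (q p) false _ _).eq, add_comm]
  fin_cases p <;> fin_cases p' <;> first | exact absurd rfl hp | assumption | skip
  all_goals (rw [symm hp]; assumption)

theorem sum_sq_sub_le {p p' : Fin 3} (hp : p ≠ p') (q : Fin 3 → Q) :
    ∑ β, stateSeminorm ψ hψ (R p (q p) β - R p' (q p') β) ^ 2 ≤ 2 * disagreeProb ψ hψ R q :=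
  (sum_stateSeminorm_sq_sub_le (hR.nonneg p _) (hR.nonneg p' _)
    (fun _ _ => hR.comm p p' hp _ _ _ _) (hR.sum_mul_self p _) (hR.sum_mul_self p' _)).trans
    (by gcongr; exact hR.sum_sq_pair_le hp q)

theorem sum_answerProb (q : Fin 3 → Q) :
    ∑ a, answerProb ψ hψ R q a = stateSeminorm ψ hψ 1 ^ 2 := by
  rw [sum_fin_three_arrow, ← hR.sum_sq_mul 0 (q 0) 1]
  refine Finset.sum_congr rfl fun x _ => ?_
  rw [← hR.sum_sq_mul 1 (q 1)]
  refine Finset.sum_congr rfl fun y _ => ?_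
  rw [← hR.sum_sq_mul 2 (q 2)]
  refine Finset.sum_congr rfl fun z _ => ?_
  unfold answerProb
  congr 2
  rw [mul_one, ← (hR.comm 0 1 (by decide) _ _ _ _).eq]
  exact ((hR.comm 2 0 (by decide) _ _ _ _).mul_right (hR.comm 2 1 (by decide) _ _ _ _)).symm.eq

end IsStrategy

section Registers

variable {J : Type*} [Fintype J] [DecidableEq J]

/-- The scaled operators of the players, for the questions `quest p r` of the registers. -/
noncomputable def registerOp (R : Fin 3 → Q → Bool → H →L[ℂ] H) (quest : Fin 3 → J → Q)
    (p : Fin 3) (r : J) (β : Bool) : H →L[ℂ] H :=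
  √2 • R p (quest p r) β

variable {quest : Fin 3 → J → Q}

theorem registerOp_comm (hR : IsStrategy R) :
    ∀ p p', p ≠ p' → ∀ r β r' β',
      Commute (registerOp R quest p r β) (registerOp R quest p' r' β') :=
  fun p p' hp _ _ _ _ => ((hR.comm p p' hp _ _ _ _).smul_left _).smul_right _

theorem sum_registerOp_mul (hR : IsStrategy R) (p : Fin 3) (r : J) (X : H →L[ℂ] H) :
    ∑ β, stateSeminorm ψ hψ (registerOp R quest p r β * X) ^ 2
      = 2 * stateSeminorm ψ hψ X ^ 2 := by
  simp only [registerOp, smul_mul_assoc, stateSeminorm_smul, Real.sq_sqrt zero_le_two]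
  rw [← Finset.mul_sum, hR.sum_sq_mul]

theorem sum_registerOp_sub_le (hR : IsStrategy R) {p p' : Fin 3} (hp : p ≠ p') (q : Fin 3 → Q)
    (r : J) (hq : q p = quest p r) (hq' : q p' = quest p' r) :
    ∑ β, stateSeminorm ψ hψ (registerOp R quest p r β - registerOp R quest p' r β) ^ 2
      ≤ 2 * √(2 * disagreeProb ψ hψ R q) ^ 2 := by
  simp only [registerOp, ← smul_sub, stateSeminorm_smul, Real.sq_sqrt zero_le_two]
  rw [← Finset.mul_sum, Real.sq_sqrt (by have := disagreeProb_nonneg (ψ := ψ) (hψ := hψ) (R := R) q;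
                                         positivity), ← hq, ← hq']
  gcongr
  exact hR.sum_sq_sub_le hp q

theorem wnorm_pair_le (hR : IsStrategy R) {p p' : Fin 3} (hp : p ≠ p') (q : Fin 3 → Q)
    {r r' : J} (hr : r ≠ r') (hq : q p = quest p r) (hq' : q p' = quest p' r') :
    wnorm (stateSeminorm ψ hψ) (registerOp R quest) (fun b => b r ≠ b r') [(p, r), (p', r')]
      ≤ √(disagreeProb ψ hψ R q) := by
  classical
  refine Real.le_sqrt_of_sq_le ?_
  refine le_trans (le_of_eq ?_) (hR.sum_sq_pair_le hp q)
  rw [wnorm_sq]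
  simp only [wordOp, List.map_cons, List.map_nil, List.prod_cons, List.prod_nil]
  rw [average_apply_two hr (fun β β' => if β ≠ β' then
    stateSeminorm ψ hψ (registerOp R quest p r β * (registerOp R quest p' r' β' * 1)) ^ 2 else 0)]
  simp only [registerOp, smul_mul_assoc, mul_smul_comm, stateSeminorm_smul, mul_one,
    Real.sq_sqrt zero_le_two, Fintype.sum_bool]
  simp [hq, hq']
  ring

open Classical in
theorem wnorm_triple_sq (hR : IsStrategy R) (q : Fin 3 → Q)
    {r : Fin 3 → J} (hr : Function.Injective r) (hq : ∀ p, q p = quest p (r p))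
    (F : (Fin 3 → Bool) → Prop) :
    wnorm (stateSeminorm ψ hψ) (registerOp R quest) (fun b => F fun t => b (r t))
        [(0, r 0), (2, r 2), (1, r 1)] ^ 2
      = ∑ a, if F a then answerProb ψ hψ R q a else 0 := by
  have e : ∀ b : J → Bool, (fun t => b (r t)) = ![b (r 0), b (r 1), b (r 2)] := by
    intro b; funext t; fin_cases t <;> rfl
  simp only [e]
  rw [wnorm_sq]
  simp only [wordOp, List.map_cons, List.map_nil, List.prod_cons, List.prod_nil]
  rw [average_apply_three (hr.ne (by decide)) (hr.ne (by decide)) (hr.ne (by decide))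
    (r := r 0) (r' := r 1) (r'' := r 2) (fun β β' β'' => if F ![β, β', β''] then
    stateSeminorm ψ hψ (registerOp R quest 0 (r 0) β * (registerOp R quest 2 (r 2) β'' *
      (registerOp R quest 1 (r 1) β' * 1))) ^ 2 else 0), sum_fin_three_arrow]
  simp only [registerOp, smul_mul_assoc, mul_smul_comm, stateSeminorm_smul, mul_one,
    Real.sq_sqrt zero_le_two, ← hq, Finset.mul_sum]
  refine Finset.sum_congr rfl fun x _ => Finset.sum_congr rfl fun y _ =>
    Finset.sum_congr rfl fun z _ => ?_
  have : R 0 (q 0) x * (R 2 (q 2) z * R 1 (q 1) y) = R 0 (q 0) x * R 1 (q 1) y * R 2 (q 2) z := by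
    rw [(hR.comm 2 1 (by decide) _ _ _ _).eq, mul_assoc]
  rw [this]
  split_ifs
  · simp only [answerProb]
    simp
    ring
  · simp

end Registers

/-- Each of the three summands is at most `(h/6 + h/4)² = (5h/12)²`. Then `1/24 + 3 · 25/144 =
9/16`, and `3/4 + 1/6 = 11/12`; what matters is that the result is below 1. -/
theorem sqrt_add_sum_sq_add_le {h d : ℝ} {s a : Fin 3 → ℝ} (h0 : 0 < h) (hd0 : 0 ≤ d)
    (hd : d ≤ h / 6) (hs : ∀ t, 0 ≤ s t) (ha : ∀ t, 0 ≤ a t) (hsa : ∀ t, s t + a t ≤ h / 4) :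
    √(h ^ 2 / 24 + ∑ t, (d + s t + a t) ^ 2) + d ≤ 11 * h / 12 := by
  have h1 : ∀ t, (d + s t + a t) ^ 2 ≤ (5 * h / 12) ^ 2 := fun t =>
    pow_le_pow_left₀ (by have := hs t; have := ha t; positivity) (by linarith [hsa t]) 2
  have h2 : √(h ^ 2 / 24 + ∑ t, (d + s t + a t) ^ 2) ≤ 3 * h / 4 := by
    refine Real.sqrt_le_iff.2 ⟨by positivity, ?_⟩
    rw [Fin.sum_univ_three]
    linarith [h1 0, h1 1, h1 2]
  linarith

open Classical in
/-- Rounding: if the players nearly win, some assignment of bits to the letters (consistent along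
`rep`) is accepted with probability more than `1 - h`. -/
theorem exists_assignment (hR : IsStrategy R) (h1 : stateSeminorm ψ hψ 1 = 1)
    {Ω : Type*} [Fintype Ω] [Nonempty Ω] {qa qb qc : Ω × Fin 3 → Q} {qa' qb' : Ω → Q}
    {rep : Ω × Fin 3 → Ω × Fin 3} (hrep : ∀ x, qb (rep x) = qb x)
    (hrr : ∀ x, rep (rep x) = rep x) (reject : Ω → (Fin 3 → Bool) → Prop) {h : ℝ} (h0 : 0 < h)
    (hle : h ≤ 1)
    (hσ : ∀ ρ, (∑ a, if reject ρ a then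
      answerProb ψ hψ R ![qa (ρ, 0), qb' ρ, qc (ρ, 2)] a else 0) ≤ h ^ 2 / 24)
    (hd : ∀ ρ, 2 * disagreeProb ψ hψ R ![qa' ρ, qb' ρ, qc (ρ, 1)] ≤ h ^ 2 / 36)
    (hS : ∑ x, √(2 * disagreeProb ψ hψ R ![qa x, qb x, qc x]) ≤ h / 4) :
    ∃ b : Ω × Fin 3 → Bool,
      (∑ ρ, if reject ρ (fun t => b (rep (ρ, t))) then (1 : ℝ) else 0) < h * Fintype.card Ω := by
  set D : Ω × Fin 3 → ℝ := fun x => √(2 * disagreeProb ψ hψ R ![qa x, qb x, qc x]) with hDdef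
  set L : List (Ω × Fin 3) := (Finset.univ.filter fun x => rep x = x).toList with hL
  have hLn : L.Nodup := Finset.nodup_toList _
  have hLm : ∀ x, x ∈ L ↔ rep x = x := by simp [hL]
  -- The registers `Sum.inl y` carry the consistency test at the place `y`. Among the registers
  -- `Sum.inr t`, the diagonal entries `p = t` are the questions of the simulation test, and the
  -- column `t = 1` is the extra consistency test at the middle address. The remaining entries are
  -- arbitrary.
  let quest (ρ : Ω) : Fin 3 → (Ω × Fin 3) ⊕ Fin 3 → Q := fun p r => match r with
    | Sum.inl y => ![qa y, qb y, qc y] p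
    | Sum.inr t => ![![qa (ρ, 0), qa' ρ, qa' ρ] t, qb' ρ, ![qc (ρ, 1), qc (ρ, 1), qc (ρ, 2)] t] p
  have hdist (ρ : Ω) : ∀ p' : Fin 3, p' ≠ 1 → ∀ y, ∑ β, stateSeminorm ψ hψ
      (registerOp R (quest ρ) 1 (Sum.inl y) β - registerOp R (quest ρ) p' (Sum.inl y) β) ^ 2
        ≤ 2 * D y ^ 2 := fun p' hp' y =>
    sum_registerOp_sub_le hR hp'.symm ![qa y, qb y, qc y] (Sum.inl y) rfl rfl
  have hdist' (ρ : Ω) : ∀ p' : Fin 3, p' ≠ 1 → ∑ β, stateSeminorm ψ hψ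
      (registerOp R (quest ρ) 1 (Sum.inr 1) β - registerOp R (quest ρ) p' (Sum.inr 1) β) ^ 2
        ≤ 2 * √(2 * disagreeProb ψ hψ R ![qa' ρ, qb' ρ, qc (ρ, 1)]) ^ 2 := fun p' hp' =>
    sum_registerOp_sub_le hR hp'.symm ![qa' ρ, qb' ρ, qc (ρ, 1)] (Sum.inr 1) rfl
      (by fin_cases p' <;> rfl)
  have hbound (ρ : Ω) : wnorm (stateSeminorm ψ hψ) (registerOp R (quest ρ))
      (fun b => reject ρ fun t => b (Sum.inl (rep (ρ, t)))) (measured L) ^ 2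
        ≤ 121 / 144 * h ^ 2 := by
    have hb := wnorm_measured_le (registerOp_comm hR) (sum_registerOp_mul hR) (D := D)
      (fun y => Real.sqrt_nonneg _) (hdist ρ) (Real.sqrt_nonneg _) (hdist' ρ) hLn
      (i := fun t => rep (ρ, t)) (fun t => (hLm _).2 (hrr _)) (reject ρ)
      (σ := h ^ 2 / 24)
      (a := fun t => √(disagreeProb ψ hψ R ![qa (ρ, t), qb (ρ, t), qc (ρ, t)]))
      (by
        have := wnorm_triple_sq (ψ := ψ) (hψ := hψ) (quest := quest ρ) hR
          ![qa (ρ, 0), qb' ρ, qc (ρ, 2)] (r := Sum.inr) Sum.inr_injective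
          (fun p => by fin_cases p <;> rfl) (reject ρ)
        rw [this]
        exact hσ ρ)
      (wnorm_pair_le hR (by decide) ![qa (ρ, 0), qb (ρ, 0), qc (ρ, 0)] (by simp) rfl
        (hrep _).symm)
      (wnorm_pair_le hR (by decide) ![qa (ρ, 1), qb (ρ, 1), qc (ρ, 1)] (by simp) rfl
        (hrep _).symm)
      (wnorm_pair_le hR (by decide) ![qa (ρ, 2), qb (ρ, 2), qc (ρ, 2)] (by simp) rfl
        (hrep _).symm)
    set d := √(2 * disagreeProb ψ hψ R ![qa' ρ, qb' ρ, qc (ρ, 1)]) with hdd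
    have hd6 : d ≤ h / 6 := by
      rw [hdd]
      refine Real.sqrt_le_iff.2 ⟨by positivity, (hd ρ).trans (le_of_eq (by ring))⟩
    have hd0 : 0 ≤ d := Real.sqrt_nonneg _
    -- The place `(ρ, t)` is never among the summed letters, since a representative equal to it has
    -- been erased. Its own term in `hS` therefore pays for the comparison of the answer with the
    -- proof bit.
    have hev (t : Fin 3) : ∑ y ∈ L.toFinset.erase (rep (ρ, t)), D y
        + √(disagreeProb ψ hψ R ![qa (ρ, t), qb (ρ, t), qc (ρ, t)]) ≤ h / 4 := by
      refine le_trans ?_ hS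
      rw [← Finset.sum_erase_add _ _ (Finset.mem_univ (ρ, t))]
      refine add_le_add (Finset.sum_le_sum_of_subset_of_nonneg ?_ fun y _ _ => Real.sqrt_nonneg _)
        (Real.sqrt_le_sqrt ?_)
      · intro y hy
        simp only [Finset.mem_erase, List.mem_toFinset, hLm, Finset.mem_univ, and_true] at hy ⊢
        rintro rfl
        exact hy.1 hy.2.symm
      · linarith [disagreeProb_nonneg (ψ := ψ) (hψ := hψ) (R := R)
          ![qa (ρ, t), qb (ρ, t), qc (ρ, t)]]
    have h3 := hb.trans (sqrt_add_sum_sq_add_le h0 hd0 hd6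
      (fun t => Finset.sum_nonneg fun y _ => Real.sqrt_nonneg _) (fun t => Real.sqrt_nonneg _) hev)
    calc _ ≤ (11 * h / 12) ^ 2 := pow_le_pow_left₀ (wnorm_nonneg _ _) h3 2
      _ = _ := by ring
  -- The operators that the middle player applies to the list do not depend on `ρ`, so a single
  -- distribution `μ` of proofs serves all coins.
  let W : ((Ω × Fin 3) ⊕ Fin 3 → Bool) → (H →L[ℂ] H) := fun b =>
    (L.map fun y => √2 • R 1 (qb y) (b (Sum.inl y))).prod
  have hW (ρ : Ω) : wordOp (registerOp R (quest ρ)) (measured L) = W := by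
    funext b
    simp only [wordOp, measured, List.map_map, W]
    rfl
  let μ : ((Ω × Fin 3) ⊕ Fin 3 → Bool) → ℝ := fun b =>
    stateSeminorm ψ hψ (W b) ^ 2 / 2 ^ Fintype.card ((Ω × Fin 3) ⊕ Fin 3)
  have hμ (ρ : Ω) (F : ((Ω × Fin 3) ⊕ Fin 3 → Bool) → Prop) :
      wnorm (stateSeminorm ψ hψ) (registerOp R (quest ρ)) F (measured L) ^ 2
        = ∑ b, μ b * if F b then 1 else 0 := by
    rw [wnorm_sq, hW, Finset.sum_div]
    refine Finset.sum_congr rfl fun b _ => ?_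
    by_cases hF : F b <;> simp [hF, μ]
  have hμ1 : ∑ b, μ b = 1 := by
    obtain ⟨ρ⟩ := ‹Nonempty Ω›
    have h2 := hμ ρ fun _ => True
    have h3 : wnorm (stateSeminorm ψ hψ) (registerOp R (quest ρ)) (fun _ => True)
        (measured L ++ []) = wnorm (stateSeminorm ψ hψ) (registerOp R (quest ρ)) (fun _ => True) [] :=
      wnorm_append_of_ignores (sum_registerOp_mul hR) (by
        rw [List.append_nil, measured_map_snd]; exact hLn.map Sum.inl_injective)
        (fun _ _ _ _ => Iff.rfl)
    rw [List.append_nil] at h3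
    rw [h3, wnorm_true_nil, h1] at h2
    simpa using h2.symm
  -- If every assignment were rejected with probability at least `h`, so would be the `μ`-average;
  -- but this average is at most `121/144 h²`, which is less than `h` for `0 < h ≤ 1`.
  by_contra! hc
  have hlt : ∑ b, μ b * ∑ ρ, (if reject ρ (fun t => b (Sum.inl (rep (ρ, t)))) then (1 : ℝ) else 0)
      ≤ Fintype.card Ω * (121 / 144 * h ^ 2) := by
    simp only [Finset.mul_sum]
    rw [Finset.sum_comm]
    calc _ ≤ ∑ _ρ : Ω, 121 / 144 * h ^ 2 := by
          refine Finset.sum_le_sum fun ρ _ => ?_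
          rw [← hμ ρ fun b => reject ρ fun t => b (Sum.inl (rep (ρ, t)))]
          exact hbound ρ
      _ = _ := by simp
  have hge : h * Fintype.card Ω ≤
      ∑ b, μ b * ∑ ρ, (if reject ρ (fun t => b (Sum.inl (rep (ρ, t)))) then (1 : ℝ) else 0) := by
    calc h * Fintype.card Ω = ∑ b, μ b * (h * Fintype.card Ω) := by
          rw [← Finset.sum_mul, hμ1, one_mul]
      _ ≤ _ := Finset.sum_le_sum fun b _ => mul_le_mul_of_nonneg_left
          (hc fun y => b (Sum.inl y)) (by positivity)
  have hcard : (0 : ℝ) < Fintype.card Ω := by exact_mod_cast Fintype.card_pos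
  have : h * Fintype.card Ω ≤ Fintype.card Ω * (121 / 144 * h ^ 2) := hge.trans hlt
  nlinarith [mul_pos hcard h0, mul_le_mul_of_nonneg_left hle (mul_pos hcard h0).le]

end Strategy
-- From commuting POVMs to square roots
section Commuting

variable {Q A : Type} [Fintype A]

/-- Square roots of commuting positive operators commute, so the product of three POVM elements is
`star T * T` for the product `T` of their roots. Its expectation in a vector is the squared norm of
the image under `T`. -/
theorem IsCommutingOperator.exists_strategy {S : Behavior 3 Q A} (e : A ≃ Bool)
    (hS : IsCommutingOperator S) :
    ∃ (H : Type) (_ : NormedAddCommGroup H) (_ : InnerProductSpace ℂ H) (_ : CompleteSpace H)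
      (ψ : ℕ → H) (hψ : Summable fun k => ‖ψ k‖ ^ 2) (R : Fin 3 → Q → Bool → H →L[ℂ] H),
      IsStrategy R ∧ stateSeminorm ψ hψ 1 = 1 ∧
      ∀ q a, S q a = answerProb ψ hψ R q fun i => e (a i) := by
  obtain ⟨H, i1, i2, i3, ψ, M, hψ, hM, hM1, hMc, hSM⟩ := hS
  have hM0 : ∀ i q a, 0 ≤ M i q a := fun i q a =>
    (ContinuousLinearMap.nonneg_iff_isPositive _).2 (hM i q a)
  have hss : ∀ i q a, CFC.sqrt (M i q a) * CFC.sqrt (M i q a) = M i q a := fun i q a =>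
    CFC.sqrt_mul_sqrt_self _ (hM0 i q a)
  have hcomm : ∀ i i', i ≠ i' → ∀ q a q' a',
      Commute (CFC.sqrt (M i q a)) (CFC.sqrt (M i' q' a')) := fun i i' hi q a q' a' =>
    (commute_sqrt (commute_sqrt (hMc i i' hi q a q' a')).symm).symm
  refine ⟨H, i1, i2, i3, ψ, hψ.summable, fun p q β => CFC.sqrt (M p q (e.symm β)),
    ⟨fun p q β => CFC.sqrt_nonneg _, fun p q => ?_, fun p p' hp q β q' β' => hcomm p p' hp _ _ _ _⟩,
    ?_, fun q a => ?_⟩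
  · simp only [hss]
    rw [e.symm.sum_comp (fun a => M p q a), hM1]
  · have h1 := hasSum_stateSeminorm_sq (hψ := hψ.summable) (1 : H →L[ℂ] H)
    have h2 : stateSeminorm ψ hψ.summable 1 ^ 2 = 1 := h1.unique (by simpa using hψ)
    exact (pow_eq_one_iff_of_nonneg (apply_nonneg _ _) two_ne_zero).1 h2
  · rw [hSM]
    unfold answerProb
    rw [← (hasSum_stateSeminorm_sq _).tsum_eq]
    refine tsum_congr fun k => ?_
    simp only [Equiv.symm_apply_apply]
    set a0 := CFC.sqrt (M 0 (q 0) (a 0)) with ha0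
    set a1 := CFC.sqrt (M 1 (q 1) (a 1)) with ha1
    set a2 := CFC.sqrt (M 2 (q 2) (a 2)) with ha2
    have c01 : a0 * a1 = a1 * a0 := (hcomm 0 1 (by decide) _ _ _ _).eq
    have c02 : a0 * a2 = a2 * a0 := (hcomm 0 2 (by decide) _ _ _ _).eq
    have c12 : a1 * a2 = a2 * a1 := (hcomm 1 2 (by decide) _ _ _ _).eq
    have s0 : star a0 = a0 := (CFC.sqrt_nonneg _).isSelfAdjoint
    have s1 : star a1 = a1 := (CFC.sqrt_nonneg _).isSelfAdjoint
    have s2 : star a2 = a2 := (CFC.sqrt_nonneg _).isSelfAdjoint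
    have hprod : (List.ofFn fun i => M i (q i) (a i)).prod
        = star (a0 * a1 * a2) * (a0 * a1 * a2) := by
      simp only [List.ofFn_succ, List.ofFn_zero, List.prod_cons, List.prod_nil, mul_one,
        Fin.succ_zero_eq_one, Fin.succ_one_eq_two]
      rw [← hss 0, ← hss 1, ← hss 2, ← ha0, ← ha1, ← ha2, star_mul, star_mul, s0, s1, s2]
      have e1 (x : H →L[ℂ] H) : a0 * (a1 * x) = a1 * (a0 * x) := by
        rw [← mul_assoc, c01, mul_assoc]
      have e2 (x : H →L[ℂ] H) : a0 * (a2 * x) = a2 * (a0 * x) := by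
        rw [← mul_assoc, c02, mul_assoc]
      have e3 (x : H →L[ℂ] H) : a1 * (a2 * x) = a2 * (a1 * x) := by
        rw [← mul_assoc, c12, mul_assoc]
      simp only [mul_assoc, e1, e2, e3, c01, c02, c12]
    rw [hprod, ContinuousLinearMap.apply_norm_sq_eq_inner_adjoint_right]
    rfl

end Commuting

/-! ### Tensor-product players as commuting-operator players -/

section Entangled

variable {m : ℕ} {d : Fin m → ℕ}

theorem tensorMatrix_mul (M N : (i : Fin m) → Matrix (Fin (d i)) (Fin (d i)) ℂ) :
    tensorMatrix M * tensorMatrix N = tensorMatrix fun i => M i * N i := by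
  ext j k
  simp only [tensorMatrix, Matrix.mul_apply, Matrix.of_apply, ← Finset.prod_mul_distrib]
  rw [Finset.prod_univ_sum, Fintype.piFinset_univ]

theorem tensorMatrix_conjTranspose (M : (i : Fin m) → Matrix (Fin (d i)) (Fin (d i)) ℂ) :
    (tensorMatrix M).conjTranspose = tensorMatrix fun i => (M i).conjTranspose := by
  ext j k
  simp [tensorMatrix, Matrix.conjTranspose_apply]

theorem tensorMatrix_one :
    tensorMatrix (fun i => (1 : Matrix (Fin (d i)) (Fin (d i)) ℂ)) = 1 := by
  ext j k
  simp only [tensorMatrix, Matrix.of_apply, Matrix.one_apply]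
  by_cases h : j = k
  · subst h; simp
  · rw [if_neg h]
    obtain ⟨i, hi⟩ := Function.ne_iff.1 h
    exact Finset.prod_eq_zero (Finset.mem_univ i) (if_neg hi)

/-- The operator of player `i` on the whole space. -/
def localMatrix (i : Fin m) (N : Matrix (Fin (d i)) (Fin (d i)) ℂ) :
    Matrix ((i : Fin m) → Fin (d i)) ((i : Fin m) → Fin (d i)) ℂ :=
  tensorMatrix (Function.update (fun _ => 1) i N)

theorem localMatrix_mul (i : Fin m) (N N' : Matrix (Fin (d i)) (Fin (d i)) ℂ) :
    localMatrix i N * localMatrix i N' = localMatrix i (N * N') := by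
  unfold localMatrix
  rw [tensorMatrix_mul]
  congr 1
  funext i'
  by_cases h : i' = i
  · subst h; simp
  · simp [Function.update_of_ne h]

theorem localMatrix_conjTranspose (i : Fin m) (N : Matrix (Fin (d i)) (Fin (d i)) ℂ) :
    (localMatrix i N).conjTranspose = localMatrix i N.conjTranspose := by
  unfold localMatrix
  rw [tensorMatrix_conjTranspose]
  congr 1
  funext i'
  by_cases h : i' = i
  · subst h; simp
  · simp [Function.update_of_ne h]

theorem localMatrix_one (i : Fin m) :
    localMatrix i (1 : Matrix (Fin (d i)) (Fin (d i)) ℂ) = 1 := by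
  unfold localMatrix
  rw [Function.update_eq_self_iff.2 rfl, tensorMatrix_one]

theorem localMatrix_sum {A : Type*} [Fintype A] (i : Fin m)
    (N : A → Matrix (Fin (d i)) (Fin (d i)) ℂ) :
    ∑ a, localMatrix i (N a) = localMatrix i (∑ a, N a) := by
  have h : ∀ (N : Matrix (Fin (d i)) (Fin (d i)) ℂ) j k, localMatrix i N j k
      = N (j i) (k i) * ∏ i' ∈ Finset.univ.erase i, (1 : Matrix (Fin (d i')) (Fin (d i')) ℂ)
        (j i') (k i') := by
    intro N j k
    unfold localMatrix tensorMatrix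
    rw [Matrix.of_apply, ← Finset.mul_prod_erase _ _ (Finset.mem_univ i)]
    congr 1
    · simp
    · refine Finset.prod_congr rfl fun i' hi' => ?_
      rw [Function.update_of_ne (Finset.ne_of_mem_erase hi')]
  ext j k
  rw [Matrix.sum_apply]
  simp only [h]
  rw [← Finset.sum_mul, Matrix.sum_apply]

theorem localMatrix_commute {i i' : Fin m} (hi : i ≠ i') (N : Matrix (Fin (d i)) (Fin (d i)) ℂ)
    (N' : Matrix (Fin (d i')) (Fin (d i')) ℂ) :
    Commute (localMatrix i N) (localMatrix i' N') := by
  unfold localMatrix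
  rw [commute_iff_eq, tensorMatrix_mul, tensorMatrix_mul]
  congr 1
  funext l
  by_cases h : l = i
  · subst h; simp [Function.update_of_ne hi]
  · simp [Function.update_of_ne h]

theorem localMatrix_prod_three {d : Fin 3 → ℕ} (N : (i : Fin 3) → Matrix (Fin (d i)) (Fin (d i)) ℂ) :
    localMatrix 0 (N 0) * (localMatrix 1 (N 1) * localMatrix 2 (N 2)) = tensorMatrix N := by
  unfold localMatrix
  rw [tensorMatrix_mul, tensorMatrix_mul]
  congr 1
  funext l
  fin_cases l
  · simp
  · simp
  · simp

open scoped ComplexOrder MatrixOrder in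
theorem exists_eq_conjTranspose_mul_self {n : Type*} [Fintype n] [DecidableEq n]
    {N : Matrix n n ℂ} (hN : N.PosSemidef) : ∃ B : Matrix n n ℂ, N = B.conjTranspose * B := by
  have h := CFC.sqrt_mul_sqrt_self N hN.nonneg
  have h2 : IsSelfAdjoint (CFC.sqrt N) := (CFC.sqrt_nonneg N).isSelfAdjoint
  refine ⟨CFC.sqrt N, ?_⟩
  rw [← Matrix.star_eq_conjTranspose, h2.star_eq, h]

open scoped ComplexOrder in
theorem toEuclideanCLM_isPositive {n : Type*} [Fintype n] [DecidableEq n] (B : Matrix n n ℂ) :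
    (Matrix.toEuclideanCLM (𝕜 := ℂ) (B.conjTranspose * B)).IsPositive := by
  rw [← ContinuousLinearMap.nonneg_iff_isPositive, map_mul, ← Matrix.star_eq_conjTranspose, map_star]
  exact star_mul_self_nonneg _

/-- The conjugated rows of `C` are vectors whose rank-one projectors, unnormalised, add up to the
matrix `C.conjTranspose * C`. -/
theorem inner_toEuclideanCLM {n : Type*} [Fintype n] [DecidableEq n] (C X : Matrix n n ℂ) :
    ∑ k, inner ℂ (WithLp.toLp 2 fun j => star (C k j) : EuclideanSpace ℂ n)
      (Matrix.toEuclideanCLM (𝕜 := ℂ) X (WithLp.toLp 2 fun j => star (C k j)))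
      = (C.conjTranspose * C * X).trace := by
  rw [mul_assoc, Matrix.trace_mul_comm, Matrix.trace]
  refine Finset.sum_congr rfl fun k _ => ?_
  rw [EuclideanSpace.inner_eq_star_dotProduct, Matrix.toEuclideanCLM_toLp, Matrix.diag_apply,
    mul_assoc, Matrix.mul_apply, dotProduct]
  refine Finset.sum_congr rfl fun j _ => ?_
  simp only [Pi.star_apply, star_star]
  rw [mul_comm]
  rfl

open scoped ComplexOrder in
/-- Players who measure their tensor factors are commuting-operator players. -/
theorem IsEntangled.isCommutingOperator {Q A : Type} [Fintype A] {S : Behavior 3 Q A}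
    (hS : IsEntangled S) : IsCommutingOperator S := by
  obtain ⟨d, ρ, M, hρ, htr, hM, hM1, hSM⟩ := hS
  obtain ⟨C, rfl⟩ := exists_eq_conjTranspose_mul_self hρ
  let v : ((i : Fin 3) → Fin (d i)) → EuclideanSpace ℂ ((i : Fin 3) → Fin (d i)) :=
    fun k => WithLp.toLp 2 fun j => star (C k j)
  -- States are sequences of vectors, so the finite family is placed in `ℕ` and extended by zero
  -- vectors.
  let g : ((i : Fin 3) → Fin (d i)) → ℕ := fun k => Fintype.equivFin _ k
  have hg : Function.Injective g := Fin.val_injective.comp (Equiv.injective _)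
  have hsum (F : EuclideanSpace ℂ ((i : Fin 3) → Fin (d i)) → ℝ) (hF : F 0 = 0) :
      HasSum (fun k => F (Function.extend g v 0 k)) (∑ k, F (v k)) := by
    have e : (fun k => F (Function.extend g v 0 k)) = Function.extend g (fun k => F (v k)) 0 := by
      funext k
      rw [Function.apply_extend F]
      congr 1
      funext n
      simp [hF]
    rw [e, hasSum_extend_zero hg]
    exact hasSum_fintype _
  have htrace (X : Matrix ((i : Fin 3) → Fin (d i)) ((i : Fin 3) → Fin (d i)) ℂ) :
      HasSum (fun k => (inner ℂ (Function.extend g v 0 k) (Matrix.toEuclideanCLM (𝕜 := ℂ) X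
        (Function.extend g v 0 k))).re) (C.conjTranspose * C * X).trace.re := by
    have := hsum (fun w => (inner ℂ w (Matrix.toEuclideanCLM (𝕜 := ℂ) X w)).re) (by simp)
    rw [← Complex.re_sum, inner_toEuclideanCLM] at this
    exact this
  refine ⟨EuclideanSpace ℂ ((i : Fin 3) → Fin (d i)), inferInstance, inferInstance, inferInstance,
    Function.extend g v 0, fun i q a => Matrix.toEuclideanCLM (𝕜 := ℂ) (localMatrix i (M i q a)),
    ?_, fun i q a => ?_, fun i q => ?_, fun i i' hi q a q' a' => ?_, fun q a => ?_⟩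
  · have h := htrace 1
    rw [mul_one, htr, Complex.one_re] at h
    convert h using 2 with k
    rw [map_one, one_apply_eq_self, inner_self_eq_norm_sq_to_K]
    norm_cast
  · obtain ⟨B, hB⟩ := exists_eq_conjTranspose_mul_self (hM i q a)
    beta_reduce
    rw [hB, ← localMatrix_mul, ← localMatrix_conjTranspose]
    exact toEuclideanCLM_isPositive _
  · rw [← map_sum, localMatrix_sum, hM1, localMatrix_one, map_one]
  · exact (localMatrix_commute hi _ _).map _
  · rw [hSM, ← (htrace _).tsum_eq]
    simp only [List.ofFn_succ, List.ofFn_zero, List.prod_cons, List.prod_nil, mul_one,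
        Fin.succ_zero_eq_one, Fin.succ_one_eq_two, ← map_mul]
    rw [localMatrix_prod_three (fun i => M i (q i) (a i))]

end Entangled
-- The three-prover proof system and its questions
theorem monotone_eval_nat (p : Polynomial ℕ) : Monotone fun n : ℕ => p.eval n := by
  intro m n h
  simp only [Polynomial.eval_eq_sum_range]
  gcongr

/-- The part of a question to the first prover that follows the encoded private memory. -/
def afterString : List Bool → List Bool
  | true :: _ :: l => afterString l
  | false :: l => l
  | _ => []

/-- Pushing reverses the memory and parsing reverses it again. A `true` before each bit and a
`false` at the end make the code self-delimiting, so that an honest first prover finds the address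
behind it. -/
theorem parseString_pushString (m l s : List Bool) :
    Judge.parseString (Ask.pushString m (false :: l)) s = m ++ s ∧
      afterString (Ask.pushString m (false :: l)) = l := by
  have h (m : List Bool) : ∀ r, Ask.pushString m r = m.reverse.flatMap (fun b => [true, b]) ++ r := by
    induction m with
    | nil => intro r; rfl
    | cons b m ih =>
      intro r
      change Ask.pushString m (true :: b :: r) = _
      simp [ih]
  have h' (n : List Bool) : ∀ s, Judge.parseString (n.flatMap (fun b => [true, b]) ++ false :: l) s
      = n.reverse ++ s ∧ afterString (n.flatMap (fun b => [true, b]) ++ false :: l) = l := by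
    induction n with
    | nil => intro s; simp [Judge.parseString, afterString]
    | cons b n ih =>
      intro s
      simp only [List.flatMap_cons, List.cons_append, List.nil_append, Judge.parseString,
        afterString, ih, List.reverse_cons, List.append_assoc]
      exact ⟨trivial, (ih []).2⟩
  rw [h]
  simpa using h' m.reverse s

namespace PCPVerifier

variable (V : PCPVerifier 3)

/-- The three-prover proof system of a PCP verifier with three queries. -/
noncomputable def threeProver : MIPVerifier 3 where
  ask := Ask.machine V.query
  judge := Judge.machine V.decide
  askTime := 16 * V.queryTime + 12
  judgeTime := V.decideTime.comp (Polynomial.X + 3) + 3 * Polynomial.X + 12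
  answerLength := 1
  coins n := V.coins n + 4
  ask_halts x ω := by
    obtain ⟨n, hn, s, hr, -⟩ := Ask.run_machine x ω _ (fun _ => rfl) (V.query_halts x _)
    unfold Machine.HaltsBy
    rw [hr.run_eq rfl (by simpa using hn)]
    rfl
  ask_coins x ω t := by
    obtain ⟨n, hn, s, hr, -⟩ := Ask.run_machine x ω _ (fun _ => rfl) (V.query_halts x _)
    have h := hr.run_eq (t := max t n) rfl (le_max_right _ _)
    refine (Machine.tossed_run_mono (M := Ask.machine V.query) (fun _ => x)
      (le_max_left t n)).trans ?_
    simp only [h]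
    exact Nat.add_le_add_right (V.query_coins x _ _) 4
  judge_det := Judge.machine_isDeterministic _ V.decide_det
  judge_halts x q a := by
    obtain ⟨n, hn, c, hr, hc, -⟩ := Judge.run_machine x q a (fun _ => V.decide_halts x _ _)
    unfold Machine.HaltsBy
    rw [hr.run_eq hc]
    · exact hc
    · refine hn.trans ?_
      have hp := Judge.length_parseString_le (q 0).tail []
      have hq : (q 0).length ≤ ∑ i, (q i).length :=
        Finset.single_le_sum (f := fun i => (q i).length) (fun _ _ => Nat.zero_le _)
          (Finset.mem_univ 0)
      have ht := List.length_tail (l := q 0)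
      -- The extracted memory may be shorter than the questions, so monotonicity of polynomials over
      -- `ℕ` is needed to bound the decision time by the total length.
      have hm := monotone_eval_nat V.decideTime
        (show x.length + (Judge.parseString (q 0).tail []).length + 3
          ≤ x.length + ∑ i, (q i).length + ∑ i, (a i).length + 3 by simp at hp; omega)
      simp only [Polynomial.eval_add, Polynomial.eval_comp, Polynomial.eval_mul, Polynomial.eval_X,
        Polynomial.eval_ofNat] at hm ⊢
      omega

variable {V} (x : List Bool)

theorem threeProver_accepts (q a : Fin 3 → List Bool) :
    V.threeProver.Accepts x q a ↔ if (q 0).head? = (q 1).head? then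
      Judge.bits a 0 = Judge.bits a 1 ∧ Judge.bits a 1 = Judge.bits a 2 else
      V.decide.output (deciderInput x (Judge.parseString (q 0).tail []) (Judge.bits a))
        (fun _ => false)
        (V.decideTime.eval (x.length + (Judge.parseString (q 0).tail []).length + 3)) ()
          = [true] := by
  obtain ⟨n, hn, c, hr, hc, h⟩ := Judge.run_machine x q a (fun _ => V.decide_halts x _ _)
  rw [← h]
  unfold MIPVerifier.Accepts Machine.output
  have e : V.threeProver.judge.run (refereeInput x q a) (fun _ => false) (V.threeProver.judgeTime.eval
      (x.length + ∑ i, (q i).length + ∑ i, (a i).length)) = c := by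
    have h1 := V.threeProver.judge_halts x q a
    set T := V.threeProver.judgeTime.eval (x.length + ∑ i, (q i).length + ∑ i, (a i).length)
    -- Two times at which the machine has halted are compared through their maximum.
    have h2 := hr.run_eq (t := max T n) hc (le_max_right _ _)
    rw [← h2]
    exact (Machine.Reaches.run_eq (M := V.threeProver.judge) rfl h1 (le_max_left T n)).symm
  rw [e]
  exact Iff.rfl

/-- The questions of the test `τ` if the simulated verifier has the coins `ρ`. -/
noncomputable def questionOf (V : PCPVerifier 3) (x : List Bool) (τ : Test)
    (ρ : Fin (V.coins x.length) → Bool) : Fin 3 → List Bool :=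
  Ask.question τ (fun k => V.queryOutput x ρ (.address k)) (V.queryOutput x ρ .memory)

theorem coinSeq_cons_succ {R : ℕ} (b : Bool) (ρ : Fin R → Bool) (i : ℕ) :
    coinSeq (Fin.cons b ρ : Fin (R + 1) → Bool) (i + 1) = coinSeq ρ i := by
  unfold coinSeq
  by_cases h : i < R
  · rw [dif_pos h, dif_pos (by omega)]
    exact Fin.cons_succ (α := fun _ => Bool) b ρ ⟨i, h⟩
  · rw [dif_neg h, dif_neg (by omega)]

theorem coinSeq_cons_zero {R : ℕ} (b : Bool) (ρ : Fin R → Bool) :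
    coinSeq (Fin.cons b ρ : Fin (R + 1) → Bool) 0 = b := by
  unfold coinSeq
  rw [dif_pos (by omega)]
  rfl

/-- The first four coins select the test, and the simulated verifier sees the remaining sequence
unchanged. -/
theorem threeProver_questions (b0 b1 b2 b3 : Bool) (ρ : Fin (V.coins x.length) → Bool) :
    V.threeProver.questions x (Fin.cons b0 (Fin.cons b1 (Fin.cons b2 (Fin.cons b3 ρ :
      Fin (V.coins x.length + 1) → Bool) : Fin (V.coins x.length + 2) → Bool) :
      Fin (V.coins x.length + 3) → Bool) : Fin (V.coins x.length + 4) → Bool)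
      = V.questionOf x (testOf b0 b1 b2 b3) ρ := by
  set ω := coinSeq (Fin.cons b0 (Fin.cons b1 (Fin.cons b2 (Fin.cons b3 ρ :
      Fin (V.coins x.length + 1) → Bool) : Fin (V.coins x.length + 2) → Bool) :
      Fin (V.coins x.length + 3) → Bool) : Fin (V.coins x.length + 4) → Bool) with hω
  have h4 (i : ℕ) : ω (i + 4) = coinSeq ρ i := by
    rw [hω, show i + 4 = i + 3 + 1 from rfl, coinSeq_cons_succ, coinSeq_cons_succ,
      coinSeq_cons_succ, coinSeq_cons_succ]
  have h0 : ω 0 = b0 := coinSeq_cons_zero _ _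
  have h1 : ω 1 = b1 := (coinSeq_cons_succ _ _ 0).trans (coinSeq_cons_zero _ _)
  have h2 : ω 2 = b2 := ((coinSeq_cons_succ _ _ 1).trans (coinSeq_cons_succ _ _ 0)).trans
    (coinSeq_cons_zero _ _)
  have h3 : ω 3 = b3 := (((coinSeq_cons_succ _ _ 2).trans (coinSeq_cons_succ _ _ 1)).trans
    (coinSeq_cons_succ _ _ 0)).trans (coinSeq_cons_zero _ _)
  obtain ⟨n, hn, s, hr, hs⟩ := Ask.run_machine x ω (coinSeq ρ) h4 (V.query_halts x _)
  rw [h0, h1, h2, h3] at hs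
  funext p
  refine Eq.trans ?_ (hs p)
  have e : V.threeProver.ask.run (fun _ => x) ω (V.threeProver.askTime.eval x.length) = _ :=
    hr.run_eq rfl (by simpa [threeProver] using hn)
  unfold MIPVerifier.questions Machine.output
  exact congrFun (congrArg Cfg.stk e) _

/-- The simulated verifier accepts if the proof bits are `β`. -/
def Decides (V : PCPVerifier 3) (x : List Bool) (ρ : Fin (V.coins x.length) → Bool)
    (β : Fin 3 → Bool) : Prop :=
  V.decide.output (deciderInput x (V.queryOutput x ρ .memory) β) (fun _ => false)
    (V.decideTime.eval (x.length + (V.queryOutput x ρ .memory).length + 3)) () = [true]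

/-- The answers `β` pass the test `τ`. -/
def Passes (V : PCPVerifier 3) (x : List Bool) (τ : Test) (ρ : Fin (V.coins x.length) → Bool)
    (β : Fin 3 → Bool) : Prop :=
  if τ.2.1 = τ.2.2 then β 0 = β 1 ∧ β 1 = β 2 else V.Decides x ρ β

/-- Answers of one bit. -/
noncomputable def answerEquiv (n : ℕ) :
    (Fin ((1 : Polynomial ℕ).eval n) → Bool) ≃ Bool :=
  (Equiv.arrowCongr (finCongr Polynomial.eval_one) (Equiv.refl _)).trans
    (Equiv.funUnique (Fin 1) Bool)

theorem head?_ofFn (n : ℕ) (a : Fin ((1 : Polynomial ℕ).eval n) → Bool) :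
    (List.ofFn a).head?.getD false = answerEquiv n a := by
  unfold answerEquiv
  generalize_proofs h
  revert h a
  -- The answer length is a polynomial value that equals 1 only propositionally; it is generalised
  -- to allow substitution.
  generalize (1 : Polynomial ℕ).eval n = k
  intro a h
  subst h
  rfl

theorem wins_questionOf (τ : Test) (ρ : Fin (V.coins x.length) → Bool)
    (a : Fin 3 → Fin (V.threeProver.answerLength.eval x.length) → Bool) :
    (V.threeProver.game x).wins (V.questionOf x τ ρ) a ↔
      V.Passes x τ ρ fun i => answerEquiv x.length (a i) := by
  have hb : Judge.bits (fun i => List.ofFn (a i)) = fun i => answerEquiv x.length (a i) :=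
    funext fun i => head?_ofFn x.length (a i)
  change V.threeProver.Accepts x _ _ ↔ _
  rw [threeProver_accepts, hb]
  unfold Passes Decides questionOf Ask.question
  simp only [Matrix.cons_val_zero, Matrix.cons_val_one, List.head?_cons, Option.some.injEq,
    List.tail_cons, (parseString_pushString _ _ _).1, List.append_nil]

end PCPVerifier

/-! ### Values of games and the winning probability as a weighted sum of tests -/

theorem sum_fin_succ_arrow {n : ℕ} (F : (Fin (n + 1) → Bool) → ℝ) :
    ∑ ρ, F ρ = ∑ b, ∑ ρ : Fin n → Bool, F (Fin.cons b ρ : Fin (n + 1) → Bool) := by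
  rw [← (Fin.consEquiv fun _ : Fin (n + 1) => Bool).sum_comp, Fintype.sum_prod_type]
  rfl

/-- The uniform test has consistency tests with weights `4`, `4`, `4`, `3` and the simulation test with
weight `1`. -/
theorem sum_testOf (g : Test → ℝ) :
    ∑ b0, ∑ b1, ∑ b2, ∑ b3, g (testOf b0 b1 b2 b3) = g (id, false, true)
      + 3 * g (fun _ => 1, true, true) + 4 * ∑ j, g (fun _ => j, false, false) := by
  simp only [Fintype.sum_bool, testOf, Fin.sum_univ_three]
  ring

section Game

variable {m : ℕ} {Q A : Type} [Fintype A]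

open Classical in
theorem Game.winProb_le_one (G : Game m Q A) {S : Behavior m Q A} (h0 : ∀ q a, 0 ≤ S q a)
    (h1 : ∀ q, ∑ a, S q a ≤ 1) : G.winProb S ≤ 1 := by
  rw [← G.total]
  refine Finset.sum_le_sum fun q _ => mul_le_of_le_one_right (G.nonneg q) ?_
  refine (Finset.sum_le_sum fun a _ => ?_).trans (h1 q)
  exact mul_le_of_le_one_right (h0 q a) (by split_ifs <;> norm_num)

open Classical in
theorem IsClassical.winProb_le_one (G : Game m Q A) {S : Behavior m Q A} (hS : IsClassical S) :
    G.winProb S ≤ 1 := by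
  obtain ⟨N, p, f, hp, hp1, hS⟩ := hS
  refine G.winProb_le_one (fun q a => ?_) (fun q => ?_)
  · rw [hS]
    exact Finset.sum_nonneg fun j _ => mul_nonneg (hp j) (by split_ifs <;> norm_num)
  · simp only [hS]
    rw [Finset.sum_comm]
    refine (Finset.sum_le_sum fun j _ => ?_).trans_eq hp1
    have (a : Fin m → A) : (∀ i, f j i (q i) = a i) ↔ (fun i => f j i (q i)) = a :=
      funext_iff.symm
    simp [this]

theorem IsCommutingOperator.winProb_le_one {S : Behavior 3 Q A} (hS : IsCommutingOperator S)
    (G : Game 3 Q A) (e : A ≃ Bool) : G.winProb S ≤ 1 := by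
  obtain ⟨H, _, _, _, ψ, hψ, R, hR, h1, hS⟩ := hS.exists_strategy e
  refine G.winProb_le_one (fun q a => ?_) (fun q => ?_)
  · rw [hS]
    exact answerProb_nonneg _ _
  · simp only [hS]
    have := ((Equiv.refl (Fin 3)).arrowCongr e).sum_comp (answerProb ψ hψ R q)
    rw [hR.sum_answerProb, h1, one_pow] at this
    exact this.le

theorem IsClassical.winProb_le_classicalValue {S : Behavior m Q A} (hS : IsClassical S)
    (G : Game m Q A) : G.winProb S ≤ G.classicalValue := by
  refine le_csSup ⟨1, ?_⟩ ⟨S, hS, rfl⟩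
  rintro w ⟨S, hS, rfl⟩
  exact hS.winProb_le_one G

theorem IsCommutingOperator.winProb_le_commutingValue {S : Behavior 3 Q A}
    (hS : IsCommutingOperator S) (G : Game 3 Q A) (e : A ≃ Bool) :
    G.winProb S ≤ G.commutingValue := by
  refine le_csSup ⟨1, ?_⟩ ⟨S, hS, rfl⟩
  rintro w ⟨S, hS, rfl⟩
  exact hS.winProb_le_one G e

theorem IsEntangled.winProb_le_entangledValue {S : Behavior 3 Q A}
    (hS : IsEntangled S) (G : Game 3 Q A) (e : A ≃ Bool) :
    G.winProb S ≤ G.entangledValue := by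
  refine le_csSup ⟨1, ?_⟩ ⟨S, hS, rfl⟩
  rintro w ⟨S, hS, rfl⟩
  exact hS.isCommutingOperator.winProb_le_one G e

open Classical in
/-- The behavior of players who give the answers `f`. -/
noncomputable def deterministic (f : Fin m → Q → A) : Behavior m Q A := fun q a =>
  if ∀ i, f i (q i) = a i then 1 else 0

theorem isClassical_deterministic (f : Fin m → Q → A) : IsClassical (deterministic f) :=
  ⟨1, fun _ => 1, fun _ => f, by simp, by simp,
    by simp [deterministic]⟩

open scoped ComplexOrder in
open Classical in
theorem isEntangled_deterministic (f : Fin m → Q → A) :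
    IsEntangled (deterministic f) := by
  refine ⟨fun _ => 1, 1, fun i q a => if f i q = a then 1 else 0, Matrix.PosSemidef.one, ?_,
    fun i q a => ?_, fun i q => ?_, fun q a => ?_⟩
  · simp
  · dsimp only
    split_ifs
    · exact Matrix.PosSemidef.one
    · exact Matrix.PosSemidef.zero
  · simp
  · rw [one_mul]
    simp only [Matrix.trace, Fintype.sum_unique, Matrix.diag, tensorMatrix, Matrix.of_apply]
    by_cases h : ∀ i, f i (q i) = a i
    · simp [deterministic, h]
    · obtain ⟨i, hi⟩ := not_forall.1 h
      rw [deterministic, if_neg h, Finset.prod_eq_zero (Finset.mem_univ i) (by simp [hi])]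
      simp

end Game

namespace PCPVerifier

variable {V : PCPVerifier 3} (x : List Bool)

open Classical in
/-- The probability that the players win if the test is `τ` and the coins of the simulated verifier
are `ρ`. -/
noncomputable def passProb (V : PCPVerifier 3) (x : List Bool)
    (S : Behavior 3 (List Bool) (Fin ((1 : Polynomial ℕ).eval x.length) → Bool)) (τ : Test)
    (ρ : Fin (V.coins x.length) → Bool) : ℝ :=
  ∑ a, S (V.questionOf x τ ρ) a *
    if V.Passes x τ ρ (fun i => answerEquiv x.length (a i)) then 1 else 0

open Classical in
theorem winProb_threeProver
    (S : Behavior 3 (List Bool) (Fin ((1 : Polynomial ℕ).eval x.length) → Bool)) :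
    (V.threeProver.game x).winProb S = (∑ ρ, (V.passProb x S (id, false, true) ρ
      + 3 * V.passProb x S (fun _ => 1, true, true) ρ
      + 4 * ∑ j, V.passProb x S (fun _ => j, false, false) ρ)) / (16 * 2 ^ V.coins x.length) := by
  let T (q : Fin 3 → List Bool) : ℝ := ∑ a, S q a *
    if (V.threeProver.game x).wins q a then 1 else 0
  have hT (τ : Test) (ρ : Fin (V.coins x.length) → Bool) :
      T (V.questionOf x τ ρ) = V.passProb x S τ ρ := by
    refine Finset.sum_congr rfl fun a _ => ?_
    congr 1
    exact if_congr (wins_questionOf x τ ρ a) rfl rfl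
  have h1 : (V.threeProver.game x).winProb S = ∑ ρ : Fin (V.coins x.length + 4) → Bool,
      (2 ^ (V.coins x.length + 4) : ℝ)⁻¹ * T (V.threeProver.questions x ρ) := by
    change Finsupp.sum (∑ ρ : Fin (V.coins x.length + 4) → Bool,
      Finsupp.single (V.threeProver.questions x ρ) ((2 ^ (V.coins x.length + 4) : ℝ)⁻¹))
        (fun q p => p * T q) = _
    rw [← Finsupp.sum_finsetSum_index (fun _ => by simp) (fun _ _ _ => by ring)]
    exact Finset.sum_congr rfl fun ρ _ => Finsupp.sum_single_index (by simp)
  have h2 : ∑ ρ : Fin (V.coins x.length + 4) → Bool, T (V.threeProver.questions x ρ)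
      = ∑ b0, ∑ b1, ∑ b2, ∑ b3, ∑ ρ, V.passProb x S (testOf b0 b1 b2 b3) ρ := by
    rw [sum_fin_succ_arrow]
    refine Finset.sum_congr rfl fun b0 _ => ?_
    rw [sum_fin_succ_arrow]
    refine Finset.sum_congr rfl fun b1 _ => ?_
    rw [sum_fin_succ_arrow]
    refine Finset.sum_congr rfl fun b2 _ => ?_
    rw [sum_fin_succ_arrow]
    refine Finset.sum_congr rfl fun b3 _ => Finset.sum_congr rfl fun ρ _ => ?_
    rw [threeProver_questions, hT]
  rw [h1, ← Finset.mul_sum, h2, sum_testOf fun τ => ∑ ρ, V.passProb x S τ ρ, Finset.sum_comm]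
  simp only [Finset.sum_add_distrib, ← Finset.mul_sum]
  rw [pow_add]
  field_simp
  ring

end PCPVerifier

/-! ### Completeness and soundness -/

namespace PCPVerifier

variable {V : PCPVerifier 3} (x : List Bool)

/-- The answers of honest players who know the string `proof`. -/
def honestAnswer (proof : List Bool → Bool) (p : Fin 3) (w : List Bool) : Bool :=
  proof (![(afterString w.tail).reverse, w.tail.reverse, w.reverse] p)

theorem honestAnswer_questionOf (proof : List Bool → Bool) (τ : Test)
    (ρ : Fin (V.coins x.length) → Bool) (p : Fin 3) :
    honestAnswer proof p (V.questionOf x τ ρ p) = proof (V.queryOutput x ρ (.address (τ.1 p))) := by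
  unfold honestAnswer questionOf Ask.question
  fin_cases p <;> simp [(parseString_pushString _ _ []).2]

/-- The behavior of honest players who know the string `proof`. -/
noncomputable def honestBehavior (n : ℕ) (proof : List Bool → Bool) :
    Behavior 3 (List Bool) (Fin ((1 : Polynomial ℕ).eval n) → Bool) :=
  deterministic fun i q => (answerEquiv n).symm (honestAnswer proof i q)

theorem isClassical_honestBehavior (n : ℕ) (proof : List Bool → Bool) :
    IsClassical (honestBehavior n proof) :=
  isClassical_deterministic _

theorem isEntangled_honestBehavior (n : ℕ) (proof : List Bool → Bool) :
    IsEntangled (honestBehavior n proof) :=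
  isEntangled_deterministic _

theorem passProb_honestBehavior {proof : List Bool → Bool} {τ : Test}
    {ρ : Fin (V.coins x.length) → Bool}
    (hτ : V.Passes x τ ρ fun i => proof (V.queryOutput x ρ (.address (τ.1 i)))) :
    V.passProb x (honestBehavior x.length proof) τ ρ = 1 := by
  classical
  unfold passProb
  rw [Finset.sum_eq_single fun i => (answerEquiv x.length).symm
    (proof (V.queryOutput x ρ (.address (τ.1 i))))]
  · simp only [honestBehavior, deterministic, honestAnswer_questionOf, Equiv.apply_symm_apply, hτ, implies_true,
      if_true, mul_one]
  · intro a _ ha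
    refine mul_eq_zero_of_left (if_neg fun h => ?_) _
    refine ha (funext fun i => ?_)
    exact (h i).symm.trans (congrArg _ (honestAnswer_questionOf x proof τ ρ i))
  · simp

theorem winProb_honestBehavior {proof : List Bool → Bool} (h : ∀ ρ, V.Accepts x proof ρ) :
    (V.threeProver.game x).winProb (honestBehavior x.length proof) = 1 := by
  have h1 (ρ) := passProb_honestBehavior (V := V) x (proof := proof) (τ := (id, false, true))
    (ρ := ρ) (by rw [Passes, if_neg (by simp)]; exact h ρ)
  have h2 (ρ) := passProb_honestBehavior (V := V) x (proof := proof)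
    (τ := (fun _ => 1, true, true)) (ρ := ρ) (by simp [Passes])
  have h3 (j : Fin 3) (ρ) := passProb_honestBehavior (V := V) x (proof := proof)
    (τ := (fun _ => j, false, false)) (ρ := ρ) (by simp [Passes])
  refine (winProb_threeProver x _).trans ?_
  simp only [h1, h2, h3]
  norm_num
  field_simp

theorem accepts_of_one_le_acceptProb {proof : List Bool → Bool} (h : 1 ≤ V.acceptProb x proof)
    (ρ : Fin (V.coins x.length) → Bool) : V.Accepts x proof ρ := by
  classical
  by_contra hρ
  unfold acceptProb at h
  rw [le_div_iff₀ (by positivity), one_mul] at h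
  have : (∑ ρ : Fin (V.coins x.length) → Bool, if V.Accepts x proof ρ then (1 : ℝ) else 0)
      < ∑ _ρ : Fin (V.coins x.length) → Bool, (1 : ℝ) :=
    Finset.sum_lt_sum (fun ρ _ => by split_ifs <;> norm_num)
      ⟨ρ, Finset.mem_univ _, by rw [if_neg hρ]; norm_num⟩
  simp only [Finset.sum_const, Finset.card_univ, Fintype.card_fun, Fintype.card_bool,
    Fintype.card_fin, nsmul_eq_mul, mul_one, Nat.cast_pow, Nat.cast_ofNat] at this
  refine absurd h (not_le.2 ?_)
  convert this

open Classical in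
theorem one_sub_passProb {H : Type} [NormedAddCommGroup H] [InnerProductSpace ℂ H]
    [CompleteSpace H] {ψ : ℕ → H} {hψ : Summable fun k => ‖ψ k‖ ^ 2}
    {R : Fin 3 → List Bool → Bool → H →L[ℂ] H} (hR : IsStrategy R)
    (h1 : stateSeminorm ψ hψ 1 = 1)
    {S : Behavior 3 (List Bool) (Fin ((1 : Polynomial ℕ).eval x.length) → Bool)}
    (hS : ∀ q a, S q a = answerProb ψ hψ R q fun i => answerEquiv x.length (a i)) (τ : Test)
    (ρ : Fin (V.coins x.length) → Bool) :
    1 - V.passProb x S τ ρ = ∑ β, if V.Passes x τ ρ β then 0 else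
      answerProb ψ hψ R (V.questionOf x τ ρ) β := by
  have h : V.passProb x S τ ρ = ∑ β, answerProb ψ hψ R (V.questionOf x τ ρ) β *
      if V.Passes x τ ρ β then 1 else 0 := by
    unfold passProb
    refine (Finset.sum_congr rfl fun a _ => congrArg (· * _) (hS _ a)).trans ?_
    exact ((Equiv.refl (Fin 3)).arrowCongr (answerEquiv x.length)).sum_comp fun β =>
      answerProb ψ hψ R (V.questionOf x τ ρ) β * if V.Passes x τ ρ β then 1 else 0
  have h' := hR.sum_answerProb (ψ := ψ) (hψ := hψ) (V.questionOf x τ ρ)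
  rw [h1, one_pow] at h'
  rw [h]
  refine (congrArg (· - _) h'.symm).trans ?_
  rw [← Finset.sum_sub_distrib]
  refine Finset.sum_congr rfl fun β _ => ?_
  split_ifs <;> simp

open Classical in
/-- Players who win with high probability yield a proof that is accepted with high probability. -/
theorem exists_proof_of_lt_winProb
    {S : Behavior 3 (List Bool) (Fin ((1 : Polynomial ℕ).eval x.length) → Bool)}
    (hS : IsCommutingOperator S) {h : ℝ} (h0 : 0 < h) (hle : h ≤ 1)
    (hw : 1 - h ^ 2 / (384 * (2 ^ V.coins x.length) ^ 2) < (V.threeProver.game x).winProb S) :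
    ∃ proof : List Bool → Bool, 1 - h < V.acceptProb x proof := by
  obtain ⟨H, _, _, _, ψ, hψ, R, hR, h1, hS⟩ := hS.exists_strategy (answerEquiv x.length)
  have hpass := fun τ ρ => one_sub_passProb (V := V) x hR h1 hS τ ρ
  have hw' : (V.threeProver.game x).winProb S = _ := winProb_threeProver x S
  rw [hw'] at hw
  set N : ℝ := 2 ^ V.coins x.length with hN
  have hN1 : 1 ≤ N := one_le_pow₀ one_le_two
  have hcard : (Fintype.card (Fin (V.coins x.length) → Bool) : ℝ) = N := by simp [hN]
  set σ : (Fin (V.coins x.length) → Bool) → ℝ := fun ρ => 1 - V.passProb x S (id, false, true) ρ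
    with hσ
  set δ' : (Fin (V.coins x.length) → Bool) → ℝ := fun ρ =>
    1 - V.passProb x S (fun _ => 1, true, true) ρ with hδ'
  set δ : (Fin (V.coins x.length) → Bool) × Fin 3 → ℝ := fun y =>
    1 - V.passProb x S (fun _ => y.2, false, false) y.1 with hδ
  have nonneg (τ ρ) : 0 ≤ 1 - V.passProb x S τ ρ := by
    rw [hpass]
    refine Finset.sum_nonneg fun β _ => ?_
    split_ifs
    exacts [le_rfl, answerProb_nonneg _ _]
  have hσ0 (ρ) : 0 ≤ σ ρ := nonneg _ _
  have hδ0' (ρ) : 0 ≤ δ' ρ := nonneg _ _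
  have hδ0 (y) : 0 ≤ δ y := nonneg _ _
  -- The test weights are 1, 3 and 4 out of 16, and `16 N · h² / (384 N²) = h² / (24 N)`.
  have htot : ∑ ρ, σ ρ + 3 * ∑ ρ, δ' ρ + 4 * ∑ y, δ y ≤ h ^ 2 / (24 * N) := by
    have e : ∑ ρ, σ ρ + 3 * ∑ ρ, δ' ρ + 4 * ∑ y, δ y
        = 16 * N - ∑ ρ, (V.passProb x S (id, false, true) ρ
          + 3 * V.passProb x S (fun _ => 1, true, true) ρ
          + 4 * ∑ j, V.passProb x S (fun _ => j, false, false) ρ) := by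
      rw [Fintype.sum_prod_type]
      simp only [hσ, hδ', hδ, Finset.sum_sub_distrib, Finset.sum_add_distrib, ← Finset.mul_sum,
        Finset.sum_const, Finset.card_univ, nsmul_eq_mul, mul_one, hcard, Fintype.card_fin]
      push_cast
      ring
    rw [e]
    rw [lt_div_iff₀ (by positivity)] at hw
    have : (1 - h ^ 2 / (384 * N ^ 2)) * (16 * N) = 16 * N - h ^ 2 / (24 * N) := by
      field_simp
      ring
    linarith
  have hbound : h ^ 2 / (24 * N) ≤ h ^ 2 / 24 :=
    div_le_div_of_nonneg_left (by positivity) (by norm_num) (by linarith)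
  have hσs : 0 ≤ ∑ ρ, σ ρ := Finset.sum_nonneg fun ρ _ => hσ0 ρ
  have hδs' : 0 ≤ ∑ ρ, δ' ρ := Finset.sum_nonneg fun ρ _ => hδ0' ρ
  have hδs : 0 ≤ ∑ y, δ y := Finset.sum_nonneg fun y _ => hδ0 y
  -- `Function.invFun addr` selects one place for each queried address. Bits read through it depend
  -- on the address alone, hence form a proof.
  let addr : (Fin (V.coins x.length) → Bool) × Fin 3 → List Bool := fun y =>
    V.queryOutput x y.1 (.address y.2)
  have haddr (y) : addr (Function.invFun addr (addr y)) = addr y := Function.invFun_eq ⟨y, rfl⟩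
  have key : ∃ b : (Fin (V.coins x.length) → Bool) × Fin 3 → Bool,
      (∑ ρ, if ¬ V.Decides x ρ (fun t => b (Function.invFun addr (addr (ρ, t)))) then (1 : ℝ)
        else 0) < h * N := by
    rw [← hcard]
    have := exists_assignment hR h1
      -- In the simulation test prover 0 receives its question from the consistency test at address
      -- 0, prover 1 that from the test with tags `true`, and prover 2 that from the consistency
      -- test at address 2.
      (qa := fun y => V.questionOf x (fun _ => y.2, false, false) y.1 0)
      (qb := fun y => false :: (addr y).reverse) (qc := fun y => (addr y).reverse)
      (qa' := fun ρ => V.questionOf x (fun _ => 1, true, true) ρ 0)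
      (qb' := fun ρ => true :: (addr (ρ, 1)).reverse)
      (rep := fun y => Function.invFun addr (addr y))
      (fun y => by simp only [haddr]) (fun y => by simp only [haddr])
      (fun ρ β => ¬ V.Decides x ρ β) h0 hle
    refine (this (fun ρ => ?_) (fun ρ => ?_) ?_).imp fun b hb => by convert hb
    · have : σ ρ ≤ ∑ ρ, σ ρ := Finset.single_le_sum (fun ρ _ => hσ0 ρ) (Finset.mem_univ ρ)
      refine le_trans (le_of_eq ?_) (show σ ρ ≤ _ by linarith)
      simp only [hσ]
      rw [hpass]
      refine Finset.sum_congr rfl fun β _ => ?_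
      have : V.Passes x (id, false, true) ρ β ↔ V.Decides x ρ β := by simp [Passes]
      by_cases hβ : V.Decides x ρ β
      · rw [if_pos (this.2 hβ), if_neg (not_not.2 hβ)]
      · rw [if_neg (mt this.1 hβ), if_pos hβ]
        rfl
    · have : δ' ρ ≤ ∑ ρ, δ' ρ := Finset.single_le_sum (fun ρ _ => hδ0' ρ) (Finset.mem_univ ρ)
      refine le_trans (le_of_eq ?_) (show 2 * δ' ρ ≤ _ by linarith)
      congr 1
      simp only [hδ']
      rw [hpass]
      refine Finset.sum_congr rfl fun β _ => ?_
      have : V.Passes x (fun _ => 1, true, true) ρ β ↔ β 0 = β 1 ∧ β 1 = β 2 := by simp [Passes]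
      simp only [this]
      rfl
    · have e (y : (Fin (V.coins x.length) → Bool) × Fin 3) : disagreeProb ψ hψ R
          ![V.questionOf x (fun _ => y.2, false, false) y.1 0, false :: (addr y).reverse,
            (addr y).reverse] = δ y := by
        simp only [hδ]
        rw [hpass]
        refine Finset.sum_congr rfl fun β _ => ?_
        have : V.Passes x (fun _ => y.2, false, false) y.1 β ↔ β 0 = β 1 ∧ β 1 = β 2 := by
          simp [Passes]
        simp only [this]
        rfl
      simp only [e]
      refine (sq_le_sq₀ (by positivity) (by positivity)).1 ?_
      -- Cauchy–Schwarz over the `3 N` places: `3 N · 2 · h² / (96 N) = h² / 16`.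
      have cs := sq_sum_le_card_mul_sum_sq (s := Finset.univ) (f := fun y => √(2 * δ y))
      have e2 : ∑ y, √(2 * δ y) ^ 2 = 2 * ∑ y, δ y := by
        rw [Finset.mul_sum]
        exact Finset.sum_congr rfl fun y _ => Real.sq_sqrt (by linarith [hδ0 y])
      have e3 : ((Finset.univ : Finset ((Fin (V.coins x.length) → Bool) × Fin 3)).card : ℝ)
          = N * 3 := by
        rw [Finset.card_univ, Fintype.card_prod, Nat.cast_mul, hcard]
        simp
      rw [e2, e3] at cs
      refine cs.trans ?_
      have h4 : 4 * ∑ y, δ y ≤ h ^ 2 / (24 * N) := by linarith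
      rw [le_div_iff₀ (by positivity)] at h4
      rw [div_pow]
      linarith
  obtain ⟨b, hb⟩ := key
  -- At addresses that are never queried the bit is arbitrary.
  refine ⟨fun w => b (Function.invFun addr w), ?_⟩
  unfold acceptProb
  rw [← hN, lt_div_iff₀ (by positivity)]
  have e : (∑ ρ, if V.Accepts x (fun w => b (Function.invFun addr w)) ρ then (1 : ℝ) else 0)
      = N - ∑ ρ, if ¬ V.Decides x ρ (fun t => b (Function.invFun addr (addr (ρ, t))))
        then (1 : ℝ) else 0 := by
    rw [← hcard, ← Finset.card_univ, Finset.cast_card, ← Finset.sum_sub_distrib]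
    refine Finset.sum_congr rfl fun ρ _ => ?_
    change (if V.Decides x ρ (fun t => b (Function.invFun addr (addr (ρ, t)))) then (1 : ℝ)
      else 0) = _
    split_ifs <;> simp
  rw [e]
  linarith

open Classical in
theorem commutingValue_threeProver_le {s : ℝ} {r : ℕ} (hs : s ∈ Set.Icc (0 : ℝ) 1)
    (hr : V.coins x.length ≤ r) (hV : ∀ proof, V.acceptProb x proof ≤ s) :
    (V.threeProver.game x).commutingValue ≤ 1 - 1 / 384 * (1 - s) ^ 2 * ((2 : ℝ) ^ (2 * r))⁻¹ := by
  have h0 : 0 ≤ 1 - s := by linarith [hs.2]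
  have h1 : 1 - s ≤ 1 := by linarith [hs.1]
  have hle : ((2 : ℝ) ^ (2 * r))⁻¹ ≤ ((2 ^ V.coins x.length) ^ 2)⁻¹ := by
    rw [← pow_mul, mul_comm _ 2]
    exact inv_anti₀ (by positivity) (pow_le_pow_right₀ one_le_two (by omega))
  have hle1 : ((2 : ℝ) ^ (2 * r))⁻¹ ≤ 1 := inv_le_one_of_one_le₀ (one_le_pow₀ one_le_two)
  have hsq : (1 - s) ^ 2 ≤ 1 := pow_le_one₀ h0 h1
  refine Real.sSup_le ?_ ?_
  · rintro w ⟨S, hS, rfl⟩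
    by_contra! hw
    -- Rounding needs `h = 1 - s` to be positive. For `s = 1` the claim is only that probabilities
    -- are at most 1.
    rcases h0.eq_or_lt with h | h
    · rw [← h] at hw
      have := hS.winProb_le_one (V.threeProver.game x) (answerEquiv x.length)
      norm_num at hw
      linarith
    · obtain ⟨proof, hp⟩ := exists_proof_of_lt_winProb x hS h h1 (lt_of_le_of_lt (by
        rw [div_eq_mul_inv, mul_inv]
        have := mul_le_mul_of_nonneg_left hle (show 0 ≤ 1 / 384 * (1 - s) ^ 2 by positivity)
        linarith) hw)
      linarith [hV proof]
  · have : 1 / 384 * (1 - s) ^ 2 * ((2 : ℝ) ^ (2 * r))⁻¹ ≤ 1 / 384 * 1 * 1 := by gcongr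
    linarith

theorem entangledValue_threeProver_le {c : ℝ} (h0 : 0 ≤ c)
    (hc : (V.threeProver.game x).commutingValue ≤ c) :
    (V.threeProver.game x).entangledValue ≤ c := by
  refine Real.sSup_le ?_ h0
  rintro w ⟨S, hS, rfl⟩
  exact (hS.isCommutingOperator.winProb_le_commutingValue _ (answerEquiv x.length)).trans hc

theorem one_le_values_threeProver {proof : List Bool → Bool} (h : 1 ≤ V.acceptProb x proof) :
    1 ≤ (V.threeProver.game x).classicalValue ∧ 1 ≤ (V.threeProver.game x).entangledValue := by
  have hw := winProb_honestBehavior x (accepts_of_one_le_acceptProb x h)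
  refine ⟨hw.symm.trans_le ?_, hw.symm.trans_le ?_⟩
  · exact (isClassical_honestBehavior _ _).winProb_le_classicalValue (V.threeProver.game x)
  · exact (isEntangled_honestBehavior _ _).winProb_le_entangledValue (V.threeProver.game x)
      (answerEquiv x.length)

end PCPVerifier

end ProverGames

/-! ### The theorem -/

theorem mainTheorem3 :
    ∃ C : ℕ, ∀ (s : ℕ → ℝ) (r : ℕ → ℕ) (ε : ℕ → ℝ),
      (∀ n, s n ∈ Set.Icc (0 : ℝ) 1) →
      (∀ n, ε n = 1 / 384 * (1 - s n) ^ 2 * ((2 : ℝ) ^ (2 * r n))⁻¹) →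
      naPCP (fun _ => 1) s r 3 ⊆ MIPStar (fun _ => 1) (fun n => 1 - ε n) 3 ∧
      ∀ L ∈ naPCP (fun _ => 1) s r 3, ∃ V : MIPVerifier 3,
        V.answerLength = 1 ∧
        (∀ n, V.coins n ≤ r n + C) ∧
        (∀ x ∈ L, 1 ≤ (V.game x).entangledValue) ∧
        (∀ x, x ∉ L → (V.game x).entangledValue ≤ 1 - ε x.length) ∧
        (∀ x ∈ L, 1 ≤ (V.game x).classicalValue) ∧
        (∀ x, x ∉ L → (V.game x).commutingValue ≤ 1 - ε x.length) := by
  -- Four extra coins choose the test.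
  refine ⟨4, fun s r ε hs hε => ?_⟩
  have main : ∀ L ∈ naPCP (fun _ => 1) s r 3, ∃ V : MIPVerifier 3,
        V.answerLength = 1 ∧
        (∀ n, V.coins n ≤ r n + 4) ∧
        (∀ x ∈ L, 1 ≤ (V.game x).entangledValue) ∧
        (∀ x, x ∉ L → (V.game x).entangledValue ≤ 1 - ε x.length) ∧
        (∀ x ∈ L, 1 ≤ (V.game x).classicalValue) ∧
        (∀ x, x ∉ L → (V.game x).commutingValue ≤ 1 - ε x.length) := by
    rintro L ⟨V, hr, hcomp, hsound⟩
    have hcom (x) (hx : x ∉ L) :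
        (V.threeProver.game x).commutingValue ≤ 1 - ε x.length := by
      rw [hε]
      exact PCPVerifier.commutingValue_threeProver_le x (hs _) (hr _) (hsound x hx)
    have hone (n : ℕ) : 0 ≤ 1 - ε n := by
      have h1 : (1 - s n) ^ 2 ≤ 1 := pow_le_one₀ (by linarith [(hs n).2]) (by linarith [(hs n).1])
      have h2 : ((2 : ℝ) ^ (2 * r n))⁻¹ ≤ 1 := inv_le_one_of_one_le₀ (one_le_pow₀ one_le_two)
      have : 1 / 384 * (1 - s n) ^ 2 * ((2 : ℝ) ^ (2 * r n))⁻¹ ≤ 1 / 384 * 1 * 1 := by gcongr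
      rw [hε]
      linarith
    refine ⟨V.threeProver, rfl, fun n => Nat.add_le_add_right (hr n) 4, fun x hx => ?_,
      fun x hx => PCPVerifier.entangledValue_threeProver_le x (hone _) (hcom x hx), fun x hx => ?_,
      hcom⟩
    · obtain ⟨proof, hp⟩ := hcomp x hx
      exact (PCPVerifier.one_le_values_threeProver x hp).2
    · obtain ⟨proof, hp⟩ := hcomp x hx
      exact (PCPVerifier.one_le_values_threeProver x hp).1
  refine ⟨fun L hL => ?_, main⟩
  obtain ⟨V, -, -, hc, hs, -, -⟩ := main L hL
  exact ⟨V, hc, hs⟩
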